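/- Let $R=\mathbb Z[a^{\pm1},b^{\pm1},c^{\pm1}]$, let $B_n$ be the braid group on $n$ strands with Artin generators $s_1,\dots,s_{n-1}$, and let $\mathrm Q_n$ be the quotient of the group algebra $RB_n$ by the two-sided ideal generated by the relations $(s_1-a)(s_1-b)(s_1-c)=0$ and $$s_1^{-1}s_2s_1=s_1s_2s_1^{-1}-a^{-1}s_1s_2+as_1s_2^{-1}+as_1^{-1}s_2-a^3s_1^{-1}s_2^{-1}+a^{-1}s_2s_1-as_2s_1^{-1}-as_2^{-1}s_1+a^3s_2^{-1}s_1^{-1}+a^2s_1^{-1}s_2^{-1}s_1-a^2s_1s_2^{-1}s_1^{-1}.$$ In $\mathrm Q_4$, let $\mathrm Q_3$ be the subalgebra generated by $s_1,s_2$ and $u_3$ the subalgebra generated by $s_3$. Write $i$ for $s_i$, $\bar i$ for $s_i^{-1}$ and $\emptyset$ for the empty word. Put $E=\{\emptyset,2,\bar2,12,1\bar2,\bar12,\bar1\bar2,2\bar12\}$, $E'=\{\emptyset,1,\bar1,21,2\bar1,\bar21,\bar2\bar1,1\bar21\}$, $E_0=\{\emptyset,1,\bar1,2,\bar2\}$,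 $F_2=\{3,\bar3,32,3\bar2,\bar32,321,\bar321,32\bar1,3\bar21\}$. Then $\mathrm Q_4$ is a free $R$-module of rank $264$. The $20$ words $\emptyset,1,\bar1,2,\bar2,12,1\bar2,\bar12,\bar1\bar2,21,2\bar1,\bar21,\bar2\bar1,121,12\bar1,1\bar21,1\bar2\bar1,\bar121,\bar12\bar1,2\bar12$ form an $R$-basis of $\mathrm Q_3$. Moreover, for every $R$-basis $\mathcal B_{(0)}$ of $\mathrm Q_3$ with $20$ elements (in particular for this one), the family of $239$ elements $$\mathcal B_{(1)}=\mathcal B_{(0)}\sqcup\mathcal B_{(0)}\times F_2\sqcup E'\times\{\bar3\bar2,\bar3\bar21\}\sqcup E_0\times\{\bar32\bar1\}\sqcup E\times\{3\bar2\bar1,32\bar12\}\sqcup\{\bar3\bar2\bar1,\bar32\bar12\}$$ (where $X\times Y$ denotes the family of products $xy$, $x\in X$, $y\in Y$) spans the $R$-module $\mathrm Q_3u_3\mathrm Q_3$, the images of the $25$ words $$\begin{array}{lllll} e_1=3\bar23& e_2=13\bar23& e_3=\bar13\bar23& e_4=213\bar23& e_5=2\bar13\bar23\\ e_6=\bar213\bar23&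 e_7=\bar2\bar13\bar23& e_8=3\bar231& e_9=3\bar23\bar1& e_{10}=3\bar2312\\ e_{11}=3\bar231\bar2& e_{12}=3\bar23\bar12& e_{13}=3\bar23\bar1\bar2& e_{14}=213\bar231& e_{15}=\bar213\bar231\\ e_{16}=13\bar2312& e_{17}=13\bar231\bar2& e_{18}=13\bar23\bar1& e_{19}=13\bar231& e_{20}=213\bar2312\\ e_{21}=213\bar231\bar2& e_{22}=32\bar123& e_{23}=\bar3\bar21\bar2\bar3& e_{24}=3\bar231\bar21& e_{25}=1\bar213\bar23 \end{array}$$ span the $R$-module $\mathrm Q_4/\mathrm Q_3u_3\mathrm Q_3$, and the family of $264$ elements $\mathcal B_{(2)}=\mathcal B_{(1)}\sqcup\{e_1,\dots,e_{25}\}$ is an $R$-basis of $\mathrm Q_4$. -/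

import Mathlib

namespace CubicQuotient

noncomputable section

/-- The ring `R = ℤ[a, b, c, (abc)⁻¹] = ℤ[a^{±1}, b^{±1}, c^{±1}]`. -/
abbrev R : Type :=
  Localization.Away (MvPolynomial.X 0 * MvPolynomial.X 1 * MvPolynomial.X 2 :
    MvPolynomial (Fin 3) ℤ)

theorem isUnit_var (i : Fin 3) :
    IsUnit (algebraMap (MvPolynomial (Fin 3) ℤ) R (MvPolynomial.X i)) := by
  refine isUnit_of_dvd_unit (map_dvd (algebraMap (MvPolynomial (Fin 3) ℤ) R) ?_)
    (IsLocalization.Away.algebraMap_isUnit (S := R)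
      (MvPolynomial.X 0 * MvPolynomial.X 1 * MvPolynomial.X 2 : MvPolynomial (Fin 3) ℤ))
  fin_cases i
  · exact (Dvd.intro _ rfl).mul_right _
  · exact (Dvd.intro_left _ rfl).mul_right _
  · exact Dvd.intro_left _ rfl

/-- The unit `a` of `R`. -/
def a : Rˣ := (isUnit_var 0).unit
/-- The unit `b` of `R`. -/
def b : Rˣ := (isUnit_var 1).unit
/-- The unit `c` of `R`. -/
def c : Rˣ := (isUnit_var 2).unit

/-- Artin's relations between the generators `s_1, …, s_{n-1}` (indexed from `0`). -/
def braidRels (n : ℕ) : Set (FreeGroup (Fin (n - 1))) :=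
  {r | ∃ i j : Fin (n - 1), (i : ℕ) + 1 = j ∧
      r = FreeGroup.of i * FreeGroup.of j * FreeGroup.of i *
        (FreeGroup.of j * FreeGroup.of i * FreeGroup.of j)⁻¹} ∪
  {r | ∃ i j : Fin (n - 1), (i : ℕ) + 1 < j ∧
      r = FreeGroup.of i * FreeGroup.of j * (FreeGroup.of j * FreeGroup.of i)⁻¹}

/-- The braid group on `n` strands. -/
abbrev BraidGroup (n : ℕ) : Type := PresentedGroup (braidRels n)

/-- The Artin generator `s_{i+1}`. -/
def gen {n : ℕ} (i : Fin (n - 1)) : BraidGroup n := PresentedGroup.of i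

/-- The group algebra `R B_n`. -/
abbrev BraidAlgebra (n : ℕ) : Type := MonoidAlgebra R (BraidGroup n)

/-- A braid as an element of the group algebra. -/
def br {n : ℕ} (g : BraidGroup n) : BraidAlgebra n := MonoidAlgebra.of R (BraidGroup n) g

/-- The defining relations of `Q_n` in `R B_n`: the cubic relation on `s = s_1`, and the relation
on three strands between `s = s_1` and `t = s_2`. -/
inductive QRel (n : ℕ) : BraidAlgebra n → BraidAlgebra n → Prop
  | cubic (i : Fin (n - 1)) (hi : (i : ℕ) = 0) :
      QRel n
        ((br (gen i) - algebraMap R (BraidAlgebra n) a) *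
          (br (gen i) - algebraMap R (BraidAlgebra n) b) *
          (br (gen i) - algebraMap R (BraidAlgebra n) c))
        0
  | three (i j : Fin (n - 1)) (hi : (i : ℕ) = 0) (hj : (j : ℕ) = 1)
      (s t : BraidGroup n) (hs : s = gen i) (ht : t = gen j) :
      QRel n
        (br (s⁻¹ * t * s))
        (br (s * t * s⁻¹)
          - (a⁻¹ : Rˣ) • br (s * t) + a • br (s * t⁻¹) + a • br (s⁻¹ * t)
          - a ^ 3 • br (s⁻¹ * t⁻¹)
          + (a⁻¹ : Rˣ) • br (t * s) - a • br (t * s⁻¹) - a • br (t⁻¹ * s)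
          + a ^ 3 • br (t⁻¹ * s⁻¹)
          + a ^ 2 • br (s⁻¹ * t⁻¹ * s) - a ^ 2 • br (s * t⁻¹ * s⁻¹))

/-- The algebra `Q_n`: the quotient of `R B_n` by the two-sided ideal of the relations `QRel n`. -/
abbrev Q (n : ℕ) : Type := RingQuot (QRel n)

/-- The image of a braid in `Q_n`. -/
def toQ {n : ℕ} (g : BraidGroup n) : Q n := RingQuot.mkAlgHom R (QRel n) (br g)

/-! ### Four strands -/

/-- The generator `s_1` of the braid group on four strands. -/
def s₁ : BraidGroup 4 := gen ⟨0, by decide⟩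
/-- The generator `s_2`. -/
def s₂ : BraidGroup 4 := gen ⟨1, by decide⟩
/-- The generator `s_3`. -/
def s₃ : BraidGroup 4 := gen ⟨2, by decide⟩

/-- `Q_3` as the subalgebra of `Q_4` generated by `s_1, s_2`. -/
def Q₃ : Subalgebra R (Q 4) := Algebra.adjoin R {toQ s₁, toQ s₂}

/-- The subalgebra `u_3` of `Q_4` generated by `s_3`. -/
def u₃ : Subalgebra R (Q 4) := Algebra.adjoin R {toQ s₃}

/-- The `R`-submodule `Q_3 u_3 Q_3` of `Q_4`. -/
def Q₃u₃Q₃ : Submodule R (Q 4) :=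
  Subalgebra.toSubmodule Q₃ * Subalgebra.toSubmodule u₃ * Subalgebra.toSubmodule Q₃

/-- The family `B` is an `R`-basis of the submodule `M` of `Q_4`. -/
def IsBasisOf {ι : Type} (B : ι → Q 4) (M : Submodule R (Q 4)) : Prop :=
  LinearIndependent R B ∧ Submodule.span R (Set.range B) = M

/-- Twenty words in `s_1^{±1}, s_2^{±1}`. -/
def wordsQ₃ : Fin 20 → BraidGroup 4 :=
  ![1, s₁, s₁⁻¹, s₂, s₂⁻¹,
    s₁ * s₂, s₁ * s₂⁻¹, s₁⁻¹ * s₂, s₁⁻¹ * s₂⁻¹, s₂ * s₁,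
    s₂ * s₁⁻¹, s₂⁻¹ * s₁, s₂⁻¹ * s₁⁻¹, s₁ * s₂ * s₁, s₁ * s₂ * s₁⁻¹,
    s₁ * s₂⁻¹ * s₁, s₁ * s₂⁻¹ * s₁⁻¹, s₁⁻¹ * s₂ * s₁, s₁⁻¹ * s₂ * s₁⁻¹, s₂ * s₁⁻¹ * s₂]

/-- The words of `E`. -/
def wordsE : Fin 8 → BraidGroup 4 :=
  ![1, s₂, s₂⁻¹, s₁ * s₂, s₁ * s₂⁻¹, s₁⁻¹ * s₂, s₁⁻¹ * s₂⁻¹, s₂ * s₁⁻¹ * s₂]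

/-- The words of `E'`. -/
def wordsE' : Fin 8 → BraidGroup 4 :=
  ![1, s₁, s₁⁻¹, s₂ * s₁, s₂ * s₁⁻¹, s₂⁻¹ * s₁, s₂⁻¹ * s₁⁻¹, s₁ * s₂⁻¹ * s₁]

/-- The words of `E_0`. -/
def wordsE₀ : Fin 5 → BraidGroup 4 := ![1, s₁, s₁⁻¹, s₂, s₂⁻¹]

/-- The words of `F_2`. -/
def wordsF₂ : Fin 9 → BraidGroup 4 :=
  ![s₃, s₃⁻¹, s₃ * s₂, s₃ * s₂⁻¹, s₃⁻¹ * s₂, s₃ * s₂ * s₁, s₃⁻¹ * s₂ * s₁,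
    s₃ * s₂ * s₁⁻¹, s₃ * s₂⁻¹ * s₁]

/-- The words `e_1, …, e_25`. -/
def wordsTop : Fin 25 → BraidGroup 4 :=
  ![s₃ * s₂⁻¹ * s₃,
    s₁ * s₃ * s₂⁻¹ * s₃,
    s₁⁻¹ * s₃ * s₂⁻¹ * s₃,
    s₂ * s₁ * s₃ * s₂⁻¹ * s₃,
    s₂ * s₁⁻¹ * s₃ * s₂⁻¹ * s₃,
    s₂⁻¹ * s₁ * s₃ * s₂⁻¹ * s₃,
    s₂⁻¹ * s₁⁻¹ * s₃ * s₂⁻¹ * s₃,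
    s₃ * s₂⁻¹ * s₃ * s₁,
    s₃ * s₂⁻¹ * s₃ * s₁⁻¹,
    s₃ * s₂⁻¹ * s₃ * s₁ * s₂,
    s₃ * s₂⁻¹ * s₃ * s₁ * s₂⁻¹,
    s₃ * s₂⁻¹ * s₃ * s₁⁻¹ * s₂,
    s₃ * s₂⁻¹ * s₃ * s₁⁻¹ * s₂⁻¹,
    s₂ * s₁ * s₃ * s₂⁻¹ * s₃ * s₁,
    s₂⁻¹ * s₁ * s₃ * s₂⁻¹ * s₃ * s₁,
    s₁ * s₃ * s₂⁻¹ * s₃ * s₁ * s₂,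
    s₁ * s₃ * s₂⁻¹ * s₃ * s₁ * s₂⁻¹,
    s₁ * s₃ * s₂⁻¹ * s₃ * s₁⁻¹,
    s₁ * s₃ * s₂⁻¹ * s₃ * s₁,
    s₂ * s₁ * s₃ * s₂⁻¹ * s₃ * s₁ * s₂,
    s₂ * s₁ * s₃ * s₂⁻¹ * s₃ * s₁ * s₂⁻¹,
    s₃ * s₂ * s₁⁻¹ * s₂ * s₃,
    s₃⁻¹ * s₂⁻¹ * s₁ * s₂⁻¹ * s₃⁻¹,
    s₃ * s₂⁻¹ * s₃ * s₁ * s₂⁻¹ * s₁,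
    s₁ * s₂⁻¹ * s₁ * s₃ * s₂⁻¹ * s₃]

/-- Index type of the family `𝓑₁`; it has `20 + 20·9 + 8·2 + 5 + 8·2 + 2 = 239` elements. -/
abbrev Idx₁ : Type :=
  Fin 20 ⊕ (Fin 20 × Fin 9) ⊕ (Fin 8 × Fin 2) ⊕ Fin 5 ⊕ (Fin 8 × Fin 2) ⊕ Fin 2

/-- Index type of the family `𝓑₂`; it has `239 + 25 = 264` elements. -/
abbrev Idx₂ : Type := Idx₁ ⊕ Fin 25

theorem card_Idx₁ : Fintype.card Idx₁ = 239 := by simp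

theorem card_Idx₂ : Fintype.card Idx₂ = 264 := by simp

/-- The family
`𝓑₁ = 𝓑₀ ⊔ 𝓑₀ × F₂ ⊔ E' × {s₃⁻¹s₂⁻¹, s₃⁻¹s₂⁻¹s₁} ⊔ E₀ × {s₃⁻¹s₂s₁⁻¹}
  ⊔ E × {s₃s₂⁻¹s₁⁻¹, s₃s₂s₁⁻¹s₂} ⊔ {s₃⁻¹s₂⁻¹s₁⁻¹, s₃⁻¹s₂s₁⁻¹s₂}`
attached to a family `𝓑₀` of elements of `Q_3`. -/
def family₁ (B₀ : Fin 20 → Q 4) : Idx₁ → Q 4 :=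
  Sum.elim B₀ <|
  Sum.elim (fun p => B₀ p.1 * toQ (wordsF₂ p.2)) <|
  Sum.elim (fun p => toQ (wordsE' p.1 * ![s₃⁻¹ * s₂⁻¹, s₃⁻¹ * s₂⁻¹ * s₁] p.2)) <|
  Sum.elim (fun i => toQ (wordsE₀ i * (s₃⁻¹ * s₂ * s₁⁻¹))) <|
  Sum.elim (fun p => toQ (wordsE p.1 * ![s₃ * s₂⁻¹ * s₁⁻¹, s₃ * s₂ * s₁⁻¹ * s₂] p.2)) <|
  fun i => toQ (![s₃⁻¹ * s₂⁻¹ * s₁⁻¹, s₃⁻¹ * s₂ * s₁⁻¹ * s₂] i)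

/-- The family `𝓑₂`, obtained from `𝓑₁` by adding `e_1, …, e_25`. -/
def family₂ (B₀ : Fin 20 → Q 4) : Idx₂ → Q 4 :=
  Sum.elim (family₁ B₀) (fun i => toQ (wordsTop i))

end

end CubicQuotient

/-! The proof bounds the rank of `Q 4` from both sides by 264. From above, rewriting over `R` shows
that the 264 listed elements span. From below, fifteen representations over the fraction field `K`
of `R`, of dimensions 1 (three times), 2 (twice), 3 (five times), 6 (four times) and 8 (once), have
squared dimensions with sum 264, and the image of `Q 4` spans over `K` the whole product of the
matrix algebras. So 264 spanning elements of `Q 4` have images that form a `K`-basis of this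
product, and they are linearly independent over `R` (`linearIndependent_of_span_eq_top`). A basis
`B₀` of `Q_3` enters only through its span.

Spanning. Let `x, y, z` be the images of `s₁, s₂, s₃`, let `B` be the algebra generated by `x, y`,
and let `u_s` be the span of `1, s, s⁻¹`, closed under products by the cubic relation. For a braided
pair `(s, t)` the relation on three strands eliminates `s⁻¹t⁻¹s` and makes `ts⁻¹t` an eigenvector of
eigenvalue `a` for multiplication by `s` on either side, modulo `u_s u_t u_s`. This gives the twenty
words of `Q_3` (`pairAlg_eq_span`). A recurrent principle follows: an element `m` with `(y - a)m` or
`(x - a)m` in lower terms generates, modulo these, a left `B`-module spanned by eight words instead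
of twenty (`pairAlg_le_cosetWords`, `OpPair.eight_stable`).

Filtered as a left `B`-module, `B u_z B` has ten generators that cost 20 elements each, four that
cost 8, and 7 remaining elements, hence 239 in all (`outerModule_stable`, `outerModule_le`). Modulo
`B u_z B`, the element `v = zy⁻¹z` is an eigenvector of `y` on both sides. Since `z` commutes with
`x`, the relation for `(x, y)` placed between two factors `z` becomes `(X - U)(X - a)(U - a)v = 0`,
with `X` and `U` the left and right multiplications by `x`. The bimodule generated by `v` is
therefore spanned by 23 words (`OpBipair.exists_stable_le`). Two more words, `e₂₂` and `e₂₃`, are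
eigenvectors for all of `B` modulo lower terms. The resulting bimodule is stable under left
multiplication by `z`, hence is everything (`topBimodule_eq_top`).

Independence. The representations are written in bases indexed by pairs (constituent of the
restriction to three strands, eigenvalue of `s₁`): `s₁` is diagonal, `s₂` preserves constituents,
and `s₃`, which commutes with `s₁`, preserves eigenvalues. Interpolation in `s₁`, then in the
diagonal of `s₂`, yields the idempotent of each label. Diagonal entries of `s₃` then separate the
representations, and nonzero entries of `s₂` and `s₃` produce all matrix units
(`subalgebra_eq_top`). -/

namespace CubicQuotient

open Submodule

/-! ### Braided pairs: the module `u_s u_t u_s` and the element `t s⁻¹ t`. -/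

section Pair

variable {R A : Type*} [CommRing R] [Ring A] [Algebra R A]

/-- Two units of an algebra that satisfy the braid relation, the cubic relation and the three strand
relation of `Q_3`. With `q = t - a² t⁻¹`, and `L`, `R` the left and right multiplications by `s`, the
last one says that `(L - R) (L - a) (R - a)` kills `q`. -/
structure CubicPair (a b c : Rˣ) (s t : Aˣ) : Prop where
  braid : s * t * s = t * s * t
  cubic : ((s : A) - algebraMap R A a) * (s - algebraMap R A b) * (s - algebraMap R A c) = 0
  three : (a : R) • ((↑s⁻¹ : A) * ((t : A) - (a : R) ^ 2 • (↑t⁻¹ : A)) * s)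
      - (a : R) • ((s : A) * (t - (a : R) ^ 2 • (↑t⁻¹ : A)) * (↑s⁻¹ : A))
      + (s : A) * (t - (a : R) ^ 2 • (↑t⁻¹ : A))
      - (a : R) ^ 2 • ((↑s⁻¹ : A) * (t - (a : R) ^ 2 • (↑t⁻¹ : A)))
      - ((t : A) - (a : R) ^ 2 • (↑t⁻¹ : A)) * s
      + (a : R) ^ 2 • (((t : A) - (a : R) ^ 2 • (↑t⁻¹ : A)) * (↑s⁻¹ : A)) = 0

/-- The span of the words `1, s, s⁻¹`. -/
def unitSpan (R : Type*) {A : Type*} [CommRing R] [Ring A] [Algebra R A] (s : Aˣ) :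
    Submodule R A :=
  span R {1, (s : A), (↑s⁻¹ : A)}

theorem one_mem_unitSpan (s : Aˣ) : (1 : A) ∈ unitSpan R s := subset_span (by simp)
theorem self_mem_unitSpan (s : Aˣ) : (s : A) ∈ unitSpan R s := subset_span (by simp)
theorem inv_mem_unitSpan (s : Aˣ) : (↑s⁻¹ : A) ∈ unitSpan R s := subset_span (by simp)

theorem one_le_unitSpan (s : Aˣ) : (1 : Submodule R A) ≤ unitSpan R s :=
  Submodule.one_le.2 (one_mem_unitSpan s)

theorem unitSpan_le {s : Aˣ} {M : Submodule R A} (h1 : (1 : A) ∈ M) (h2 : (s : A) ∈ M)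
    (h3 : (↑s⁻¹ : A) ∈ M) : unitSpan R s ≤ M := by
  refine span_le.2 ?_
  rintro x (rfl | rfl | rfl) <;> assumption

/-- Lets the relations be used in a form cleared of the inverses of `a`, `b`, `c`. -/
theorem mem_of_unit_smul_mem {M : Submodule R A} (r : Rˣ) {x : A} (h : (r : R) • x ∈ M) :
    x ∈ M := by
  simpa [smul_smul] using M.smul_mem (↑r⁻¹ : R) h

namespace CubicPair

variable {a b c : Rˣ} {s t : Aˣ}

section Words

variable {x : A}

theorem sq_left (h : CubicPair a b c s t) : (s : A) * s =
    ((a : R) + b + c) • (s : A) - ((a : R) * b + a * c + b * c) • (1 : A)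
      + ((a : R) * b * c) • (↑s⁻¹ : A) := by
  have h1 := congrArg (fun y => y * (↑s⁻¹ : A)) h.cubic
  simp only [Algebra.algebraMap_eq_smul_one, mul_sub, sub_mul, mul_assoc, smul_mul_assoc,
    mul_smul_comm, one_mul, mul_one, Units.mul_inv, zero_mul, smul_sub, smul_smul] at h1
  rw [← sub_eq_zero, ← h1]
  module

/-- The relations are imposed on one pair of Artin generators only; conjugation carries them to the
other adjacent pairs. -/
theorem conj (h : CubicPair a b c s t) (g : Aˣ) : CubicPair a b c (g * s * g⁻¹)
    (g * t * g⁻¹) where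
  braid := by
    have := h.braid
    simp only [mul_assoc, inv_mul_cancel_left] at this ⊢
    rw [← mul_assoc t, ← mul_assoc s, ← mul_assoc s, mul_assoc s, this]
    simp [mul_assoc]
  cubic := by
    have h1 := congrArg (fun y => (g : A) * y * (↑g⁻¹ : A)) h.cubic
    simp only [Algebra.algebraMap_eq_smul_one, mul_sub, sub_mul, mul_assoc, smul_mul_assoc,
      mul_smul_comm, one_mul, mul_one, Units.mul_inv, zero_mul, mul_zero, smul_sub, smul_smul,
      Units.val_mul, Units.inv_mul_cancel_left] at h1 ⊢
    exact h1
  three := by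
    have h1 := congrArg (fun y => (g : A) * y * (↑g⁻¹ : A)) h.three
    simp only [mul_sub, sub_mul, mul_add, add_mul, mul_assoc, smul_mul_assoc, mul_inv_rev, inv_inv,
      mul_smul_comm, zero_mul, mul_zero, smul_sub, smul_smul,
      Units.val_mul, Units.inv_mul_cancel_left] at h1 ⊢
    exact h1

/-- Conjugation by the half twist `sts` exchanges `s` and `t`. -/
theorem swap (h : CubicPair a b c s t) : CubicPair a b c t s := by
  have h1 := h.conj (s * t * s)
  have e1 : s * t * s * s * (s * t * s)⁻¹ = t := by
    rw [mul_inv_eq_iff_eq_mul, h.braid]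
    have := h.braid
    simp only [mul_assoc] at this ⊢
    rw [this]
  have e2 : s * t * s * t * (s * t * s)⁻¹ = s := by
    rw [mul_inv_eq_iff_eq_mul]
    have := h.braid
    simp only [mul_assoc] at this ⊢
    rw [this]
  rwa [e1, e2] at h1

theorem sq_left_mul (h : CubicPair a b c s t) (x : A) : (s : A) * (s * x) =
    ((a : R) + b + c) • ((s : A) * x) - ((a : R) * b + a * c + b * c) • x
      + ((a : R) * b * c) • ((↑s⁻¹ : A) * x) := by
  rw [← mul_assoc, h.sq_left]
  simp [sub_mul, add_mul]

/-- The lemmas from here on are the rewriting rules for words in `s^{±1}, t^{±1}`; a prime marks an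
inverse letter. The variants with a trailing factor `x` allow rewriting inside right-nested
products. -/
theorem tst (h : CubicPair a b c s t) : (t : A) * (s * t) = s * (t * s) := by
  have := congrArg Units.val h.braid
  simpa [mul_assoc] using this.symm

theorem tst_mul (h : CubicPair a b c s t) (x : A) :
    (t : A) * (s * (t * x)) = s * (t * (s * x)) := by
  have := congrArg (· * x) h.tst
  simpa [mul_assoc] using this

theorem tst'_mul (h : CubicPair a b c s t) (x : A) :
    (t : A) * (s * ((↑t⁻¹ : A) * x)) = (↑s⁻¹ : A) * (t * (s * x)) := by
  have := h.swap.tst_mul ((↑t⁻¹ : A) * x)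
  rw [Units.mul_inv_cancel_left] at this
  rw [← this, Units.inv_mul_cancel_left]

theorem tst' (h : CubicPair a b c s t) :
    (t : A) * (s * (↑t⁻¹ : A)) = (↑s⁻¹ : A) * (t * s) := by
  simpa using h.tst'_mul 1

theorem t'st_mul (h : CubicPair a b c s t) (x : A) :
    (↑t⁻¹ : A) * (s * (t * x)) = s * (t * ((↑s⁻¹ : A) * x)) := by
  have := h.tst_mul ((↑s⁻¹ : A) * x)
  rw [Units.mul_inv_cancel_left] at this
  rw [← this, Units.inv_mul_cancel_left]

theorem t'st (h : CubicPair a b c s t) :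
    (↑t⁻¹ : A) * (s * t) = s * (t * (↑s⁻¹ : A)) := by
  simpa using h.t'st_mul 1

theorem t's't_mul (h : CubicPair a b c s t) (x : A) :
    (↑t⁻¹ : A) * ((↑s⁻¹ : A) * (t * x)) = s * ((↑t⁻¹ : A) * ((↑s⁻¹ : A) * x)) := by
  rw [← Units.inv_mul_cancel_left t ((s : A) * _), h.tst'_mul]
  simp

theorem t's't (h : CubicPair a b c s t) :
    (↑t⁻¹ : A) * ((↑s⁻¹ : A) * t) = s * ((↑t⁻¹ : A) * (↑s⁻¹ : A)) := by
  simpa using h.t's't_mul 1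

theorem ts't'_mul (h : CubicPair a b c s t) (x : A) :
    (t : A) * ((↑s⁻¹ : A) * ((↑t⁻¹ : A) * x)) = (↑s⁻¹ : A) * ((↑t⁻¹ : A) * (s * x)) := by
  rw [h.swap.t's't_mul x]

theorem ts't' (h : CubicPair a b c s t) :
    (t : A) * ((↑s⁻¹ : A) * (↑t⁻¹ : A)) = (↑s⁻¹ : A) * ((↑t⁻¹ : A) * s) := by
  simpa using h.ts't'_mul 1

theorem t's't'_mul (h : CubicPair a b c s t) (x : A) :
    (↑t⁻¹ : A) * ((↑s⁻¹ : A) * ((↑t⁻¹ : A) * x)) =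
      (↑s⁻¹ : A) * ((↑t⁻¹ : A) * ((↑s⁻¹ : A) * x)) := by
  have := congrArg (fun u : Aˣ => (↑u⁻¹ : A) * x) h.braid
  simpa [mul_assoc] using this.symm

theorem t's't' (h : CubicPair a b c s t) :
    (↑t⁻¹ : A) * ((↑s⁻¹ : A) * (↑t⁻¹ : A)) = (↑s⁻¹ : A) * ((↑t⁻¹ : A) * (↑s⁻¹ : A)) := by
  simpa using h.t's't'_mul 1

end Words

end CubicPair

/-- The submodule `u_s u_t u_s`. -/
def triple (R : Type*) {A : Type*} [CommRing R] [Ring A] [Algebra R A] (s t : Aˣ) :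
    Submodule R A :=
  unitSpan R s * unitSpan R t * unitSpan R s

theorem triple_mem₃ {s t : Aˣ} {x y z : A} (hx : x ∈ unitSpan R s) (hy : y ∈ unitSpan R t)
    (hz : z ∈ unitSpan R s) : x * (y * z) ∈ triple R s t := by
  rw [← mul_assoc]
  exact mul_mem_mul (mul_mem_mul hx hy) hz

theorem triple_mem₂ {s t : Aˣ} {x y : A} (hx : x ∈ unitSpan R s) (hy : y ∈ unitSpan R t) :
    x * y ∈ triple R s t := by
  simpa using triple_mem₃ hx hy (one_mem_unitSpan s)

theorem triple_mem₂' {s t : Aˣ} {y z : A} (hy : y ∈ unitSpan R t) (hz : z ∈ unitSpan R s) :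
    y * z ∈ triple R s t := by
  simpa using triple_mem₃ (one_mem_unitSpan s) hy hz

theorem triple_mem₁ {s t : Aˣ} {x : A} (hx : x ∈ unitSpan R s) : x ∈ triple R s t := by
  simpa using triple_mem₂ hx (one_mem_unitSpan t)

theorem triple_mem₁' {s t : Aˣ} {y : A} (hy : y ∈ unitSpan R t) : y ∈ triple R s t := by
  simpa using triple_mem₂ (one_mem_unitSpan s) hy

/-- The submodule `u_s u_t u_s + R t s⁻¹ t`. -/
def tripleTop (R : Type*) {A : Type*} [CommRing R] [Ring A] [Algebra R A] (s t : Aˣ) :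
    Submodule R A :=
  triple R s t ⊔ span R {(t : A) * ((↑s⁻¹ : A) * t)}

theorem triple_le_tripleTop (s t : Aˣ) : triple R s t ≤ tripleTop R s t := le_sup_left

theorem top_mem_tripleTop (s t : Aˣ) : (t : A) * ((↑s⁻¹ : A) * t) ∈ tripleTop R s t :=
  mem_sup_right (mem_span_singleton_self _)

namespace CubicPair

variable {a b c : Rˣ} {s t : Aˣ}

/-- `t⁻¹ s t⁻¹` and `t s⁻¹ t` are proportional modulo `u_s u_t u_s`. -/
theorem barTop_sub_top_mem (h : CubicPair a b c s t) :
    ((b : R) * c) • ((↑t⁻¹ : A) * (s * (↑t⁻¹ : A))) - (t : A) * ((↑s⁻¹ : A) * t) ∈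
      triple R s t := by
  refine mem_of_unit_smul_mem (a ^ 2) ?_
  -- With `q = s - a² s⁻¹`, the relation of the pair `(t, s)` multiplied by `t` has only two
  -- contributions outside `u_s u_t u_s`: `t⁻¹ s t⁻¹`, from `t² q t⁻¹` through the cubic relation,
  -- and `t s⁻¹ t`, from `t q t`.
  have h1 := congrArg (fun y => (triple R s t).mkQ ((t : A) * y)) h.swap.three
  simp only [mul_sub, sub_mul, mul_add, mul_assoc, smul_mul_assoc,
    mul_smul_comm, Units.mul_inv_cancel_left, mul_zero, smul_sub, smul_add, smul_smul,
    h.swap.sq_left_mul, map_sub, map_add, map_smul, map_zero] at h1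
  simp only [h.tst, h.ts't', h.tst', h.t's't'] at h1
  rw [← Submodule.ker_mkQ (triple R s t), LinearMap.mem_ker]
  have m3 : ∀ {x y z : A}, x ∈ unitSpan R s → y ∈ unitSpan R t → z ∈ unitSpan R s →
      (triple R s t).mkQ (x * (y * z)) = 0 :=
    fun hx hy hz => (Submodule.Quotient.mk_eq_zero _).2 (triple_mem₃ hx hy hz)
  have m2 : ∀ {x y : A}, x ∈ unitSpan R s → y ∈ unitSpan R t →
      (triple R s t).mkQ (x * y) = 0 :=
    fun hx hy => (Submodule.Quotient.mk_eq_zero _).2 (triple_mem₂ hx hy)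
  have m2' : ∀ {x y : A}, x ∈ unitSpan R t → y ∈ unitSpan R s →
      (triple R s t).mkQ (x * y) = 0 :=
    fun hx hy => (Submodule.Quotient.mk_eq_zero _).2 (triple_mem₂' hx hy)
  have m1 : ∀ {x : A}, x ∈ unitSpan R s → (triple R s t).mkQ x = 0 :=
    fun hx => (Submodule.Quotient.mk_eq_zero _).2 (triple_mem₁ hx)
  simp only [m3, m2, m2', m1, self_mem_unitSpan, inv_mem_unitSpan, smul_zero, sub_zero, add_zero,
    zero_add, zero_sub] at h1
  simp only [map_sub, map_smul, Units.val_pow_eq_pow_val]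
  linear_combination (norm := module) - h1

theorem unitSpan_mul_self (h : CubicPair a b c s t) :
    unitSpan R s * unitSpan R s = unitSpan R s := by
  apply le_antisymm
  · have hi : (↑s⁻¹ : A) * (↑s⁻¹ : A) ∈ unitSpan R s := by
      refine mem_of_unit_smul_mem (a * b * c) ?_
      have h1 := h.sq_left_mul ((↑s⁻¹ : A) * (↑s⁻¹ : A))
      simp only [Units.mul_inv_cancel_left, Units.mul_inv] at h1
      have h2 := congrArg (fun y => (↑s⁻¹ : A) * y) h.sq_left
      have h3 := congrArg (fun y => (↑s⁻¹ : A) * y) h2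
      simp only [mul_one, mul_add, mul_sub, mul_smul_comm,
        Units.inv_mul_cancel_left, Units.inv_mul] at h2 h3
      have : ((a * b * c : Rˣ) : R) • ((↑s⁻¹ : A) * (↑s⁻¹ : A)) = (s : A)
          - ((a : R) + b + c) • (1 : A) + ((a : R) * b + a * c + b * c) • (↑s⁻¹ : A) := by
        push_cast
        linear_combination (norm := module) - h2
      rw [this]
      exact add_mem (sub_mem (self_mem_unitSpan s) (smul_mem _ _ (one_mem_unitSpan s)))
        (smul_mem _ _ (inv_mem_unitSpan s))
    rw [Submodule.mul_le]
    have key : unitSpan R s ≤ (unitSpan R s).comap (LinearMap.mulLeft R (s : A)) := by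
      refine unitSpan_le ?_ ?_ ?_
      · simpa using self_mem_unitSpan s
      · simp only [mem_comap, LinearMap.mulLeft_apply]
        rw [h.sq_left]
        exact add_mem (sub_mem (smul_mem _ _ (self_mem_unitSpan s))
          (smul_mem _ _ (one_mem_unitSpan s))) (smul_mem _ _ (inv_mem_unitSpan s))
      · simpa using one_mem_unitSpan s
    have key' : unitSpan R s ≤ (unitSpan R s).comap (LinearMap.mulLeft R (↑s⁻¹ : A)) := by
      refine unitSpan_le ?_ ?_ ?_
      · simpa using inv_mem_unitSpan s
      · simpa using one_mem_unitSpan s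
      · simpa using hi
    intro m hm n hn
    have : unitSpan R s ≤ (unitSpan R s).comap (LinearMap.mulRight R n) :=
      unitSpan_le (by simpa using hn) (key hn) (key' hn)
    exact this hm
  · calc unitSpan R s = 1 * unitSpan R s := (one_mul _).symm
      _ ≤ _ := mul_le_mul_left (one_le_unitSpan s) _

theorem unitSpan_mul_triple (h : CubicPair a b c s t) :
    unitSpan R s * triple R s t = triple R s t := by
  rw [triple, ← mul_assoc, ← mul_assoc, h.unitSpan_mul_self]

theorem triple_mul_unitSpan (h : CubicPair a b c s t) :
    triple R s t * unitSpan R s = triple R s t := by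
  rw [triple, mul_assoc, h.unitSpan_mul_self]

/-- `s (t s⁻¹ t)` is `a (t s⁻¹ t)` modulo `u_s u_t u_s`. -/
theorem mul_top_sub_mem (h : CubicPair a b c s t) :
    (s : A) * (t * ((↑s⁻¹ : A) * t)) - (a : R) • ((t : A) * ((↑s⁻¹ : A) * t)) ∈
      triple R s t := by
  have h1 := (triple R s t).smul_mem (a : R) h.barTop_sub_top_mem
  have e : (s : A) * (t * ((↑s⁻¹ : A) * t)) - (a : R) • ((t : A) * ((↑s⁻¹ : A) * t)) =
      (a : R) • (((b : R) * c) • ((↑t⁻¹ : A) * (s * (↑t⁻¹ : A))) - (t : A) * ((↑s⁻¹ : A) * t))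
      + (((a : R) + b + c) • ((s : A) * (t * (↑s⁻¹ : A)))
        - ((a : R) * b + a * c + b * c) • ((↑t⁻¹ : A) * s)) := by
    -- Since `s t s⁻¹ = t⁻¹ s t`, the product is `t⁻¹ s t²`. The cubic relation for `t` then
    -- produces `abc t⁻¹ s t⁻¹`, which `barTop_sub_top_mem` converts into `a t s⁻¹ t`.
    rw [← h.t'st_mul, h.swap.sq_left]
    simp only [mul_add, mul_sub, mul_smul_comm, mul_one, ← h.t'st]
    module
  rw [e]
  exact add_mem h1 (sub_mem (smul_mem _ _ (triple_mem₃ (self_mem_unitSpan s) (self_mem_unitSpan t)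
    (inv_mem_unitSpan s)))
    (smul_mem _ _ (triple_mem₂' (inv_mem_unitSpan t) (self_mem_unitSpan s))))

/-- `(t s⁻¹ t) s` is `a (t s⁻¹ t)` modulo `u_s u_t u_s`. -/
theorem top_mul_sub_mem (h : CubicPair a b c s t) :
    (t : A) * ((↑s⁻¹ : A) * (t * s)) - (a : R) • ((t : A) * ((↑s⁻¹ : A) * t)) ∈
      triple R s t := by
  have h1 := (triple R s t).smul_mem (a : R) h.barTop_sub_top_mem
  have e : (t : A) * ((↑s⁻¹ : A) * (t * s)) - (a : R) • ((t : A) * ((↑s⁻¹ : A) * t)) =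
      (a : R) • (((b : R) * c) • ((↑t⁻¹ : A) * (s * (↑t⁻¹ : A))) - (t : A) * ((↑s⁻¹ : A) * t))
      + (((a : R) + b + c) • ((↑s⁻¹ : A) * (t * s))
        - ((a : R) * b + a * c + b * c) • ((s : A) * (↑t⁻¹ : A))) := by
    rw [← h.tst', h.swap.sq_left_mul]
    module
  rw [e]
  exact add_mem h1 (sub_mem (smul_mem _ _ (triple_mem₃ (inv_mem_unitSpan s) (self_mem_unitSpan t)
    (self_mem_unitSpan s))) (smul_mem _ _ (triple_mem₂ (self_mem_unitSpan s) (inv_mem_unitSpan t))))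

end CubicPair
end Pair
end CubicQuotient

namespace CubicQuotient

open Submodule

/-! ### The algebra generated by a braided pair and its twenty words. -/

section Pair

variable {R A : Type*} [CommRing R] [Ring A] [Algebra R A]

/-- The subalgebra generated by two units. -/
def pairAlg (R : Type*) {A : Type*} [CommRing R] [Ring A] [Algebra R A] (s t : Aˣ) :
    Subalgebra R A :=
  Algebra.adjoin R {(s : A), (t : A)}

theorem pairAlg_comm (s t : Aˣ) : pairAlg R s t = pairAlg R t s := by
  rw [pairAlg, pairAlg, Set.pair_comm]

theorem left_mem_pairAlg (s t : Aˣ) : (s : A) ∈ pairAlg R s t :=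
  Algebra.subset_adjoin (by simp)

theorem right_mem_pairAlg (s t : Aˣ) : (t : A) ∈ pairAlg R s t :=
  Algebra.subset_adjoin (by simp)

theorem pairAlg_mul_mem {s t : Aˣ} {M : Submodule R A} (hs : ∀ m ∈ M, (s : A) * m ∈ M)
    (ht : ∀ m ∈ M, (t : A) * m ∈ M) {q : A} (hq : q ∈ pairAlg R s t) {m : A} (hm : m ∈ M) :
    q * m ∈ M := by
  induction hq using Algebra.adjoin_induction generalizing m with
  | mem x hx =>
    rcases hx with rfl | rfl
    · exact hs m hm
    · exact ht m hm
  | algebraMap r => simpa [Algebra.smul_def] using M.smul_mem r hm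
  | add x y _ _ hx hy => rw [add_mul]; exact add_mem (hx hm) (hy hm)
  | mul x y _ _ hx hy => rw [mul_assoc]; exact hx (hy hm)

theorem mul_pairAlg_mem {s t : Aˣ} {M : Submodule R A} (hs : ∀ m ∈ M, m * (s : A) ∈ M)
    (ht : ∀ m ∈ M, m * (t : A) ∈ M) {q : A} (hq : q ∈ pairAlg R s t) {m : A} (hm : m ∈ M) :
    m * q ∈ M := by
  induction hq using Algebra.adjoin_induction generalizing m with
  | mem x hx =>
    rcases hx with rfl | rfl
    · exact hs m hm
    · exact ht m hm
  | algebraMap r =>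
    rw [← Algebra.commutes, ← Algebra.smul_def]
    exact M.smul_mem r hm
  | add x y _ _ hx hy => rw [mul_add]; exact add_mem (hx hm) (hy hm)
  | mul x y _ _ hx hy => rw [← mul_assoc]; exact hy (hx hm)

theorem mul_mem_of_span {S : Set A} {M : Submodule R A} {x : A}
    (h : ∀ m ∈ S, x * m ∈ M) {m : A} (hm : m ∈ span R S) : x * m ∈ M := by
  have : span R S ≤ M.comap (LinearMap.mulLeft R x) := span_le.2 fun m hm => h m hm
  exact this hm

theorem span_mul_mem {S : Set A} {M : Submodule R A} {x : A}
    (h : ∀ m ∈ S, m * x ∈ M) {m : A} (hm : m ∈ span R S) : m * x ∈ M := by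
  have : span R S ≤ M.comap (LinearMap.mulRight R x) := span_le.2 fun m hm => h m hm
  exact this hm

namespace CubicPair

variable {a b c : Rˣ} {s t : Aˣ}

theorem smul_inv (h : CubicPair a b c s t) : ((a * b * c : Rˣ) : R) • (↑s⁻¹ : A) =
    (s : A) * s - ((a : R) + b + c) • (s : A) + ((a : R) * b + a * c + b * c) • (1 : A) := by
  rw [h.sq_left]
  push_cast
  module

theorem inv_mul_mem (h : CubicPair a b c s t) {M : Submodule R A}
    (hs : ∀ m ∈ M, (s : A) * m ∈ M) {m : A} (hm : m ∈ M) : (↑s⁻¹ : A) * m ∈ M := by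
  refine mem_of_unit_smul_mem (a * b * c) ?_
  rw [← smul_mul_assoc, h.smul_inv]
  simp only [add_mul, sub_mul, smul_mul_assoc, one_mul, mul_assoc]
  exact add_mem (sub_mem (hs _ (hs _ hm)) (smul_mem _ _ (hs _ hm))) (smul_mem _ _ hm)

theorem mul_inv_mem (h : CubicPair a b c s t) {M : Submodule R A}
    (hs : ∀ m ∈ M, m * (s : A) ∈ M) {m : A} (hm : m ∈ M) : m * (↑s⁻¹ : A) ∈ M := by
  refine mem_of_unit_smul_mem (a * b * c) ?_
  rw [← mul_smul_comm, h.smul_inv]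
  simp only [mul_add, mul_sub, mul_smul_comm, mul_one, ← mul_assoc]
  exact add_mem (sub_mem (hs _ (hs _ hm)) (smul_mem _ _ (hs _ hm))) (smul_mem _ _ hm)

theorem inv_mul_inv_mul (h : CubicPair a b c s t) (x : A) :
    ((a : R) * b * c) • ((↑s⁻¹ : A) * ((↑s⁻¹ : A) * x)) =
      (s : A) * x - ((a : R) + b + c) • x + ((a : R) * b + a * c + b * c) • ((↑s⁻¹ : A) * x) := by
  have h1 := h.sq_left_mul ((↑s⁻¹ : A) * ((↑s⁻¹ : A) * x))
  simp only [Units.mul_inv_cancel_left] at h1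
  have h2 := h.sq_left_mul ((↑s⁻¹ : A) * x)
  have h3 := congrArg (fun y => (↑s⁻¹ : A) * y) h2
  simp only [Units.mul_inv_cancel_left, Units.inv_mul_cancel_left, mul_add, mul_sub,
    mul_smul_comm] at h2 h3
  linear_combination (norm := module) - h2

theorem left_inv_mem_pairAlg (h : CubicPair a b c s t) : (↑s⁻¹ : A) ∈ pairAlg R s t := by
  have := h.inv_mul_mem (M := Subalgebra.toSubmodule (pairAlg R s t))
    (fun m hm => (pairAlg R s t).mul_mem (left_mem_pairAlg s t) hm) (pairAlg R s t).one_mem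
  simpa using this

theorem right_inv_mem_pairAlg (h : CubicPair a b c s t) : (↑t⁻¹ : A) ∈ pairAlg R s t := by
  rw [pairAlg_comm]
  exact h.swap.left_inv_mem_pairAlg

theorem unitSpan_left_le (h : CubicPair a b c s t) :
    unitSpan R s ≤ Subalgebra.toSubmodule (pairAlg R s t) :=
  unitSpan_le (pairAlg R s t).one_mem (left_mem_pairAlg s t) h.left_inv_mem_pairAlg

theorem unitSpan_right_le (h : CubicPair a b c s t) :
    unitSpan R t ≤ Subalgebra.toSubmodule (pairAlg R s t) :=
  unitSpan_le (pairAlg R s t).one_mem (right_mem_pairAlg s t) h.right_inv_mem_pairAlg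

theorem tripleTop_mul_mem (h : CubicPair a b c s t) {m : A} (hm : m ∈ tripleTop R s t) :
    m * s ∈ tripleTop R s t := by
  rw [tripleTop] at hm
  obtain ⟨x, hx, y, hy, rfl⟩ := mem_sup.1 hm
  rw [add_mul]
  refine add_mem (triple_le_tripleTop s t ?_) (span_mul_mem ?_ hy)
  · rw [← h.triple_mul_unitSpan]
    exact mul_mem_mul hx (self_mem_unitSpan s)
  · rintro _ rfl
    have := add_mem (triple_le_tripleTop s t h.top_mul_sub_mem)
      (smul_mem _ (a : R) (top_mem_tripleTop (R := R) s t))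
    rw [sub_add_cancel] at this
    simpa only [mul_assoc] using this

theorem mul_tripleTop_mem (h : CubicPair a b c s t) {m : A} (hm : m ∈ tripleTop R s t) :
    (s : A) * m ∈ tripleTop R s t := by
  rw [tripleTop] at hm
  obtain ⟨x, hx, y, hy, rfl⟩ := mem_sup.1 hm
  rw [mul_add]
  refine add_mem (triple_le_tripleTop s t ?_) (mul_mem_of_span ?_ hy)
  · rw [← h.unitSpan_mul_triple]
    exact mul_mem_mul (self_mem_unitSpan s) hx
  · rintro _ rfl
    have := add_mem (triple_le_tripleTop s t h.mul_top_sub_mem)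
      (smul_mem _ (a : R) (top_mem_tripleTop (R := R) s t))
    rwa [sub_add_cancel] at this

theorem barTop_mem_tripleTop (h : CubicPair a b c s t) :
    (↑t⁻¹ : A) * (s * (↑t⁻¹ : A)) ∈ tripleTop R s t := by
  refine mem_of_unit_smul_mem (b * c) ?_
  have := add_mem (triple_le_tripleTop s t h.barTop_sub_top_mem) (top_mem_tripleTop (R := R) s t)
  rw [sub_add_cancel] at this
  exact_mod_cast this

/-- The braid relation turns each word `t^i s^j t^k` into a word of `u_s u_t u_s`, except `t s⁻¹ t`
itself and `t⁻¹ s t⁻¹`, which is proportional to it modulo `u_s u_t u_s`. -/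
theorem triple_swap_le (h : CubicPair a b c s t) : triple R t s ≤ tripleTop R s t := by
  have hs := self_mem_unitSpan (R := R) s
  have hs' := inv_mem_unitSpan (R := R) s
  have ht := self_mem_unitSpan (R := R) t
  have ht' := inv_mem_unitSpan (R := R) t
  have h3 := triple_le_tripleTop (R := R) s t
  have htt := h.swap.unitSpan_mul_self
  have m1 : ∀ {x}, x ∈ unitSpan R t → x ∈ tripleTop R s t := fun hx => h3 (triple_mem₁' hx)
  rw [triple, unitSpan, unitSpan, span_mul_span, span_mul_span, span_le]
  rintro _ ⟨_, ⟨x, hx, y, hy, rfl⟩, z, hz, rfl⟩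
  simp only [SetLike.mem_coe, mul_assoc]
  have hxu : x ∈ unitSpan R t := subset_span hx
  have hzu : z ∈ unitSpan R t := subset_span hz
  rcases hy with rfl | rfl | rfl
  · rw [one_mul]
    exact m1 (htt ▸ mul_mem_mul hxu hzu)
  · rcases hx with rfl | rfl | rfl
    · rw [one_mul]
      exact h3 (triple_mem₂ hs hzu)
    · rcases hz with rfl | rfl | rfl
      · rw [mul_one]
        exact h3 (triple_mem₂' hxu hs)
      · rw [h.tst]
        exact h3 (triple_mem₃ hs ht hs)
      · rw [h.tst']
        exact h3 (triple_mem₃ hs' ht hs)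
    · rcases hz with rfl | rfl | rfl
      · rw [mul_one]
        exact h3 (triple_mem₂' hxu hs)
      · rw [h.t'st]
        exact h3 (triple_mem₃ hs ht hs')
      · exact h.barTop_mem_tripleTop
  · rcases hx with rfl | rfl | rfl
    · rw [one_mul]
      exact h3 (triple_mem₂ hs' hzu)
    · rcases hz with rfl | rfl | rfl
      · rw [mul_one]
        exact h3 (triple_mem₂' hxu hs')
      · exact top_mem_tripleTop s t
      · rw [h.ts't']
        exact h3 (triple_mem₃ hs' ht' hs)
    · rcases hz with rfl | rfl | rfl
      · rw [mul_one]
        exact h3 (triple_mem₂' hxu hs')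
      · rw [h.t's't]
        exact h3 (triple_mem₃ hs ht' hs')
      · rw [h.t's't']
        exact h3 (triple_mem₃ hs' ht' hs')

theorem tripleTop_mul_unitSpan_le (h : CubicPair a b c s t) :
    tripleTop R s t * unitSpan R s ≤ tripleTop R s t := by
  rw [Submodule.mul_le]
  intro m hm n hn
  have : unitSpan R s ≤ (tripleTop R s t).comap (LinearMap.mulLeft R m) :=
    unitSpan_le (by simpa using hm) (h.tripleTop_mul_mem hm)
      (h.mul_inv_mem (fun m hm => h.tripleTop_mul_mem hm) hm)
  exact this hn

/-- Here `u_t (u_s u_t u_s) = (u_t u_s u_t) u_s`, so `triple_swap_le` and stability under right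
multiplication by `s` suffice. -/
theorem right_mul_tripleTop_mem (h : CubicPair a b c s t) {m : A} (hm : m ∈ tripleTop R s t) :
    (t : A) * m ∈ tripleTop R s t := by
  rw [tripleTop] at hm
  obtain ⟨x, hx, y, hy, rfl⟩ := mem_sup.1 hm
  rw [mul_add]
  refine add_mem ?_ (mul_mem_of_span ?_ hy)
  · have h1 : (t : A) * x ∈ unitSpan R t * triple R s t := mul_mem_mul (self_mem_unitSpan t) hx
    rw [triple, ← mul_assoc, ← mul_assoc] at h1
    exact h.tripleTop_mul_unitSpan_le (mul_le_mul_left h.triple_swap_le _ h1)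
  · rintro _ rfl
    have h1 := mul_mem_mul (self_mem_unitSpan (R := R) t)
      (triple_mem₃ (self_mem_unitSpan (R := R) t) (inv_mem_unitSpan s) (self_mem_unitSpan t))
    rw [h.swap.unitSpan_mul_triple] at h1
    exact h.triple_swap_le h1

theorem triple_le_pairAlg (h : CubicPair a b c s t) :
    triple R s t ≤ Subalgebra.toSubmodule (pairAlg R s t) := by
  rw [triple, Submodule.mul_le]
  intro m hm n hn
  refine (pairAlg R s t).mul_mem ?_ (h.unitSpan_left_le hn)
  have : unitSpan R s * unitSpan R t ≤ Subalgebra.toSubmodule (pairAlg R s t) := by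
    rw [Submodule.mul_le]
    exact fun m hm n hn => (pairAlg R s t).mul_mem (h.unitSpan_left_le hm) (h.unitSpan_right_le hn)
  exact this hm

theorem pairAlg_eq (h : CubicPair a b c s t) :
    Subalgebra.toSubmodule (pairAlg R s t) = tripleTop R s t := by
  apply le_antisymm
  · intro q hq
    have := pairAlg_mul_mem (M := tripleTop R s t) (fun m hm => h.mul_tripleTop_mem hm)
      (fun m hm => h.right_mul_tripleTop_mem hm) hq
      (triple_le_tripleTop s t (triple_mem₁ (one_mem_unitSpan s)))
    simpa using this
  · refine sup_le h.triple_le_pairAlg (span_le.2 ?_)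
    rintro _ rfl
    exact (pairAlg R s t).mul_mem (right_mem_pairAlg s t)
      ((pairAlg R s t).mul_mem h.left_inv_mem_pairAlg (right_mem_pairAlg s t))

end CubicPair

/-- The twenty words spanning the algebra generated by a pair. -/
def pairWords (s t : Aˣ) : Fin 20 → Aˣ :=
  ![1, s, s⁻¹, t, t⁻¹, s * t, s * t⁻¹, s⁻¹ * t, s⁻¹ * t⁻¹, t * s,
    t * s⁻¹, t⁻¹ * s, t⁻¹ * s⁻¹, s * t * s, s * t * s⁻¹,
    s * t⁻¹ * s, s * t⁻¹ * s⁻¹, s⁻¹ * t * s, s⁻¹ * t * s⁻¹, t * s⁻¹ * t]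

/-- The eight words spanning the algebra generated by a pair modulo the left ideal of `s - a`. -/
def cosetWords (s t : Aˣ) : Fin 8 → Aˣ :=
  ![1, t, t⁻¹, s * t, s * t⁻¹, s⁻¹ * t, s⁻¹ * t⁻¹, t * s⁻¹ * t]

namespace CubicPair

variable {a b c : Rˣ} {s t : Aˣ}

/-- The module `u_s u_t u_s` has 21 obvious spanning words. The relation `three` eliminates
`s⁻¹t⁻¹s`, its product with `s⁻¹` eliminates `s⁻¹t⁻¹s⁻¹`, and `ts⁻¹t` brings the number to twenty.
-/
theorem pairAlg_eq_span (h : CubicPair a b c s t) :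
    Subalgebra.toSubmodule (pairAlg R s t) =
      span R (Set.range fun i => (pairWords s t i : A)) := by
  apply le_antisymm
  · have w : ∀ i, (pairWords s t i : A) ∈ span R (Set.range fun i => (pairWords s t i : A)) :=
      fun i => subset_span ⟨i, rfl⟩
    generalize hM : span R (Set.range fun i => (pairWords s t i : A)) = M at w ⊢
    have w0 : (1 : A) ∈ M := by simpa [pairWords] using w 0
    have w1 : (s : A) ∈ M := by simpa [pairWords] using w 1
    have w2 : (↑s⁻¹ : A) ∈ M := by simpa [pairWords] using w 2
    have w3 : (t : A) ∈ M := by simpa [pairWords] using w 3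
    have w4 : (↑t⁻¹ : A) ∈ M := by simpa [pairWords] using w 4
    have w5 : (s : A) * t ∈ M := by simpa [pairWords] using w 5
    have w6 : (s : A) * (↑t⁻¹ : A) ∈ M := by simpa [pairWords] using w 6
    have w7 : (↑s⁻¹ : A) * t ∈ M := by simpa [pairWords] using w 7
    have w8 : (↑s⁻¹ : A) * (↑t⁻¹ : A) ∈ M := by simpa [pairWords] using w 8
    have w9 : (t : A) * s ∈ M := by simpa [pairWords] using w 9
    have w10 : (t : A) * (↑s⁻¹ : A) ∈ M := by simpa [pairWords] using w 10
    have w11 : (↑t⁻¹ : A) * s ∈ M := by simpa [pairWords] using w 11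
    have w12 : (↑t⁻¹ : A) * (↑s⁻¹ : A) ∈ M := by simpa [pairWords] using w 12
    have w13 : (s : A) * (t * s) ∈ M := by simpa [pairWords, mul_assoc] using w 13
    have w14 : (s : A) * (t * (↑s⁻¹ : A)) ∈ M := by simpa [pairWords, mul_assoc] using w 14
    have w15 : (s : A) * ((↑t⁻¹ : A) * s) ∈ M := by simpa [pairWords, mul_assoc] using w 15
    have w16 : (s : A) * ((↑t⁻¹ : A) * (↑s⁻¹ : A)) ∈ M := by
      simpa [pairWords, mul_assoc] using w 16
    have w17 : (↑s⁻¹ : A) * (t * s) ∈ M := by simpa [pairWords, mul_assoc] using w 17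
    have w18 : (↑s⁻¹ : A) * (t * (↑s⁻¹ : A)) ∈ M := by simpa [pairWords, mul_assoc] using w 18
    have w19 : (t : A) * ((↑s⁻¹ : A) * t) ∈ M := by simpa [pairWords, mul_assoc] using w 19
    have h0 : ∀ {x : A}, x ∈ M → M.mkQ x = 0 := fun hx => (Submodule.Quotient.mk_eq_zero _).2 hx
    have h0' : ∀ {x : A}, M.mkQ x = 0 → x ∈ M := fun hx => (Submodule.Quotient.mk_eq_zero _).1 hx
    have w20 : (↑s⁻¹ : A) * ((↑t⁻¹ : A) * s) ∈ M := by
      refine mem_of_unit_smul_mem (a ^ 3) (h0' ?_)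
      have h1 := congrArg M.mkQ h.three
      simp only [mul_sub, sub_mul, mul_assoc, smul_mul_assoc, mul_smul_comm, smul_sub, smul_smul,
        map_sub, map_add, map_smul, map_zero, h0, w5, w6, w7, w8, w9, w10, w11, w12, w14, w16, w17,
        smul_zero, sub_zero, add_zero, zero_sub] at h1
      simp only [map_smul, Units.val_pow_eq_pow_val]
      linear_combination (norm := module) - h1
    have w21 : (↑s⁻¹ : A) * ((↑t⁻¹ : A) * (↑s⁻¹ : A)) ∈ M := by
      refine mem_of_unit_smul_mem (a ^ 4 * (a * b * c)) (h0' ?_)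
      have h1 := congrArg (fun y => ((a : R) * b * c) • M.mkQ ((↑s⁻¹ : A) * y)) h.three
      simp only [mul_sub, mul_add, sub_mul, mul_assoc, smul_mul_assoc, mul_smul_comm, smul_sub,
        smul_add, smul_smul, map_sub, map_add, map_smul, map_zero, mul_zero,
        Units.inv_mul_cancel_left] at h1
      -- The product with `s⁻¹` creates four words that begin with `s⁻¹s⁻¹`; the cubic relation
      -- shortens each of them.
      have e1 := congrArg M.mkQ (h.inv_mul_inv_mul ((t : A) * s))
      have e2 := congrArg M.mkQ (h.inv_mul_inv_mul ((↑t⁻¹ : A) * s))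
      have e3 := congrArg M.mkQ (h.inv_mul_inv_mul (t : A))
      have e4 := congrArg M.mkQ (h.inv_mul_inv_mul (↑t⁻¹ : A))
      simp only [map_sub, map_add, map_smul, h0, w3, w4, w5, w6, w7, w8, w9, w11, w13, w15, w17,
        w20, smul_zero, sub_zero, add_zero] at e1 e2 e3 e4
      simp only [h0, w3, w4, w10, w12, w17, w18, w20, smul_zero, sub_zero,
        add_zero, zero_sub] at h1
      simp only [map_smul, Units.val_pow_eq_pow_val, Units.val_mul]
      linear_combination (norm := module) - h1 + (a : R) • e1 - (a : R) ^ 3 • e2 -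
        (a : R) ^ 2 • e3 + (a : R) ^ 4 • e4
    rw [h.pairAlg_eq]
    refine sup_le ?_ (span_le.2 (by rintro _ rfl; exact w19))
    rw [triple]
    have htt := h.unitSpan_mul_self
    have hU : unitSpan R s ≤ M := unitSpan_le w0 w1 w2
    nth_rewrite 2 [unitSpan]
    rw [Submodule.mul_le]
    intro m hm z hz
    have key : ∀ y ∈ ({1, (t : A), (↑t⁻¹ : A)} : Set A), ∀ x ∈ unitSpan R s, ∀ z ∈ unitSpan R s,
        x * (y * z) ∈ M := by
      have aux : ∀ y x : A, (x * y ∈ M) → (x * (y * s) ∈ M) → (x * (y * (↑s⁻¹ : A)) ∈ M) →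
          ∀ z ∈ unitSpan R s, x * (y * z) ∈ M := by
        intro y x h1 h2 h3 z hz
        have : unitSpan R s ≤ M.comap (LinearMap.mulLeft R (x * y)) :=
          unitSpan_le (by simpa using h1) (by simpa [mul_assoc] using h2)
            (by simpa [mul_assoc] using h3)
        simpa [mul_assoc] using this hz
      intro y hy x hx z hz
      have : unitSpan R s ≤ M.comap (LinearMap.mulRight R (y * z)) := by
        rcases hy with rfl | rfl | rfl
        · intro x hx
          refine hU ?_
          rw [← htt]
          simpa using mul_mem_mul hx hz
        · refine unitSpan_le ?_ ?_ ?_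
          · simpa using aux t 1 (by simpa) (by simpa) (by simpa) z hz
          · simpa [mul_assoc] using aux t s w5 w13 w14 z hz
          · simpa [mul_assoc] using aux t (↑s⁻¹ : A) w7 w17 w18 z hz
        · refine unitSpan_le ?_ ?_ ?_
          · simpa using aux (↑t⁻¹ : A) 1 (by simpa) (by simpa) (by simpa) z hz
          · simpa [mul_assoc] using aux (↑t⁻¹ : A) s w6 w15 w16 z hz
          · simpa [mul_assoc] using aux (↑t⁻¹ : A) (↑s⁻¹ : A) w8 w20 w21 z hz
      exact this hx
    induction hm using Submodule.mul_induction_on' with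
    | mem_mul_mem x hx y hy =>
      have : span R ({1, (t : A), (↑t⁻¹ : A)} : Set A) ≤
          M.comap (LinearMap.mulLeft R x ∘ₗ LinearMap.mulRight R z) :=
        span_le.2 fun y hy => by simpa using key y hy x hx z hz
      simpa [mul_assoc] using this hy
    | add x _ y _ hx hy => rw [add_mul]; exact add_mem hx hy
  · rw [span_le]
    rintro _ ⟨i, rfl⟩
    have hs := left_mem_pairAlg (R := R) s t
    have hs' := h.left_inv_mem_pairAlg
    have ht := right_mem_pairAlg (R := R) s t
    have ht' := h.right_inv_mem_pairAlg
    fin_cases i <;> simp [pairWords, hs, hs', ht, ht', mul_mem, one_mem]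

/-- Modulo the left ideal of `s - a`, the algebra generated by a pair is spanned by eight words. -/
theorem pairAlg_le_cosetWords (h : CubicPair a b c s t) :
    Subalgebra.toSubmodule (pairAlg R s t) ≤
      span R (Set.range fun i => (cosetWords s t i : A)) ⊔
        (Subalgebra.toSubmodule (pairAlg R s t)).map
          (LinearMap.mulRight R ((s : A) - (a : R) • 1)) := by
  set K := (Subalgebra.toSubmodule (pairAlg R s t)).map
          (LinearMap.mulRight R ((s : A) - (a : R) • 1)) with hK
  have hs := left_mem_pairAlg (R := R) s t
  have hs' := h.left_inv_mem_pairAlg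
  have ht := right_mem_pairAlg (R := R) s t
  have ht' := h.right_inv_mem_pairAlg
  have w : ∀ i, (cosetWords s t i : A) ∈
      span R (Set.range fun i => (cosetWords s t i : A)) ⊔ K :=
    fun i => mem_sup_left (subset_span ⟨i, rfl⟩)
  have hKM := le_sup_right (a := span R (Set.range fun i => (cosetWords s t i : A))) (b := K)
  generalize hM : span R (Set.range fun i => (cosetWords s t i : A)) ⊔ K = M at w hKM ⊢
  -- A trailing letter `s^{±1}` acts as the scalar `a^{±1}` modulo the left ideal, so it can be
  -- stripped from each of the twenty words.
  have k1 : ∀ x ∈ pairAlg R s t, x * s - (a : R) • x ∈ M := fun x hx =>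
    hKM ⟨x, hx, by simp [mul_sub]⟩
  have r1 : ∀ x ∈ pairAlg R s t, x ∈ M → x * s ∈ M := fun x hx hxM => by
    have := add_mem (k1 x hx) (M.smul_mem (a : R) hxM)
    rwa [sub_add_cancel] at this
  have r2 : ∀ x ∈ pairAlg R s t, x ∈ M → x * (↑s⁻¹ : A) ∈ M := fun x hx hxM => by
    refine mem_of_unit_smul_mem a ?_
    have := sub_mem hxM (k1 (x * (↑s⁻¹ : A)) (mul_mem hx hs'))
    simpa [mul_assoc] using this
  have w0 : (1 : A) ∈ M := by simpa [cosetWords] using w 0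
  have w1 : (t : A) ∈ M := by simpa [cosetWords] using w 1
  have w2 : (↑t⁻¹ : A) ∈ M := by simpa [cosetWords] using w 2
  have w3 : (s : A) * t ∈ M := by simpa [cosetWords] using w 3
  have w4 : (s : A) * (↑t⁻¹ : A) ∈ M := by simpa [cosetWords] using w 4
  have w5 : (↑s⁻¹ : A) * t ∈ M := by simpa [cosetWords] using w 5
  have w6 : (↑s⁻¹ : A) * (↑t⁻¹ : A) ∈ M := by simpa [cosetWords] using w 6
  have w7 : (t : A) * (↑s⁻¹ : A) * t ∈ M := by simpa [cosetWords] using w 7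
  rw [h.pairAlg_eq_span, span_le]
  rintro _ ⟨i, rfl⟩
  fin_cases i <;>
    simp [pairWords, hs, hs', ht, ht', mul_mem, r1, r2, w0, w1, w2, w3, w4, w5, w6, w7]
  · simpa using r1 1 (one_mem _) w0
  · simpa using r2 1 (one_mem _) w0

end CubicPair
end Pair
end CubicQuotient

namespace CubicQuotient

open Submodule

set_option linter.unusedSimpArgs false

/-! ### A module spanned by six vectors for two braided operators. -/

section SixStable

variable {R M : Type*} [CommRing R] [AddCommGroup M] [Module R M]

theorem mem_of_unit_smul_mem' {S : Submodule R M} (r : Rˣ) {x : M} (h : (r : R) • x ∈ S) :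
    x ∈ S := by
  simpa [smul_smul] using S.smul_mem (↑r⁻¹ : R) h

/-- The six vectors `p, X p, X⁻¹ p, Y p, Y⁻¹ p, r` span a submodule stable under `X` and `Y`. -/
theorem six_stable {X X' Y Y' : M →ₗ[R] M} {a e₃ : Rˣ} {e₁ e₂ : R} {p r : M}
    (XX' : ∀ m, X (X' m) = m) (X'X : ∀ m, X' (X m) = m) (YY' : ∀ m, Y (Y' m) = m)
    (Y'Y : ∀ m, Y' (Y m) = m) (braid : ∀ m, X (Y (X m)) = Y (X (Y m)))
    (cubX : ∀ m, X (X m) = e₁ • X m - e₂ • m + (e₃ : R) • X' m)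
    (cubY : ∀ m, Y (Y m) = e₁ • Y m - e₂ • m + (e₃ : R) • Y' m)
    (h1 : (a : R) ^ 2 • (X r - (a : R) • r) = X p - (a : R) • p)
    (h2 : (a : R) • (Y r - (a : R) • r) = (a : R) • Y' p - p)
    (h3 : Y (X p) = (a : R) • X p) (h4 : Y (X' r) = (a : R) • X' r) :
    (span R {p, X p, X' p, Y p, Y' p, r}).map X ≤ span R {p, X p, X' p, Y p, Y' p, r} ∧
    (span R {p, X p, X' p, Y p, Y' p, r}).map Y ≤ span R {p, X p, X' p, Y p, Y' p, r} := by
  set S := span R {p, X p, X' p, Y p, Y' p, r} with hS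
  have m1 : p ∈ S := subset_span (by simp)
  have m2 : X p ∈ S := subset_span (by simp)
  have m3 : X' p ∈ S := subset_span (by simp)
  have m4 : Y p ∈ S := subset_span (by simp)
  have m5 : Y' p ∈ S := subset_span (by simp)
  have m6 : r ∈ S := subset_span (by simp)
  have c1 : X (Y' p) = (a : R) • Y' p := by
    have e : Y (X (Y' p)) = (a : R) • p := by
      rw [← X'X (Y (X (Y' p))), braid, YY', h3, map_smul, X'X]
    rw [← Y'Y (X (Y' p)), e, map_smul]
  have c2 : X r ∈ S := by
    refine mem_of_unit_smul_mem' (a ^ 2) ?_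
    have : ((a ^ 2 : Rˣ) : R) • X r = (a : R) ^ 3 • r + X p - (a : R) • p := by
      push_cast
      linear_combination (norm := module) h1
    rw [this]
    exact sub_mem (add_mem (smul_mem _ _ m6) m2) (smul_mem _ _ m1)
  have c3 : Y r ∈ S := by
    refine mem_of_unit_smul_mem' a ?_
    have : (a : R) • Y r = (a : R) ^ 2 • r + (a : R) • Y' p - p := by
      linear_combination (norm := module) h2
    rw [this]
    exact sub_mem (add_mem (smul_mem _ _ m6) (smul_mem _ _ m5)) m1
  -- Apply `Y X⁻¹` to `h1`; then `h4`, `h2` and `X⁻¹` of `h1` eliminate every term in `r`.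
  have c4 : (a : R) • Y (X' p) = (a : R) ^ 2 • X' p + Y p - (a : R) ^ 2 • Y' p := by
    have e1 := congrArg X' h1
    have e2 := congrArg Y e1
    simp only [map_sub, map_smul, X'X] at e1 e2
    linear_combination (norm := module) e2 + (a : R) ^ 3 • h4 - (a : R) • e1 - (a : R) • h2
  have c5 : Y' (Y' p) ∈ S := by
    refine mem_of_unit_smul_mem' e₃ ?_
    have e := congrArg Y' (cubY (Y' p))
    simp only [map_sub, map_add, map_smul, YY', Y'Y] at e
    have e' := cubY (Y' p)
    rw [YY'] at e'
    have : (e₃ : R) • Y' (Y' p) = Y p - e₁ • p + e₂ • Y' p := by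
      linear_combination (norm := module) - e'
    rw [this]
    exact add_mem (sub_mem m4 (smul_mem _ _ m1)) (smul_mem _ _ m5)
  have c5' : Y' (X' p) ∈ S := by
    refine mem_of_unit_smul_mem' (a ^ 2) ?_
    have e := congrArg Y' c4
    simp only [map_sub, map_add, map_smul, Y'Y] at e
    have : ((a ^ 2 : Rˣ) : R) • Y' (X' p) = (a : R) • X' p - p + (a : R) ^ 2 • Y' (Y' p) := by
      push_cast
      linear_combination (norm := module) - e
    rw [this]
    exact add_mem (sub_mem (smul_mem _ _ m3) m1) (smul_mem _ _ c5)
  have c6 : Y' (X p) ∈ S := by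
    refine mem_of_unit_smul_mem' a ?_
    have e := congrArg Y' h3
    simp only [map_smul, Y'Y] at e
    rw [← e]
    exact m2
  -- By the braid relation and `h3`, `Y X Y p = X Y X p = a X² p`, and the cubic relation reduces
  -- `X² p`.
  have c7 : X (Y p) ∈ S := by
    have e : Y (X (Y p)) = (a : R) • X (X p) := by rw [← braid, h3, map_smul]
    rw [← Y'Y (X (Y p)), e, cubX]
    simp only [map_smul, map_add, map_sub]
    exact smul_mem _ _ (add_mem (sub_mem (smul_mem _ _ c6) (smul_mem _ _ m5)) (smul_mem _ _ c5'))
  constructor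
  · rw [hS, map_span_le, ← hS]
    rintro _ (rfl | rfl | rfl | rfl | rfl | rfl)
    · exact m2
    · rw [cubX]
      exact add_mem (sub_mem (smul_mem _ _ m2) (smul_mem _ _ m1)) (smul_mem _ _ m3)
    · rwa [XX']
    · exact c7
    · rw [c1]
      exact smul_mem _ _ m5
    · exact c2
  · rw [hS, map_span_le, ← hS]
    rintro _ (rfl | rfl | rfl | rfl | rfl | rfl)
    · exact m4
    · rw [h3]
      exact smul_mem _ _ m2
    · refine mem_of_unit_smul_mem' a ?_
      rw [c4]
      exact sub_mem (add_mem (smul_mem _ _ m3) m4) (smul_mem _ _ m5)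
    · rw [cubY]
      exact add_mem (sub_mem (smul_mem _ _ m4) (smul_mem _ _ m1)) (smul_mem _ _ m5)
    · rwa [YY']
    · exact c3

end SixStable

/-! ### Relations in `B u_z B`, as a left module over `B`. -/

section Triple

variable {R A : Type*} [CommRing R] [Ring A] [Algebra R A]

/-- Three units satisfying the defining relations of `Q_4`. -/
structure CubicTriple (a b c : Rˣ) (x y z : Aˣ) : Prop where
  left : CubicPair a b c x y
  right : CubicPair a b c y z
  comm : Commute (z : A) (x : A)

namespace CubicTriple

variable {a b c : Rˣ} {x y z : Aˣ}

theorem zx (h : CubicTriple a b c x y z) : (z : A) * x = x * z := h.comm.eq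
theorem zx' (h : CubicTriple a b c x y z) : (z : A) * (↑x⁻¹ : A) = (↑x⁻¹ : A) * z :=
  h.comm.units_inv_right.eq
theorem z'x (h : CubicTriple a b c x y z) : (↑z⁻¹ : A) * x = x * (↑z⁻¹ : A) :=
  h.comm.units_inv_left.eq
theorem z'x' (h : CubicTriple a b c x y z) : (↑z⁻¹ : A) * (↑x⁻¹ : A) = (↑x⁻¹ : A) * (↑z⁻¹ : A) :=
  h.comm.units_inv_left.units_inv_right.eq
theorem zx_mul (h : CubicTriple a b c x y z) (m : A) : (z : A) * (x * m) = x * (z * m) :=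
  h.comm.left_comm m
theorem zx'_mul (h : CubicTriple a b c x y z) (m : A) :
    (z : A) * ((↑x⁻¹ : A) * m) = (↑x⁻¹ : A) * (z * m) :=
  h.comm.units_inv_right.left_comm m
theorem z'x_mul (h : CubicTriple a b c x y z) (m : A) :
    (↑z⁻¹ : A) * (x * m) = x * ((↑z⁻¹ : A) * m) :=
  h.comm.units_inv_left.left_comm m
theorem z'x'_mul (h : CubicTriple a b c x y z) (m : A) :
    (↑z⁻¹ : A) * ((↑x⁻¹ : A) * m) = (↑x⁻¹ : A) * ((↑z⁻¹ : A) * m) :=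
  h.comm.units_inv_left.units_inv_right.left_comm m

end CubicTriple

variable (R) in
/-- The left module over the algebra of `x, y` generated by `1` and nine words. -/
def lowModule (x y z : Aˣ) : Submodule (pairAlg R x y) A :=
  span (pairAlg R x y) {1, (z : A), (↑z⁻¹ : A), (z : A) * y, (z : A) * (↑y⁻¹ : A),
    (↑z⁻¹ : A) * y, (z : A) * (y * x), (↑z⁻¹ : A) * (y * x), (z : A) * (y * (↑x⁻¹ : A)),
    (z : A) * ((↑y⁻¹ : A) * x)}

variable (R) in
/-- The left module obtained from `lowModule` by adding four more words. -/
def midModule (x y z : Aˣ) : Submodule (pairAlg R x y) A :=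
  lowModule R x y z ⊔ span (pairAlg R x y) {(↑z⁻¹ : A) * (↑y⁻¹ : A),
    (↑z⁻¹ : A) * ((↑y⁻¹ : A) * x), (z : A) * ((↑y⁻¹ : A) * (↑x⁻¹ : A)),
    (z : A) * (y * ((↑x⁻¹ : A) * y))}

theorem left_smul_mem {B : Subalgebra R A} {N : Submodule B A} {q m : A} (hq : q ∈ B)
    (hm : m ∈ N) : q * m ∈ N :=
  N.smul_mem (⟨q, hq⟩ : B) hm

theorem left_smul_smul_mem {B : Subalgebra R A} {N : Submodule B A} {q q' m : A} (hq : q ∈ B)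
    (hq' : q' ∈ B) (hm : m ∈ N) : q * (q' * m) ∈ N :=
  left_smul_mem hq (left_smul_mem hq' hm)

namespace CubicTriple

variable {a b c : Rˣ} {x y z : Aˣ}

theorem smul_mk_eq_zero {B : Subalgebra R A} {N : Submodule B A} {m : A} (hm : m ∈ N) :
    (N.restrictScalars R).mkQ m = 0 :=
  (Submodule.Quotient.mk_eq_zero _).2 hm

theorem mem_of_mk_eq_zero {B : Subalgebra R A} {N : Submodule B A} {m : A}
    (hm : (N.restrictScalars R).mkQ m = 0) : m ∈ N :=
  (Submodule.Quotient.mk_eq_zero (N.restrictScalars R)).1 hm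

theorem words_mem_lowModule (R : Type*) [CommRing R] [Algebra R A] (x y z : Aˣ) :
    ((1 : A) ∈ lowModule R x y z ∧ (z : A) ∈ lowModule R x y z ∧
    (↑z⁻¹ : A) ∈ lowModule R x y z) ∧ ((z : A) * y ∈ lowModule R x y z ∧
    (z : A) * (↑y⁻¹ : A) ∈ lowModule R x y z ∧ (↑z⁻¹ : A) * y ∈ lowModule R x y z) ∧
    (z : A) * (y * x) ∈ lowModule R x y z ∧ (↑z⁻¹ : A) * (y * x) ∈ lowModule R x y z ∧
    (z : A) * (y * (↑x⁻¹ : A)) ∈ lowModule R x y z ∧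
    (z : A) * ((↑y⁻¹ : A) * x) ∈ lowModule R x y z := by
  refine ⟨⟨?_, ?_, ?_⟩, ⟨?_, ?_, ?_⟩, ?_, ?_, ?_, ?_⟩ <;> exact subset_span (by simp)

/-- In the relation of `(y, z)`, every term lies in `lowModule` except the two that end in `z⁻¹y⁻¹`,
namely `a³ y z⁻¹y⁻¹` and `-a⁴ z⁻¹y⁻¹`. -/
theorem mul_z'y'_mem (h : CubicTriple a b c x y z) :
    (y : A) * ((↑z⁻¹ : A) * (↑y⁻¹ : A)) - (a : R) • (((↑z⁻¹ : A) * (↑y⁻¹ : A))) ∈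
      lowModule R x y z := by
  have hx := left_mem_pairAlg (R := R) x y
  have hx' := h.left.left_inv_mem_pairAlg
  have hy := right_mem_pairAlg (R := R) x y
  have hy' := h.left.right_inv_mem_pairAlg
  obtain ⟨⟨w0, w1, w2⟩, ⟨w3, w4, w5⟩, w6, w7, w8, w9⟩ := words_mem_lowModule R x y z
  refine mem_of_mk_eq_zero (R := R) (mem_of_unit_smul_mem' (S := ⊥) (a ^ 3) ?_)
  have h1 := congrArg (fun m => ((lowModule R x y z).restrictScalars R).mkQ (m)) h.right.three
  simp only [mul_sub, sub_mul, mul_add, add_mul, mul_assoc, smul_mul_assoc, mul_smul_comm, smul_sub,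
    smul_add, smul_smul, mul_zero, zero_mul, h.zx, h.z'x, h.zx_mul, h.z'x_mul, h.zx'_mul, h.z'x'_mul,
    map_sub, map_add, map_smul, map_zero, smul_mk_eq_zero, left_smul_smul_mem,
    left_smul_mem, hx, hx', hy, hy', w1, w2, w3, w4, w5, w6, w7, w8, w9, smul_zero, sub_zero, add_zero,
    zero_sub, zero_add] at h1
  rw [Submodule.mem_bot, map_sub, map_smul, ← h1]
  push_cast
  module

/-- The same relation multiplied on the right by `x`, which passes through `z^{±1}` in the terms
without a trailing `y^{±1}`. -/
theorem mul_z'y'x_mem (h : CubicTriple a b c x y z) :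
    (y : A) * ((↑z⁻¹ : A) * ((↑y⁻¹ : A) * x)) - (a : R) • (((↑z⁻¹ : A) * ((↑y⁻¹ : A) * x))) ∈
      lowModule R x y z := by
  have hx := left_mem_pairAlg (R := R) x y
  have hx' := h.left.left_inv_mem_pairAlg
  have hy := right_mem_pairAlg (R := R) x y
  have hy' := h.left.right_inv_mem_pairAlg
  obtain ⟨⟨w0, w1, w2⟩, ⟨w3, w4, w5⟩, w6, w7, w8, w9⟩ := words_mem_lowModule R x y z
  refine mem_of_mk_eq_zero (R := R) (mem_of_unit_smul_mem' (S := ⊥) (a ^ 3) ?_)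
  have h1 := congrArg (fun m => ((lowModule R x y z).restrictScalars R).mkQ (m * x)) h.right.three
  simp only [mul_sub, sub_mul, mul_add, add_mul, mul_assoc, smul_mul_assoc, mul_smul_comm, smul_sub,
    smul_add, smul_smul, mul_zero, zero_mul, h.zx, h.z'x, h.zx_mul, h.z'x_mul, h.zx'_mul, h.z'x'_mul,
    map_sub, map_add, map_smul, map_zero, smul_mk_eq_zero, left_smul_smul_mem,
    left_smul_mem, hx, hx', hy, hy', w1, w2, w3, w4, w5, w6, w7, w8, w9, smul_zero, sub_zero, add_zero,
    zero_sub, zero_add] at h1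
  rw [Submodule.mem_bot, map_sub, map_smul, ← h1]
  push_cast
  module

/-- The relation of `(x, y)` multiplied on the left by `z`, which passes through leading letters
`x^{±1}`; only the terms that end in `z y⁻¹ x⁻¹` survive. -/
theorem mul_zy'x'_mem (h : CubicTriple a b c x y z) :
    (x : A) * ((z : A) * ((↑y⁻¹ : A) * (↑x⁻¹ : A))) - (a : R) • (((z : A) * ((↑y⁻¹ : A) * (↑x⁻¹ : A)))) ∈
      lowModule R x y z := by
  have hx := left_mem_pairAlg (R := R) x y
  have hx' := h.left.left_inv_mem_pairAlg
  have hy := right_mem_pairAlg (R := R) x y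
  have hy' := h.left.right_inv_mem_pairAlg
  obtain ⟨⟨w0, w1, w2⟩, ⟨w3, w4, w5⟩, w6, w7, w8, w9⟩ := words_mem_lowModule R x y z
  refine mem_of_mk_eq_zero (R := R) (mem_of_unit_smul_mem' (S := ⊥) (a ^ 3) ?_)
  have h1 := congrArg (fun m => ((lowModule R x y z).restrictScalars R).mkQ ((z : A) * m)) h.left.three
  simp only [mul_sub, sub_mul, mul_add, add_mul, mul_assoc, smul_mul_assoc, mul_smul_comm, smul_sub,
    smul_add, smul_smul, mul_zero, zero_mul, h.zx, h.z'x, h.zx_mul, h.z'x_mul, h.zx'_mul, h.z'x'_mul,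
    map_sub, map_add, map_smul, map_zero, smul_mk_eq_zero, left_smul_smul_mem,
    left_smul_mem, hx, hx', hy, hy', w1, w2, w3, w4, w5, w6, w7, w8, w9, smul_zero, sub_zero, add_zero,
    zero_sub, zero_add] at h1
  rw [Submodule.mem_bot, map_sub, map_smul, ← h1]
  push_cast
  module

/-- `z ^ ε u_x u_y u_x` lies in every left module that contains the words `z ^ ε y ^ j x ^ k`. -/
theorem mul_triple_mem {N : Submodule (pairAlg R x y) A} {ζ : A} (h : CubicPair a b c x y)
    (hζ : ∀ m, ζ * ((x : A) * m) = x * (ζ * m))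
    (hζ' : ∀ m, ζ * ((↑x⁻¹ : A) * m) = (↑x⁻¹ : A) * (ζ * m))
    (w0 : ζ ∈ N) (w1 : ζ * y ∈ N) (w2 : ζ * (↑y⁻¹ : A) ∈ N)
    (w3 : ζ * (y * x) ∈ N) (w4 : ζ * (y * (↑x⁻¹ : A)) ∈ N) (w5 : ζ * ((↑y⁻¹ : A) * x) ∈ N)
    (w6 : ζ * ((↑y⁻¹ : A) * (↑x⁻¹ : A)) ∈ N) {m : A} (hm : m ∈ triple R x y) : ζ * m ∈ N := by
  have hx := left_mem_pairAlg (R := R) x y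
  have hx' := h.left_inv_mem_pairAlg
  have v1 : ζ * x ∈ N := by
    have := left_smul_mem hx w0
    rwa [← mul_one ζ, ← hζ, mul_one] at this
  have v2 : ζ * (↑x⁻¹ : A) ∈ N := by
    have := left_smul_mem hx' w0
    rwa [← mul_one ζ, ← hζ', mul_one] at this
  have key : triple R x y ≤ (N.restrictScalars R).comap (LinearMap.mulLeft R ζ) := by
    rw [triple, unitSpan, unitSpan, span_mul_span, span_mul_span, span_le]
    rintro _ ⟨_, ⟨i, hi, j, hj, rfl⟩, k, hk, rfl⟩
    have : ζ * (j * k) ∈ N := by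
      rcases hj with rfl | rfl | rfl <;> rcases hk with rfl | rfl | rfl <;> simp [*]
    change ζ * (i * j * k) ∈ N
    rw [mul_assoc]
    rcases hi with rfl | rfl | rfl
    · simpa using this
    · rw [hζ]
      exact left_smul_mem hx this
    · rw [hζ']
      exact left_smul_mem hx' this
  exact key hm

/-- The element `y x⁻¹ y` is an eigenvector of `x` modulo `u_x u_y u_x`, and beyond `lowModule` the
module `z u_x u_y u_x` only needs the generator `z y⁻¹ x⁻¹`. -/
theorem mul_zyx'y_mem (h : CubicTriple a b c x y z) :
    (x : A) * ((z : A) * (y * ((↑x⁻¹ : A) * y))) - (a : R) • ((z : A) * (y * ((↑x⁻¹ : A) * y))) ∈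
      lowModule R x y z ⊔ span (pairAlg R x y) {(z : A) * ((↑y⁻¹ : A) * (↑x⁻¹ : A))} := by
  obtain ⟨⟨w0, w1, w2⟩, ⟨w3, w4, w5⟩, w6, w7, w8, w9⟩ := words_mem_lowModule R x y z
  have := mul_triple_mem (ζ := (z : A)) (N := lowModule R x y z ⊔ span (pairAlg R x y)
    {(z : A) * ((↑y⁻¹ : A) * (↑x⁻¹ : A))}) h.left h.zx_mul h.zx'_mul (mem_sup_left w1)
    (mem_sup_left w3) (mem_sup_left w4) (mem_sup_left w6) (mem_sup_left w8) (mem_sup_left w9)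
    (mem_sup_right (mem_span_singleton_self _)) h.left.mul_top_sub_mem
  rwa [mul_sub, mul_smul_comm, h.zx_mul] at this

/-- Left multiplication on the quotient by a left module. -/
def quotMul {B : Subalgebra R A} (N : Submodule B A) (q : B) :
    (A ⧸ N.restrictScalars R) →ₗ[R] A ⧸ N.restrictScalars R :=
  (N.restrictScalars R).mapQ _ (LinearMap.mulLeft R (q : A)) fun _ hm => left_smul_mem q.2 hm

theorem quotMul_mk {B : Subalgebra R A} (N : Submodule B A) (q : B) (m : A) :
    quotMul N q ((N.restrictScalars R).mkQ m) = (N.restrictScalars R).mkQ ((q : A) * m) := rfl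

theorem words_mem_midModule (R : Type*) [CommRing R] [Algebra R A] (x y z : Aˣ) :
    ((1 : A) ∈ midModule R x y z ∧ (z : A) ∈ midModule R x y z ∧
    (↑z⁻¹ : A) ∈ midModule R x y z) ∧ ((z : A) * y ∈ midModule R x y z ∧
    (z : A) * (↑y⁻¹ : A) ∈ midModule R x y z ∧ (↑z⁻¹ : A) * y ∈ midModule R x y z) ∧
    ((z : A) * (y * x) ∈ midModule R x y z ∧ (↑z⁻¹ : A) * (y * x) ∈ midModule R x y z ∧
    (z : A) * (y * (↑x⁻¹ : A)) ∈ midModule R x y z ∧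
    (z : A) * ((↑y⁻¹ : A) * x) ∈ midModule R x y z) ∧
    (↑z⁻¹ : A) * (↑y⁻¹ : A) ∈ midModule R x y z ∧
    (↑z⁻¹ : A) * ((↑y⁻¹ : A) * x) ∈ midModule R x y z ∧
    (z : A) * ((↑y⁻¹ : A) * (↑x⁻¹ : A)) ∈ midModule R x y z ∧
    (z : A) * (y * ((↑x⁻¹ : A) * y)) ∈ midModule R x y z := by
  obtain ⟨⟨w0, w1, w2⟩, ⟨w3, w4, w5⟩, w6, w7, w8, w9⟩ := words_mem_lowModule R x y z
  refine ⟨⟨mem_sup_left w0, mem_sup_left w1, mem_sup_left w2⟩,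
    ⟨mem_sup_left w3, mem_sup_left w4, mem_sup_left w5⟩,
    ⟨mem_sup_left w6, mem_sup_left w7, mem_sup_left w8, mem_sup_left w9⟩, ?_, ?_, ?_, ?_⟩ <;>
  exact mem_sup_right (subset_span (by simp))

/-- With `p = z⁻¹yx⁻¹` and `r = z⁻¹y⁻¹x⁻¹`, this lemma and the next three provide the hypotheses
`h1` to `h4` of `six_stable`. They come from the relation of `(x, y)` multiplied on the left by
`z⁻¹`, and from the relation of `(y, z)` multiplied on the right by `x⁻¹`, by `xy` and by `x⁻¹y⁻¹`.
-/
theorem mk_mul_r_left (h : CubicTriple a b c x y z) :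
    (a : R) ^ 2 • (((midModule R x y z).restrictScalars R).mkQ ((x : A) * ((↑z⁻¹ : A) * ((↑y⁻¹ : A) * (↑x⁻¹ : A)))) - (a : R) • ((midModule R x y z).restrictScalars R).mkQ ((↑z⁻¹ : A) * ((↑y⁻¹ : A) * (↑x⁻¹ : A)))) =
      ((midModule R x y z).restrictScalars R).mkQ ((x : A) * ((↑z⁻¹ : A) * (y * (↑x⁻¹ : A)))) - (a : R) • ((midModule R x y z).restrictScalars R).mkQ ((↑z⁻¹ : A) * (y * (↑x⁻¹ : A))) := by
  have hx := left_mem_pairAlg (R := R) x y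
  have hx' := h.left.left_inv_mem_pairAlg
  have hy := right_mem_pairAlg (R := R) x y
  have hy' := h.left.right_inv_mem_pairAlg
  obtain ⟨⟨w0, w1, w2⟩, ⟨w3, w4, w5⟩, ⟨w6, w7, w8, w9⟩, w10, w11, w12, w13⟩ :=
    words_mem_midModule R x y z
  rw [← sub_eq_zero]
  refine (Submodule.mem_bot R).1 (mem_of_unit_smul_mem' (S := ⊥) (a) ((Submodule.mem_bot R).2 ?_))
  have h1 := congrArg (fun m => ((midModule R x y z).restrictScalars R).mkQ ((↑z⁻¹ : A) * m)) h.left.three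
  simp only [mul_sub, sub_mul, mul_add, add_mul, mul_assoc, smul_mul_assoc, mul_smul_comm, smul_sub,
    smul_add, smul_smul, mul_zero, zero_mul, map_sub, map_add, map_smul, map_zero,
    h.left.tst, h.left.t'st, h.left.ts't', h.left.t's't'] at h1
  simp only [h.zx, h.z'x, h.zx', h.z'x', h.zx_mul, h.z'x_mul, h.zx'_mul, h.z'x'_mul,
    h.left.t's't] at h1
  simp only [h.zx_mul, h.z'x_mul, smul_mk_eq_zero, left_smul_smul_mem,
    left_smul_mem, hx, hx', hy, hy', w1, w2, w3, w4, w5, w6, w7, w8, w9, w10, w11, w12, w13, smul_zero, sub_zero,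
    add_zero, zero_sub, zero_add, neg_zero] at h1
  linear_combination (norm := module) h1

theorem mk_mul_r_right (h : CubicTriple a b c x y z) :
    (a : R) • (((midModule R x y z).restrictScalars R).mkQ ((y : A) * ((↑z⁻¹ : A) * ((↑y⁻¹ : A) * (↑x⁻¹ : A)))) - (a : R) • ((midModule R x y z).restrictScalars R).mkQ ((↑z⁻¹ : A) * ((↑y⁻¹ : A) * (↑x⁻¹ : A)))) =
      (a : R) • ((midModule R x y z).restrictScalars R).mkQ ((↑y⁻¹ : A) * ((↑z⁻¹ : A) * (y * (↑x⁻¹ : A)))) - ((midModule R x y z).restrictScalars R).mkQ ((↑z⁻¹ : A) * (y * (↑x⁻¹ : A))) := by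
  have hx := left_mem_pairAlg (R := R) x y
  have hx' := h.left.left_inv_mem_pairAlg
  have hy := right_mem_pairAlg (R := R) x y
  have hy' := h.left.right_inv_mem_pairAlg
  obtain ⟨⟨w0, w1, w2⟩, ⟨w3, w4, w5⟩, ⟨w6, w7, w8, w9⟩, w10, w11, w12, w13⟩ :=
    words_mem_midModule R x y z
  rw [← sub_eq_zero]
  refine (Submodule.mem_bot R).1 (mem_of_unit_smul_mem' (S := ⊥) (a ^ 2) ((Submodule.mem_bot R).2 ?_))
  have h1 := congrArg (fun m => ((midModule R x y z).restrictScalars R).mkQ (m * (↑x⁻¹ : A))) h.right.three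
  simp only [mul_sub, sub_mul, mul_add, add_mul, mul_assoc, smul_mul_assoc, mul_smul_comm, smul_sub,
    smul_add, smul_smul, mul_zero, zero_mul, map_sub, map_add, map_smul, map_zero,
    h.left.tst, h.left.t'st, h.left.ts't', h.left.t's't'] at h1
  simp only [h.zx, h.z'x, h.zx', h.z'x', h.zx_mul, h.z'x_mul, h.zx'_mul, h.z'x'_mul,
    h.left.t's't] at h1
  simp only [h.zx_mul, h.z'x_mul, smul_mk_eq_zero, left_smul_smul_mem,
    left_smul_mem, hx, hx', hy, hy', w1, w2, w3, w4, w5, w6, w7, w8, w9, w10, w11, w12, w13, smul_zero, sub_zero,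
    add_zero, zero_sub, zero_add, neg_zero] at h1
  push_cast
  linear_combination (norm := module) h1

theorem mk_mul_p (h : CubicTriple a b c x y z) :
    ((midModule R x y z).restrictScalars R).mkQ ((y : A) * ((x : A) * ((↑z⁻¹ : A) * (y * (↑x⁻¹ : A))))) =
      (a : R) • ((midModule R x y z).restrictScalars R).mkQ ((x : A) * ((↑z⁻¹ : A) * (y * (↑x⁻¹ : A)))) := by
  have hx := left_mem_pairAlg (R := R) x y
  have hx' := h.left.left_inv_mem_pairAlg
  have hy := right_mem_pairAlg (R := R) x y
  have hy' := h.left.right_inv_mem_pairAlg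
  obtain ⟨⟨w0, w1, w2⟩, ⟨w3, w4, w5⟩, ⟨w6, w7, w8, w9⟩, w10, w11, w12, w13⟩ :=
    words_mem_midModule R x y z
  rw [← sub_eq_zero]
  refine (Submodule.mem_bot R).1 (mem_of_unit_smul_mem' (S := ⊥) (a ^ 3) ((Submodule.mem_bot R).2 ?_))
  have h1 := congrArg (fun m => ((midModule R x y z).restrictScalars R).mkQ (m * (x * y))) h.right.three
  simp only [mul_sub, sub_mul, mul_add, add_mul, mul_assoc, smul_mul_assoc, mul_smul_comm, smul_sub,
    smul_add, smul_smul, mul_zero, zero_mul, map_sub, map_add, map_smul, map_zero,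
    h.left.tst, h.left.t'st, h.left.ts't', h.left.t's't'] at h1
  simp only [h.zx, h.z'x, h.zx', h.z'x', h.zx_mul, h.z'x_mul, h.zx'_mul, h.z'x'_mul,
    h.left.t's't] at h1
  simp only [h.zx_mul, h.z'x_mul, smul_mk_eq_zero, left_smul_smul_mem,
    left_smul_mem, hx, hx', hy, hy', w1, w2, w3, w4, w5, w6, w7, w8, w9, w10, w11, w12, w13, smul_zero, sub_zero,
    add_zero, zero_sub, zero_add, neg_zero] at h1
  push_cast
  linear_combination (norm := module) h1

theorem mk_mul_r_inv (h : CubicTriple a b c x y z) :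
    ((midModule R x y z).restrictScalars R).mkQ ((y : A) * ((↑x⁻¹ : A) * ((↑z⁻¹ : A) * ((↑y⁻¹ : A) * (↑x⁻¹ : A))))) =
      (a : R) • ((midModule R x y z).restrictScalars R).mkQ ((↑x⁻¹ : A) * ((↑z⁻¹ : A) * ((↑y⁻¹ : A) * (↑x⁻¹ : A)))) := by
  have hx := left_mem_pairAlg (R := R) x y
  have hx' := h.left.left_inv_mem_pairAlg
  have hy := right_mem_pairAlg (R := R) x y
  have hy' := h.left.right_inv_mem_pairAlg
  obtain ⟨⟨w0, w1, w2⟩, ⟨w3, w4, w5⟩, ⟨w6, w7, w8, w9⟩, w10, w11, w12, w13⟩ :=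
    words_mem_midModule R x y z
  rw [← sub_eq_zero]
  refine (Submodule.mem_bot R).1 (mem_of_unit_smul_mem' (S := ⊥) (a ^ 3) ((Submodule.mem_bot R).2 ?_))
  have h1 := congrArg (fun m => ((midModule R x y z).restrictScalars R).mkQ (m * ((↑x⁻¹ : A) * (↑y⁻¹ : A)))) h.right.three
  simp only [mul_sub, sub_mul, mul_add, add_mul, mul_assoc, smul_mul_assoc, mul_smul_comm, smul_sub,
    smul_add, smul_smul, mul_zero, zero_mul, map_sub, map_add, map_smul, map_zero,
    h.left.tst, h.left.t'st, h.left.ts't', h.left.t's't'] at h1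
  simp only [h.zx, h.z'x, h.zx', h.z'x', h.zx_mul, h.z'x_mul, h.zx'_mul, h.z'x'_mul,
    h.left.t's't] at h1
  simp only [h.zx_mul, h.z'x_mul, smul_mk_eq_zero, left_smul_smul_mem,
    left_smul_mem, hx, hx', hy, hy', w1, w2, w3, w4, w5, w6, w7, w8, w9, w10, w11, w12, w13, smul_zero, sub_zero,
    add_zero, zero_sub, zero_add, neg_zero] at h1
  push_cast
  linear_combination (norm := module) h1

/-- The relation of `(y, z)` multiplied on the right by `x⁻¹y`. There `y⁻¹x⁻¹y = xy⁻¹x⁻¹`, and `x`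
passes through `z⁻¹`; this is how `x r` appears. -/
theorem mk_mul_o (h : CubicTriple a b c x y z) :
    (a : R) • ((midModule R x y z).restrictScalars R).mkQ ((↑y⁻¹ : A) * ((↑z⁻¹ : A) * (y * ((↑x⁻¹ : A) * y)))) - ((midModule R x y z).restrictScalars R).mkQ ((↑z⁻¹ : A) * (y * ((↑x⁻¹ : A) * y))) =
      (a : R) • (((midModule R x y z).restrictScalars R).mkQ ((y : A) * ((x : A) * ((↑z⁻¹ : A) * ((↑y⁻¹ : A) * (↑x⁻¹ : A))))) - (a : R) • ((midModule R x y z).restrictScalars R).mkQ ((x : A) * ((↑z⁻¹ : A) * ((↑y⁻¹ : A) * (↑x⁻¹ : A))))) := by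
  have hx := left_mem_pairAlg (R := R) x y
  have hx' := h.left.left_inv_mem_pairAlg
  have hy := right_mem_pairAlg (R := R) x y
  have hy' := h.left.right_inv_mem_pairAlg
  obtain ⟨⟨w0, w1, w2⟩, ⟨w3, w4, w5⟩, ⟨w6, w7, w8, w9⟩, w10, w11, w12, w13⟩ :=
    words_mem_midModule R x y z
  rw [← sub_eq_zero]
  refine (Submodule.mem_bot R).1 (mem_of_unit_smul_mem' (S := ⊥) (a ^ 2) ((Submodule.mem_bot R).2 ?_))
  have h1 := congrArg (fun m => ((midModule R x y z).restrictScalars R).mkQ (m * ((↑x⁻¹ : A) * y))) h.right.three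
  simp only [mul_sub, sub_mul, mul_add, add_mul, mul_assoc, smul_mul_assoc, mul_smul_comm, smul_sub,
    smul_add, smul_smul, mul_zero, zero_mul, map_sub, map_add, map_smul, map_zero,
    h.left.tst, h.left.t'st, h.left.ts't', h.left.t's't'] at h1
  simp only [h.zx, h.z'x, h.zx', h.z'x', h.zx_mul, h.z'x_mul, h.zx'_mul, h.z'x'_mul,
    h.left.t's't] at h1
  simp only [h.zx_mul, h.z'x_mul, smul_mk_eq_zero, left_smul_smul_mem,
    left_smul_mem, hx, hx', hy, hy', w1, w2, w3, w4, w5, w6, w7, w8, w9, w10, w11, w12, w13, smul_zero, sub_zero,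
    add_zero, zero_sub, zero_add, neg_zero] at h1
  push_cast
  linear_combination (norm := module) - h1

end CubicTriple
end Triple
end CubicQuotient

namespace CubicQuotient

open Submodule

set_option linter.unusedSimpArgs false

/-! ### Stability of the filtration and the spanning family of `B u_z B`. -/

section Triple

variable {R A : Type*} [CommRing R] [Ring A] [Algebra R A]

/-- A submodule stable under left multiplication by `x` and `y`, as a module over their algebra. -/
def leftModule {x y : Aˣ} (M : Submodule R A) (hx : ∀ m ∈ M, (x : A) * m ∈ M)
    (hy : ∀ m ∈ M, (y : A) * m ∈ M) : Submodule (pairAlg R x y) A where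
  carrier := M
  add_mem' := M.add_mem
  zero_mem' := M.zero_mem
  smul_mem' q _ hm := pairAlg_mul_mem hx hy q.2 hm

theorem mem_leftModule {x y : Aˣ} {M : Submodule R A} {hx : ∀ m ∈ M, (x : A) * m ∈ M}
    {hy : ∀ m ∈ M, (y : A) * m ∈ M} {m : A} : m ∈ leftModule M hx hy ↔ m ∈ M := Iff.rfl

variable (R) in
/-- `midModule` with the six elements `p, x p, x⁻¹ p, y p, y⁻¹ p, r` added, where
`p = z⁻¹ y x⁻¹` and `r = z⁻¹ y⁻¹ x⁻¹`. -/
def sixModule (x y z : Aˣ) : Submodule R A :=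
  (midModule R x y z).restrictScalars R ⊔ span R {(↑z⁻¹ : A) * (y * (↑x⁻¹ : A)),
    (x : A) * ((↑z⁻¹ : A) * (y * (↑x⁻¹ : A))), (↑x⁻¹ : A) * ((↑z⁻¹ : A) * (y * (↑x⁻¹ : A))),
    (y : A) * ((↑z⁻¹ : A) * (y * (↑x⁻¹ : A))), (↑y⁻¹ : A) * ((↑z⁻¹ : A) * (y * (↑x⁻¹ : A))),
    (↑z⁻¹ : A) * ((↑y⁻¹ : A) * (↑x⁻¹ : A))}

variable (R) in
/-- `sixModule` with `z⁻¹ y x⁻¹ y` added. -/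
def outerModule (x y z : Aˣ) : Submodule R A :=
  sixModule R x y z ⊔ span R {(↑z⁻¹ : A) * (y * ((↑x⁻¹ : A) * y))}

namespace CubicTriple

variable {a b c : Rˣ} {x y z : Aˣ}

theorem sixModule_stable (h : CubicTriple a b c x y z) {m : A} (hm : m ∈ sixModule R x y z) :
    (x : A) * m ∈ sixModule R x y z ∧ (y : A) * m ∈ sixModule R x y z := by
  let N := midModule R x y z
  let X := quotMul N ⟨x, left_mem_pairAlg x y⟩
  let X' := quotMul N ⟨_, h.left.left_inv_mem_pairAlg⟩
  let Y := quotMul N ⟨y, right_mem_pairAlg x y⟩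
  let Y' := quotMul N ⟨_, h.left.right_inv_mem_pairAlg⟩
  have surj := (N.restrictScalars R).mkQ_surjective
  have key := six_stable (X := X) (X' := X') (Y := Y) (Y' := Y') (a := a) (e₃ := a * b * c)
    (e₁ := (a : R) + b + c) (e₂ := (a : R) * b + a * c + b * c)
    (p := (N.restrictScalars R).mkQ ((↑z⁻¹ : A) * (y * (↑x⁻¹ : A))))
    (r := (N.restrictScalars R).mkQ ((↑z⁻¹ : A) * ((↑y⁻¹ : A) * (↑x⁻¹ : A))))
    (by intro m; obtain ⟨m, rfl⟩ := surj m; simp only [X, X', quotMul_mk, Units.mul_inv_cancel_left])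
    (by intro m; obtain ⟨m, rfl⟩ := surj m; simp only [X, X', quotMul_mk, Units.inv_mul_cancel_left])
    (by intro m; obtain ⟨m, rfl⟩ := surj m; simp only [Y, Y', quotMul_mk, Units.mul_inv_cancel_left])
    (by intro m; obtain ⟨m, rfl⟩ := surj m; simp only [Y, Y', quotMul_mk, Units.inv_mul_cancel_left])
    (by intro m; obtain ⟨m, rfl⟩ := surj m; simp only [X, Y, quotMul_mk, h.left.tst_mul])
    (by
      intro m
      obtain ⟨m, rfl⟩ := surj m
      simp only [X, X', quotMul_mk, h.left.sq_left_mul, map_add, map_sub, map_smul, Units.val_mul])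
    (by
      intro m
      obtain ⟨m, rfl⟩ := surj m
      simp only [Y, Y', quotMul_mk, h.left.swap.sq_left_mul, map_add, map_sub, map_smul,
        Units.val_mul])
    h.mk_mul_r_left h.mk_mul_r_right h.mk_mul_p h.mk_mul_r_inv
  simp only [X, X', Y, Y', quotMul_mk] at key
  rw [sixModule, ← comap_map_mkQ] at hm ⊢
  simp only [map_span, Set.image_insert_eq, Set.image_singleton, mem_comap] at hm ⊢
  exact ⟨key.1 (mem_map_of_mem (f := X) hm), key.2 (mem_map_of_mem (f := Y) hm)⟩

theorem words_mem_sixModule (R : Type*) [CommRing R] [Algebra R A] (x y z : Aˣ) :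
    (↑z⁻¹ : A) * (y * (↑x⁻¹ : A)) ∈ sixModule R x y z ∧
    (↑z⁻¹ : A) * ((↑y⁻¹ : A) * (↑x⁻¹ : A)) ∈ sixModule R x y z :=
  ⟨mem_sup_right (subset_span (by simp)), mem_sup_right (subset_span (by simp))⟩

/-- For `o = z⁻¹yx⁻¹y`: `x o` is `a o` modulo `sixModule` because `yx⁻¹y` is an eigenvector of `x`
modulo `u_x u_y u_x`, and `mk_mul_o` puts `a y⁻¹o - o` into `sixModule`, so `y o` is `a o` as well.
-/
theorem outerModule_stable (h : CubicTriple a b c x y z) {m : A} (hm : m ∈ outerModule R x y z) :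
    (x : A) * m ∈ outerModule R x y z ∧ (y : A) * m ∈ outerModule R x y z := by
  obtain ⟨⟨w0, w1, w2⟩, ⟨w3, w4, w5⟩, ⟨w6, w7, w8, w9⟩, w10, w11, w12, w13⟩ :=
    words_mem_midModule R x y z
  obtain ⟨w14, w15⟩ := words_mem_sixModule R x y z
  have ho : (↑z⁻¹ : A) * (y * ((↑x⁻¹ : A) * y)) ∈ outerModule R x y z :=
    mem_sup_right (mem_span_singleton_self _)
  let N := leftModule (sixModule R x y z) (fun m hm => (h.sixModule_stable hm).1)
    (fun m hm => (h.sixModule_stable hm).2)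
  have hN : ∀ {m}, m ∈ midModule R x y z → m ∈ N := fun hm => mem_sup_left hm
  have hxo : (x : A) * ((↑z⁻¹ : A) * (y * ((↑x⁻¹ : A) * y))) ∈ outerModule R x y z := by
    have h1 := mul_triple_mem (ζ := (↑z⁻¹ : A)) (N := N) h.left h.z'x_mul h.z'x'_mul (hN w2)
      (hN w5) (hN w10) (hN w7) w14 (hN w11) w15 h.left.mul_top_sub_mem
    rw [mul_sub, mul_smul_comm, h.z'x_mul] at h1
    have := add_mem (mem_sup_left (mem_leftModule.1 h1) : _ ∈ outerModule R x y z)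
      (smul_mem _ (a : R) ho)
    rwa [sub_add_cancel] at this
  have hyo : (y : A) * ((↑z⁻¹ : A) * (y * ((↑x⁻¹ : A) * y))) ∈ outerModule R x y z := by
    have h1 := h.mk_mul_o
    have h2 : (a : R) • ((↑y⁻¹ : A) * ((↑z⁻¹ : A) * (y * ((↑x⁻¹ : A) * y)))) -
        (↑z⁻¹ : A) * (y * ((↑x⁻¹ : A) * y)) ∈ sixModule R x y z := by
      have h3 : (a : R) • ((y : A) * ((x : A) * ((↑z⁻¹ : A) * ((↑y⁻¹ : A) * (↑x⁻¹ : A)))) -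
          (a : R) • ((x : A) * ((↑z⁻¹ : A) * ((↑y⁻¹ : A) * (↑x⁻¹ : A))))) ∈ sixModule R x y z :=
        smul_mem _ _ (sub_mem (h.sixModule_stable (h.sixModule_stable w15).1).2
          (smul_mem _ _ (h.sixModule_stable w15).1))
      rw [← map_smul, ← map_smul, ← map_sub, ← map_sub, ← map_smul, ← sub_eq_zero, ← map_sub] at h1
      have := add_mem (mem_sup_left (mem_of_mk_eq_zero h1) : _ ∈ sixModule R x y z) h3
      rwa [sub_add_cancel] at this
    have h4 := (h.sixModule_stable h2).2
    rw [mul_sub, mul_smul_comm, Units.mul_inv_cancel_left] at h4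
    have := sub_mem (smul_mem _ (a : R) ho) (mem_sup_left h4 : _ ∈ outerModule R x y z)
    rwa [sub_sub_cancel] at this
  obtain ⟨m, hm', n, hn, rfl⟩ := mem_sup.1 (show m ∈ sixModule R x y z ⊔ _ from hm)
  rw [mul_add, mul_add]
  refine ⟨add_mem (mem_sup_left (h.sixModule_stable hm').1) (mul_mem_of_span ?_ hn),
    add_mem (mem_sup_left (h.sixModule_stable hm').2) (mul_mem_of_span ?_ hn)⟩
  · rintro _ rfl
    exact hxo
  · rintro _ rfl
    exact hyo

/-- Since `B = u_x u_y u_x + R yx⁻¹y` and `x` passes through `z`, the right factor reduces to the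
few words whose products with `z^{±1}` were adjoined to form `outerModule`. -/
theorem mul_unitSpan_mul_mem (h : CubicTriple a b c x y z) {q u q' : A} (hq : q ∈ pairAlg R x y)
    (hu : u ∈ unitSpan R z) (hq' : q' ∈ pairAlg R x y) : q * (u * q') ∈ outerModule R x y z := by
  obtain ⟨⟨w0, w1, w2⟩, ⟨w3, w4, w5⟩, ⟨w6, w7, w8, w9⟩, w10, w11, w12, w13⟩ :=
    words_mem_midModule R x y z
  obtain ⟨w14, w15⟩ := words_mem_sixModule R x y z
  have ho : (↑z⁻¹ : A) * (y * ((↑x⁻¹ : A) * y)) ∈ outerModule R x y z :=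
    mem_sup_right (mem_span_singleton_self _)
  let N := leftModule (outerModule R x y z) (fun m hm => (h.outerModule_stable hm).1)
    (fun m hm => (h.outerModule_stable hm).2)
  have hN : ∀ {m}, m ∈ midModule R x y z → m ∈ N := fun hm => mem_sup_left (mem_sup_left hm)
  refine left_smul_mem (N := N) hq ?_
  have key : unitSpan R z ≤ (N.restrictScalars R).comap (LinearMap.mulRight R q') := by
    refine unitSpan_le ?_ ?_ ?_
    · have := left_smul_mem (N := N) hq' (hN w0)
      simpa using this
    all_goals
      have h1 : q' ∈ tripleTop R x y := h.left.pairAlg_eq ▸ hq'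
      obtain ⟨m, hm, n, hn, rfl⟩ := mem_sup.1 h1
      simp only [mem_comap, LinearMap.mulRight_apply, restrictScalars_mem, mul_add]
    · refine add_mem ?_ (mul_mem_of_span (M := outerModule R x y z) ?_ hn)
      · exact mul_triple_mem (N := N) h.left h.zx_mul h.zx'_mul (hN w1)
          (hN w3) (hN w4) (hN w6) (hN w8) (hN w9) (hN w12) hm
      · rintro _ rfl
        exact hN w13
    · refine add_mem ?_ (mul_mem_of_span (M := outerModule R x y z) ?_ hn)
      · exact mul_triple_mem (N := N) h.left h.z'x_mul h.z'x'_mul (hN w2)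
          (hN w5) (hN w10) (hN w7) (mem_sup_left w14) (hN w11) (mem_sup_left w15) hm
      · rintro _ rfl
        exact ho
  exact key hu

/-- This is how a generator `m` costs eight elements instead of twenty: `(s - a) m`, with all its
left multiples, is already in `F`. -/
theorem mul_mem_of_cosetWords {s t : Aˣ} (h : CubicPair a b c s t) {F : Submodule R A} {m : A}
    (hm : ∀ q ∈ pairAlg R s t, q * ((s : A) * m - (a : R) • m) ∈ F)
    (hF : ∀ i, (cosetWords s t i : A) * m ∈ F) {q : A} (hq : q ∈ pairAlg R s t) : q * m ∈ F := by
  obtain ⟨e, he, k, ⟨q', hq', rfl⟩, rfl⟩ := mem_sup.1 (h.pairAlg_le_cosetWords hq)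
  rw [add_mul]
  refine add_mem (span_mul_mem ?_ he) ?_
  · rintro _ ⟨i, rfl⟩
    exact hF i
  · have := hm q' hq'
    simpa [mul_sub, sub_mul, mul_assoc] using this

end CubicTriple

theorem span_left_le {B : Subalgebra R A} {S : Set A} {F : Submodule R A}
    (h : ∀ q ∈ B, ∀ m ∈ S, q * m ∈ F) : (span B S).restrictScalars R ≤ F := by
  intro m hm
  replace hm : m ∈ span B S := hm
  induction hm using Submodule.closure_induction with
  | zero => exact F.zero_mem
  | add m n _ _ hm hn => exact F.add_mem hm hn
  | smul_mem q m hm => exact h q q.2 m hm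

/-- The nine words generating `lowModule` together with `1`. -/
def lowWords (x y z : Aˣ) : Fin 9 → Aˣ :=
  ![z, z⁻¹, z * y, z * y⁻¹, z⁻¹ * y, z * y * x, z⁻¹ * y * x, z * y * x⁻¹, z * y⁻¹ * x]

namespace CubicTriple

variable {a b c : Rˣ} {x y z : Aˣ}

/-- A submodule containing the expected spanning family contains `outerModule`. -/
theorem outerModule_le (h : CubicTriple a b c x y z) {F : Submodule R A}
    (f₀ : ∀ q ∈ pairAlg R x y, q ∈ F)
    (f₁ : ∀ q ∈ pairAlg R x y, ∀ i, q * (lowWords x y z i : A) ∈ F)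
    (f₂ : ∀ i, (cosetWords y x i : A) * ((↑z⁻¹ : A) * (↑y⁻¹ : A)) ∈ F)
    (f₃ : ∀ i, (cosetWords y x i : A) * ((↑z⁻¹ : A) * ((↑y⁻¹ : A) * x)) ∈ F)
    (f₄ : ∀ i, (cosetWords x y i : A) * ((z : A) * ((↑y⁻¹ : A) * (↑x⁻¹ : A))) ∈ F)
    (f₅ : ∀ i, (cosetWords x y i : A) * ((z : A) * (y * ((↑x⁻¹ : A) * y))) ∈ F)
    (f₆ : ∀ u ∈ ({1, (x : A), (↑x⁻¹ : A), (y : A), (↑y⁻¹ : A)} : Set A),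
      u * ((↑z⁻¹ : A) * (y * (↑x⁻¹ : A))) ∈ F)
    (f₇ : (↑z⁻¹ : A) * ((↑y⁻¹ : A) * (↑x⁻¹ : A)) ∈ F)
    (f₈ : (↑z⁻¹ : A) * (y * ((↑x⁻¹ : A) * y)) ∈ F) : outerModule R x y z ≤ F := by
  have low : (lowModule R x y z).restrictScalars R ≤ F := by
    refine span_left_le fun q hq m hm => ?_
    have g := f₁ q hq
    rcases hm with rfl | rfl | rfl | rfl | rfl | rfl | rfl | rfl | rfl | rfl
    · simpa using f₀ q hq
    · simpa [lowWords] using g 0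
    · simpa [lowWords] using g 1
    · simpa [lowWords] using g 2
    · simpa [lowWords] using g 3
    · simpa [lowWords] using g 4
    · simpa [lowWords, mul_assoc] using g 5
    · simpa [lowWords, mul_assoc] using g 6
    · simpa [lowWords, mul_assoc] using g 7
    · simpa [lowWords, mul_assoc] using g 8
  -- Settled before the other generators because the eigenvector relation for `z y x⁻¹ y` holds only
  -- modulo the multiples of `z y⁻¹ x⁻¹`.
  have k3 : ∀ q ∈ pairAlg R x y, q * ((z : A) * ((↑y⁻¹ : A) * (↑x⁻¹ : A))) ∈ F := fun q hq =>
    mul_mem_of_cosetWords h.left (fun q hq => low (left_smul_mem hq h.mul_zy'x'_mem)) f₄ hq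
  have mid : (midModule R x y z).restrictScalars R ≤ F := by
    intro m hm
    obtain ⟨m, hm', n, hn, rfl⟩ := mem_sup.1 (show m ∈ midModule R x y z from hm)
    refine add_mem (low hm') ((span_left_le fun q hq m hm => ?_) hn)
    rcases hm with rfl | rfl | rfl | rfl
    -- The eigenvector relation for `z⁻¹y⁻¹` is under `y`, not `x`, so the coset words are those of
    -- the exchanged pair.
    · rw [pairAlg_comm] at hq
      refine mul_mem_of_cosetWords h.left.swap (fun q hq => ?_) f₂ hq
      rw [pairAlg_comm] at hq
      exact low (left_smul_mem hq h.mul_z'y'_mem)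
    · rw [pairAlg_comm] at hq
      refine mul_mem_of_cosetWords h.left.swap (fun q hq => ?_) f₃ hq
      rw [pairAlg_comm] at hq
      exact low (left_smul_mem hq h.mul_z'y'x_mem)
    · exact k3 q hq
    · refine mul_mem_of_cosetWords h.left (fun q hq => ?_) f₅ hq
      have h1 := left_smul_mem hq h.mul_zyx'y_mem
      obtain ⟨m, hm, n, hn, e⟩ := mem_sup.1 h1
      rw [← e]
      refine add_mem (low hm) ((span_left_le fun q hq m hm => ?_) hn)
      rw [Set.mem_singleton_iff.1 hm]
      exact k3 q hq
  refine sup_le (sup_le mid (span_le.2 ?_)) (span_le.2 ?_)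
  · rintro _ (rfl | rfl | rfl | rfl | rfl | rfl)
    · simpa using f₆ 1 (by simp)
    · exact f₆ _ (by simp)
    · exact f₆ _ (by simp)
    · exact f₆ _ (by simp)
    · exact f₆ _ (by simp)
    · exact f₇
  · rintro _ rfl
    exact f₈

end CubicTriple
end Triple
end CubicQuotient

namespace CubicQuotient

open Submodule

/-! ### Modules and bimodules generated by an eigenvector of a braided pair. -/

section Operators

variable {R M : Type*} [CommRing R] [AddCommGroup M] [Module R M]

/-- Two invertible operators satisfying the braid relation and the cubic relation. -/
structure OpPair (a b c : Rˣ) (X X' Y Y' : M →ₗ[R] M) : Prop where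
  XX' : ∀ m, X (X' m) = m
  X'X : ∀ m, X' (X m) = m
  YY' : ∀ m, Y (Y' m) = m
  Y'Y : ∀ m, Y' (Y m) = m
  braid : ∀ m, X (Y (X m)) = Y (X (Y m))
  cubX : ∀ m, X (X m) = ((a : R) + b + c) • X m - ((a : R) * b + a * c + b * c) • m
    + ((a : R) * b * c) • X' m
  cubY : ∀ m, Y (Y m) = ((a : R) + b + c) • Y m - ((a : R) * b + a * c + b * c) • m
    + ((a : R) * b * c) • Y' m

theorem smul_unit_cancel (r : Rˣ) {m n : M} (h : (r : R) • m = (r : R) • n) : m = n := by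
  simpa [smul_smul] using congrArg ((↑r⁻¹ : R) • ·) h

theorem mem_of_smul_eq {S : Submodule R M} (r : Rˣ) {m n : M} (h : (r : R) • m = n)
    (hn : n ∈ S) : m ∈ S :=
  mem_of_unit_smul_mem' r (h ▸ hn)

namespace OpPair

variable {a b c : Rˣ} {X X' Y Y' : M →ₗ[R] M}

theorem XYX' (h : OpPair a b c X X' Y Y') (m : M) : X (Y (X' m)) = Y' (X (Y m)) := by
  rw [← h.Y'Y (X (Y (X' m))), ← h.braid, h.XX']

theorem X'YX (h : OpPair a b c X X' Y Y') (m : M) : X' (Y (X m)) = Y (X (Y' m)) := by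
  rw [← h.X'X (Y (X (Y' m))), h.braid, h.YY']

theorem XY'X' (h : OpPair a b c X X' Y Y') (m : M) : X (Y' (X' m)) = Y' (X' (Y m)) := by
  rw [← h.Y'Y (X _), ← h.X'X (Y (X _)), h.braid, h.YY', h.XX']

theorem X'Y'X (h : OpPair a b c X X' Y Y') (m : M) : X' (Y' (X m)) = Y (X' (Y' m)) := by
  rw [← h.X'X (Y (X' (Y' m))), h.XYX', h.YY']

theorem inv_smul_of_smul (h : OpPair a b c X X' Y Y') {v : M} (hv : Y v = (a : R) • v) :
    (a : R) • Y' v = v := by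
  have hY := h.Y'Y v
  rw [← map_smul, ← hv, hY]

/-- An `a`-eigenvector of `Y` generates a submodule spanned by eight vectors. -/
theorem eight_stable (h : OpPair a b c X X' Y Y') {v : M} (hv : Y v = (a : R) • v)
    {S : Submodule R M}
    (hS : S = span R {v, X v, X' v, Y (X v), Y (X' v), Y' (X v), Y' (X' v), X (Y' (X v))}) :
    (∀ m ∈ S, X m ∈ S) ∧ ∀ m ∈ S, Y m ∈ S := by
  have hv' := h.inv_smul_of_smul hv
  have m1 : v ∈ S := hS ▸ subset_span (by simp)
  have m2 : X v ∈ S := hS ▸ subset_span (by simp)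
  have m3 : X' v ∈ S := hS ▸ subset_span (by simp)
  have m4 : Y (X v) ∈ S := hS ▸ subset_span (by simp)
  have m5 : Y (X' v) ∈ S := hS ▸ subset_span (by simp)
  have m6 : Y' (X v) ∈ S := hS ▸ subset_span (by simp)
  have m7 : Y' (X' v) ∈ S := hS ▸ subset_span (by simp)
  have m8 : X (Y' (X v)) ∈ S := hS ▸ subset_span (by simp)
  have lin : ∀ {r₁ r₂ r₃ : R} {m n k : M}, m ∈ S → n ∈ S → k ∈ S →
      r₁ • m - r₂ • n + r₃ • k ∈ S := fun hm hn hk =>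
    add_mem (sub_mem (smul_mem _ _ hm) (smul_mem _ _ hn)) (smul_mem _ _ hk)
  have c1 : X' (Y' (X v)) ∈ S := by
    refine mem_of_smul_eq a (n := Y (X' v)) ?_ m5
    rw [h.X'Y'X, ← map_smul, ← map_smul, hv']
  have c2 : X' (Y (X v)) ∈ S := by
    refine mem_of_smul_eq a (n := Y (X v)) ?_ m4
    rw [h.X'YX, ← map_smul, ← map_smul, hv']
  have c3 : X (Y (X' v)) ∈ S := by
    rw [h.XYX', hv, map_smul, map_smul]
    exact smul_mem _ _ m6
  have c4 : X (X (Y (X' v))) ∈ S := by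
    rw [h.XYX', hv, map_smul, map_smul, map_smul]
    exact smul_mem _ _ m8
  -- The cubic relation expresses `X⁻¹` of `Y X⁻¹ v` through `Y X⁻¹ v` and its images under `X` and
  -- `X²`; here `X Y X⁻¹ v = a Y⁻¹ X v`.
  have c5 : X' (Y (X' v)) ∈ S := by
    refine mem_of_smul_eq (a * b * c) (n := X (X (Y (X' v))) - ((a : R) + b + c) • X (Y (X' v))
      + ((a : R) * b + a * c + b * c) • Y (X' v)) ?_
      (add_mem (sub_mem c4 (smul_mem _ _ c3)) (smul_mem _ _ m5))
    rw [h.cubX (Y (X' v))]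
    push_cast
    module
  constructor
  · suffices S.map X ≤ S from fun m hm => this (mem_map_of_mem hm)
    conv_lhs => rw [hS]
    rw [map_span_le]
    rintro _ (rfl | rfl | rfl | rfl | rfl | rfl | rfl | rfl)
    · exact m2
    · rw [h.cubX]
      exact lin m2 m1 m3
    · rwa [h.XX']
    · rw [h.braid, hv, map_smul, map_smul]
      exact smul_mem _ _ m4
    · exact c3
    · exact m8
    · rw [h.XY'X', hv, map_smul, map_smul]
      exact smul_mem _ _ m7
    · rw [h.cubX]
      exact lin m8 m6 c1
  · suffices S.map Y ≤ S from fun m hm => this (mem_map_of_mem hm)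
    conv_lhs => rw [hS]
    rw [map_span_le]
    rintro _ (rfl | rfl | rfl | rfl | rfl | rfl | rfl | rfl)
    · rw [hv]
      exact smul_mem _ _ m1
    · exact m4
    · exact m5
    · rw [h.cubY]
      exact lin m4 m2 m6
    · rw [h.cubY]
      exact lin m5 m3 m7
    · rwa [h.YY']
    · rwa [h.YY']
    -- The vector `Y X Y⁻¹ X v` equals `X⁻¹ Y X² v`, and the cubic relation reduces `X² v`.
    · rw [← h.X'YX, h.cubX]
      simp only [map_add, map_sub, map_smul, hv]
      rw [smul_smul]
      exact lin c2 m3 c5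

end OpPair

/-- Two commuting pairs of operators (left and right multiplications), with a vector `v` that
satisfies the relations of `z y⁻¹ z` modulo lower terms. -/
structure OpBipair (a b c : Rˣ) (X X' Y Y' U U' V V' : M →ₗ[R] M) (v : M) : Prop where
  left : OpPair a b c X X' Y Y'
  right : OpPair a b c U U' V V'
  XU : ∀ m, U (X m) = X (U m)
  XV : ∀ m, V (X m) = X (V m)
  YU : ∀ m, U (Y m) = Y (U m)
  YV : ∀ m, V (Y m) = Y (V m)
  Yv : Y v = (a : R) • v
  Vv : V v = (a : R) • v
  rel : (a : R) • X' (U v) - (a : R) • X (U' v) + X v - (a : R) ^ 2 • X' v - U v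
    + (a : R) ^ 2 • U' v = 0

namespace OpBipair

variable {a b c : Rˣ} {X X' Y Y' U U' V V' : M →ₗ[R] M} {v : M}

theorem XU' (h : OpBipair a b c X X' Y Y' U U' V V' v) (m : M) : U' (X m) = X (U' m) := by
  rw [← h.right.X'X (X (U' m)), h.XU, h.right.XX']

theorem X'U (h : OpBipair a b c X X' Y Y' U U' V V' v) (m : M) : U (X' m) = X' (U m) := by
  rw [← h.left.X'X (U (X' m)), ← h.XU, h.left.XX']

theorem Y'U (h : OpBipair a b c X X' Y Y' U U' V V' v) (m : M) : U (Y' m) = Y' (U m) := by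
  rw [← h.left.Y'Y (U (Y' m)), ← h.YU, h.left.YY']

theorem Y'V (h : OpBipair a b c X X' Y Y' U U' V V' v) (m : M) : V (Y' m) = Y' (V m) := by
  rw [← h.left.Y'Y (V (Y' m)), ← h.YV, h.left.YY']

theorem XV' (h : OpBipair a b c X X' Y Y' U U' V V' v) (m : M) : V' (X m) = X (V' m) := by
  rw [← h.right.Y'Y (X (V' m)), h.XV, h.right.YY']

theorem YV' (h : OpBipair a b c X X' Y Y' U U' V V' v) (m : M) : V' (Y m) = Y (V' m) := by
  rw [← h.right.Y'Y (Y (V' m)), h.YV, h.right.YY']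

theorem symm (h : OpBipair a b c X X' Y Y' U U' V V' v) :
    OpBipair a b c U U' V V' X X' Y Y' v where
  left := h.right
  right := h.left
  XU m := (h.XU m).symm
  XV m := (h.YU m).symm
  YU m := (h.XV m).symm
  YV m := (h.YV m).symm
  Yv := h.Vv
  Vv := h.Yv
  rel := by
    rw [h.XU', h.X'U]
    linear_combination (norm := module) - h.rel

/-- The vector `(X - a) (U - a) v`. -/
def core (a : Rˣ) (X U : M →ₗ[R] M) (v : M) : M :=
  X (U v) - (a : R) • X v - (a : R) • U v + (a : R) ^ 2 • v

theorem core_symm (h : OpBipair a b c X X' Y Y' U U' V V' v) : core a U X v = core a X U v := by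
  rw [core, core, h.XU]
  module

/-- Applying `X U` to `rel` turns it into `(X - U)(X - a)(U - a)v = 0`. -/
theorem X_core (h : OpBipair a b c X X' Y Y' U U' V V' v) :
    X (core a X U v) = U (core a X U v) := by
  have h1 := congrArg (fun m => X (U m)) h.rel
  simp only [map_sub, map_add, map_smul, map_zero, h.XU, h.X'U, h.left.XX', h.right.XX'] at h1
  simp only [core, map_sub, map_add, map_smul, h.XU]
  linear_combination (norm := module) h1

theorem X'_core (h : OpBipair a b c X X' Y Y' U U' V V' v) :
    X' (core a X U v) = U' (core a X U v) := by
  have h1 := congrArg (fun m => U' (X' m)) h.X_core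
  simp only [h.left.X'X, ← h.X'U, h.right.X'X] at h1
  exact h1.symm

/-- The core lies in the image of `X - a`, so the cubic relation leaves `(X - b)(X - c)` to kill it.
-/
theorem XX_core (h : OpBipair a b c X X' Y Y' U U' V V' v) :
    X (X (core a X U v)) = ((b : R) + c) • X (core a X U v) - ((b : R) * c) • core a X U v := by
  have e : ∀ m, X (X (X m - (a : R) • m)) = ((b : R) + c) • X (X m - (a : R) • m)
      - ((b : R) * c) • (X m - (a : R) • m) := by
    intro m
    have h1 := congrArg X (h.left.cubX m)
    simp only [map_sub, map_add, map_smul, h.left.XX'] at h1 ⊢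
    linear_combination (norm := module) h1
  have e2 : core a X U v = X (U v - (a : R) • v) - (a : R) • (U v - (a : R) • v) := by
    simp only [core, map_sub, map_smul]
    module
  rw [e2, e]

/-- Both `v` and `U v` are eigenvectors of `Y` for `a`, so `X Y X` acts on them as `Y X Y = a Y X`.
-/
theorem XY_core (h : OpBipair a b c X X' Y Y' U U' V V' v) :
    X (Y (core a X U v)) = (a : R) • Y (core a X U v) - (a : R) ^ 2 • core a X U v := by
  simp only [core, map_sub, map_add, map_smul, h.left.braid, ← h.YU, h.Yv]
  module

/-- On the core `X` coincides with `U`, which commutes with `X` and `Y`; this transports `XY_core`.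
-/
theorem XYX_core (h : OpBipair a b c X X' Y Y' U U' V V' v) :
    X (Y (X (core a X U v))) =
      (a : R) • Y (X (core a X U v)) - (a : R) ^ 2 • X (core a X U v) := by
  rw [h.X_core, ← h.YU, ← h.XU, h.XY_core]
  simp only [map_sub, map_smul]

/-- The expression for `X Y X` on the core is compared with the one that `XY_core` gives for `Y X
Y`. -/
theorem YX_core (h : OpBipair a b c X X' Y Y' U U' V V' v) :
    Y (X (core a X U v)) =
      Y (Y (core a X U v)) - (a : R) • Y (core a X U v) + (a : R) • X (core a X U v) := by
  refine smul_unit_cancel a ?_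
  have h1 := h.XYX_core
  rw [h.left.braid, h.XY_core] at h1
  simp only [map_sub, map_smul] at h1
  linear_combination (norm := module) - h1

theorem Y'X_core (h : OpBipair a b c X X' Y Y' U U' V V' v) :
    (a : R) • Y' (X (core a X U v)) =
      X (core a X U v) - Y (core a X U v) + (a : R) • core a X U v := by
  have h1 := congrArg Y' h.YX_core
  simp only [map_sub, map_add, map_smul, h.left.Y'Y] at h1
  linear_combination (norm := module) - h1

theorem XY'_core (h : OpBipair a b c X X' Y Y' U U' V V' v) :
    (a : R) • X (Y' (core a X U v)) = (a : R) ^ 2 • Y' (core a X U v) + X (core a X U v) := by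
  have h1 := congrArg (fun m => Y' (X' m)) h.XYX_core
  simp only [map_sub, map_smul, h.left.X'X, h.left.Y'Y, ← h.left.XY'X'] at h1
  linear_combination (norm := module) - h1

/-- Eight vectors spanning the bimodule generated by `core`. -/
theorem core_stable (h : OpBipair a b c X X' Y Y' U U' V V' v) {w : M} (hw : w = core a X U v)
    {S : Submodule R M}
    (hS : S = span R {w, X w, Y w, Y' w, V w, V' w, Y (V w), Y (V' w)}) :
    (∀ m ∈ S, X m ∈ S) ∧ (∀ m ∈ S, Y m ∈ S) ∧ (∀ m ∈ S, U m ∈ S) ∧ ∀ m ∈ S, V m ∈ S := by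
  have hw' : w = core a U X v := by rw [hw, h.core_symm]
  have hXw : X w = U w := hw ▸ h.X_core
  have hXXw := h.XX_core
  have hXYw := h.XY_core
  have hYXw := h.YX_core
  have hY'Xw := h.Y'X_core
  have hXY'w := h.XY'_core
  rw [← hw] at hXXw hXYw hYXw hY'Xw hXY'w
  -- The core is symmetric in the two sides, so each identity for left multiplication has a mirror
  -- image for right multiplication, with `U w` replaced by `X w`.
  have hUVw := h.symm.XY_core
  have hVUw := h.symm.YX_core
  have hV'Uw := h.symm.Y'X_core
  have hUV'w := h.symm.XY'_core
  rw [← hw', ← hXw] at hVUw hV'Uw hUV'w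
  rw [← hw'] at hUVw
  clear hw hw'
  have m1 : w ∈ S := hS ▸ subset_span (by simp)
  have m2 : X w ∈ S := hS ▸ subset_span (by simp)
  have m3 : Y w ∈ S := hS ▸ subset_span (by simp)
  have m4 : Y' w ∈ S := hS ▸ subset_span (by simp)
  have m5 : V w ∈ S := hS ▸ subset_span (by simp)
  have m6 : V' w ∈ S := hS ▸ subset_span (by simp)
  have m7 : Y (V w) ∈ S := hS ▸ subset_span (by simp)
  have m8 : Y (V' w) ∈ S := hS ▸ subset_span (by simp)
  have lin : ∀ {r₁ r₂ r₃ : R} {m n k : M}, m ∈ S → n ∈ S → k ∈ S →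
      r₁ • m - r₂ • n + r₃ • k ∈ S := fun hm hn hk =>
    add_mem (sub_mem (smul_mem _ _ hm) (smul_mem _ _ hn)) (smul_mem _ _ hk)
  have cYY : Y (Y w) ∈ S := by rw [h.left.cubY]; exact lin m3 m1 m4
  have cVV : V (V w) ∈ S := by rw [h.right.cubY]; exact lin m5 m1 m6
  have cYX : Y (X w) ∈ S := by
    rw [hYXw]
    exact add_mem (sub_mem cYY (smul_mem _ _ m3)) (smul_mem _ _ m2)
  have cY'X : Y' (X w) ∈ S :=
    mem_of_smul_eq a hY'Xw (add_mem (sub_mem m2 m3) (smul_mem _ _ m1))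
  have cXY' : X (Y' w) ∈ S :=
    mem_of_smul_eq a hXY'w (add_mem (smul_mem _ _ m4) m2)
  have cVX : V (X w) ∈ S := by
    rw [hVUw]
    exact add_mem (sub_mem cVV (smul_mem _ _ m5)) (smul_mem _ _ m2)
  have cV'X : V' (X w) ∈ S :=
    mem_of_smul_eq a hV'Uw (add_mem (sub_mem m2 m5) (smul_mem _ _ m1))
  have cUV' : U (V' w) ∈ S :=
    mem_of_smul_eq a hUV'w (add_mem (smul_mem _ _ m6) m2)
  have cYVV : Y (V (V w)) ∈ S := by
    rw [h.right.cubY]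
    simp only [map_add, map_sub, map_smul]
    exact lin m7 m3 m8
  have cVYX : V (Y (X w)) ∈ S := by
    rw [h.YV, hVUw]
    simp only [map_add, map_sub, map_smul]
    exact add_mem (sub_mem cYVV (smul_mem _ _ m7)) (smul_mem _ _ cYX)
  have cV'YX : V' (Y (X w)) ∈ S := by
    rw [h.YV']
    refine mem_of_smul_eq a (n := Y (X w) - Y (V w) + (a : R) • Y w) ?_
      (add_mem (sub_mem cYX m7) (smul_mem _ _ m3))
    rw [← map_smul, hV'Uw]
    simp only [map_add, map_sub, map_smul]
  -- Expressing `Y⁻¹ w` through `w`, `X w`, `Y w`, `Y X w` reduces the mixed vectors `V^{±1} Y⁻¹ w`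
  -- to vectors already in `S`.
  have eY' : ((a * b * c : Rˣ) : R) • Y' w = Y (X w) - ((b : R) + c) • Y w
      + ((a : R) * b + a * c + b * c) • w - (a : R) • X w := by
    have := h.left.cubY w
    push_cast
    linear_combination (norm := module) - hYXw - this
  have cVY' : V (Y' w) ∈ S := by
    refine mem_of_smul_eq (a * b * c) (n := V (Y (X w)) - ((b : R) + c) • Y (V w)
      + ((a : R) * b + a * c + b * c) • V w - (a : R) • V (X w)) ?_
      (sub_mem (add_mem (sub_mem cVYX (smul_mem _ _ m7)) (smul_mem _ _ m5)) (smul_mem _ _ cVX))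
    rw [← map_smul, eY']
    simp only [map_add, map_sub, map_smul, h.YV]
  have cV'Y' : V' (Y' w) ∈ S := by
    refine mem_of_smul_eq (a * b * c) (n := V' (Y (X w)) - ((b : R) + c) • Y (V' w)
      + ((a : R) * b + a * c + b * c) • V' w - (a : R) • V' (X w)) ?_
      (sub_mem (add_mem (sub_mem cV'YX (smul_mem _ _ m8)) (smul_mem _ _ m6)) (smul_mem _ _ cV'X))
    rw [← map_smul, eY']
    simp only [map_add, map_sub, map_smul, h.YV']
  have Y'V' : ∀ m, Y' (V' m) = V' (Y' m) := by
    intro m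
    rw [← h.right.Y'Y (Y' (V' m)), h.Y'V, h.right.YY']
  have of_gens : ∀ {f : M →ₗ[R] M}, (∀ m ∈ ({w, X w, Y w, Y' w, V w, V' w, Y (V w), Y (V' w)} :
      Set M), f m ∈ S) → ∀ m ∈ S, f m ∈ S := by
    intro f hf m hm
    rw [hS] at hm
    exact (map_span_le _ _ _).2 hf (mem_map_of_mem hm)
  refine ⟨of_gens ?_, of_gens ?_, of_gens ?_, of_gens ?_⟩ <;>
    rintro _ (rfl | rfl | rfl | rfl | rfl | rfl | rfl | rfl)
  · exact m2
  · rw [hXXw]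
    exact sub_mem (smul_mem _ _ m2) (smul_mem _ _ m1)
  · rw [hXYw]
    exact sub_mem (smul_mem _ _ m3) (smul_mem _ _ m1)
  · exact cXY'
  · rwa [← h.XV]
  · rwa [← h.XV']
  · rw [← h.YV, ← h.XV, hXYw, map_sub, map_smul, map_smul, h.YV]
    exact sub_mem (smul_mem _ _ m7) (smul_mem _ _ m5)
  · rw [← h.YV', ← h.XV', hXYw, map_sub, map_smul, map_smul, h.YV']
    exact sub_mem (smul_mem _ _ m8) (smul_mem _ _ m6)
  · exact m3
  · exact cYX
  · exact cYY
  · rwa [h.left.YY']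
  · exact m7
  · exact m8
  · rw [h.left.cubY, ← h.Y'V]
    exact lin m7 m5 cVY'
  · rw [h.left.cubY, Y'V']
    exact lin m8 m6 cV'Y'
  · rwa [← hXw]
  · rw [h.XU, ← hXw, hXXw]
    exact sub_mem (smul_mem _ _ m2) (smul_mem _ _ m1)
  · rwa [h.YU, ← hXw]
  · rwa [h.Y'U, ← hXw]
  · rw [hUVw]
    exact sub_mem (smul_mem _ _ m5) (smul_mem _ _ m1)
  · exact cUV'
  · rw [h.YU, hUVw, map_sub, map_smul, map_smul]
    exact sub_mem (smul_mem _ _ m7) (smul_mem _ _ m3)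
  · rw [h.YU]
    refine mem_of_smul_eq a (n := (a : R) ^ 2 • Y (V' w) + Y (X w)) ?_
      (add_mem (smul_mem _ _ m8) cYX)
    rw [← map_smul, hUV'w, map_add, map_smul]
  · exact m5
  · exact cVX
  · rwa [h.YV]
  · exact cVY'
  · exact cVV
  · rwa [h.right.YY']
  · rwa [h.YV]
  · rwa [h.YV, h.right.YY']

end OpBipair
end Operators
end CubicQuotient

namespace CubicQuotient

open Submodule

/-! ### Twenty-three vectors containing the bimodule of `v` in their span. -/

section Operators

variable {R M : Type*} [CommRing R] [AddCommGroup M] [Module R M]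

namespace OpPair

variable {a b c : Rˣ} {X X' Y Y' : M →ₗ[R] M}

theorem X'_mem (h : OpPair a b c X X' Y Y') {S : Submodule R M} (hX : ∀ m ∈ S, X m ∈ S) :
    ∀ m ∈ S, X' m ∈ S := by
  intro m hm
  refine mem_of_smul_eq (a * b * c) (n := X (X m) - ((a : R) + b + c) • X m
    + ((a : R) * b + a * c + b * c) • m) ?_
    (add_mem (sub_mem (hX _ (hX _ hm)) (smul_mem _ _ (hX _ hm))) (smul_mem _ _ hm))
  rw [h.cubX]
  push_cast
  module

theorem Y'_mem (h : OpPair a b c X X' Y Y') {S : Submodule R M} (hY : ∀ m ∈ S, Y m ∈ S) :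
    ∀ m ∈ S, Y' m ∈ S := by
  intro m hm
  refine mem_of_smul_eq (a * b * c) (n := Y (Y m) - ((a : R) + b + c) • Y m
    + ((a : R) * b + a * c + b * c) • m) ?_
    (add_mem (sub_mem (hY _ (hY _ hm)) (smul_mem _ _ (hY _ hm))) (smul_mem _ _ hm))
  rw [h.cubY]
  push_cast
  module

theorem eight_le (h : OpPair a b c X X' Y Y') {v : M} {S : Submodule R M}
    (hX : ∀ m ∈ S, X m ∈ S) (hY : ∀ m ∈ S, Y m ∈ S) (hv : v ∈ S) :
    span R {v, X v, X' v, Y (X v), Y (X' v), Y' (X v), Y' (X' v), X (Y' (X v))} ≤ S := by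
  have hX' := h.X'_mem hX
  have hY' := h.Y'_mem hY
  rw [span_le]
  rintro _ (rfl | rfl | rfl | rfl | rfl | rfl | rfl | rfl)
  exacts [hv, hX _ hv, hX' _ hv, hY _ (hX _ hv), hY _ (hX' _ hv), hY' _ (hX _ hv),
    hY' _ (hX' _ hv), hX _ (hY' _ (hX _ hv))]

end OpPair

namespace OpBipair

variable {a b c : Rˣ} {X X' Y Y' U U' V V' : M →ₗ[R] M} {v : M}

/-- The vector `(U - a)v` is sent by `X` to `a` times itself plus the core, and by `Y` to `a` times
itself. So `W` and this vector span a left-stable module, modulo which `U` is the scalar `a` on the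
left module of `v`. On that module `V`, which commutes with `X` and `Y`, is exactly `a`. -/
theorem X_left_mem_aux (h : OpBipair a b c X X' Y Y' U U' V V' v) {W L : Submodule R M}
    (hw : core a X U v ∈ W) (hX : ∀ m ∈ W, X m ∈ W) (hY : ∀ m ∈ W, Y m ∈ W)
    (hL : L = span R {v, X v, X' v, Y (X v), Y (X' v), Y' (X v), Y' (X' v), X (Y' (X v))}) :
    (∀ m ∈ L, U m - (a : R) • m ∈ W ⊔ span R {U v - (a : R) • v}) ∧
      ∀ m ∈ L, V m = (a : R) • m := by
  set N := W ⊔ span R {U v - (a : R) • v} with hN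
  have hv1 : U v - (a : R) • v ∈ N := (le_sup_right : _ ≤ N) (subset_span rfl)
  have of_gens : ∀ {f : M →ₗ[R] M}, (∀ m ∈ W, f m ∈ W) → f (U v - (a : R) • v) ∈ N →
      ∀ m ∈ N, f m ∈ N := by
    intro f hf hf1
    suffices N ≤ N.comap f from this
    rw [hN, sup_le_iff]
    exact ⟨fun m hm => (le_sup_left : W ≤ N) (hf m hm), by
      rw [span_le, Set.singleton_subset_iff]; exact hf1⟩
  have hNX : ∀ m ∈ N, X m ∈ N := by
    refine of_gens hX ?_
    have : X (U v - (a : R) • v) = core a X U v + (a : R) • (U v - (a : R) • v) := by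
      simp only [core, map_sub, map_smul]; module
    rw [this]
    exact add_mem ((le_sup_left : W ≤ N) hw) (smul_mem _ _ hv1)
  have hNY : ∀ m ∈ N, Y m ∈ N := by
    refine of_gens hY ?_
    have : Y (U v - (a : R) • v) = (a : R) • (U v - (a : R) • v) := by
      simp only [map_sub, map_smul, ← h.YU, h.Yv, smul_sub]
    rw [this]
    exact smul_mem _ _ hv1
  constructor
  · have : L ≤ N.comap (U - (a : R) • LinearMap.id) := by
      rw [hL]
      refine h.left.eight_le ?_ ?_ ?_
      · intro m hm
        simpa [h.XU] using hNX _ hm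
      · intro m hm
        simpa [h.YU] using hNY _ hm
      · simpa using hv1
    intro m hm
    simpa using this hm
  · have : L ≤ LinearMap.ker (V - (a : R) • LinearMap.id) := by
      rw [hL]
      refine h.left.eight_le ?_ ?_ ?_
      · intro m hm
        have hm' : V m - (a : R) • m = 0 := by simpa using hm
        have := congrArg X hm'
        simpa [h.XV] using this
      · intro m hm
        have hm' : V m - (a : R) • m = 0 := by simpa using hm
        have := congrArg Y hm'
        simpa [h.YV] using this
      · simp [h.Vv]
    intro m hm
    have := this hm
    simpa [sub_eq_zero] using this

/-- The bimodule generated by `v` is contained in any submodule containing `23` given vectors. -/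
theorem exists_stable_le (h : OpBipair a b c X X' Y Y' U U' V V' v) {N : Submodule R M}
    (hN : ({v, X v, X' v, Y (X v), Y (X' v), Y' (X v), Y' (X' v), U v, U' v, V (U v), V' (U v),
      V (U' v), V' (U' v), Y (X (U v)), Y' (X (U v)), X (V (U v)), X (V' (U v)), X (U' v),
      X (U v), Y (X (V (U v))), Y (X (V' (U v))), U (V' (U v)), X (Y' (X v))} : Set M) ⊆ N) :
    ∃ S ≤ N, v ∈ S ∧ (∀ m ∈ S, X m ∈ S) ∧ (∀ m ∈ S, Y m ∈ S) ∧ (∀ m ∈ S, U m ∈ S) ∧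
      ∀ m ∈ S, V m ∈ S := by
  obtain ⟨w, hw⟩ : ∃ w, w = core a X U v := ⟨_, rfl⟩
  obtain ⟨W, hW⟩ : ∃ W, W = span R {w, X w, Y w, Y' w, V w, V' w, Y (V w), Y (V' w)} := ⟨_, rfl⟩
  obtain ⟨L, hL⟩ : ∃ L, L = span R {v, X v, X' v, Y (X v), Y (X' v), Y' (X v), Y' (X' v),
    X (Y' (X v))} := ⟨_, rfl⟩
  obtain ⟨K, hK⟩ : ∃ K, K = span R {v, U v, U' v, V (U v), V (U' v), V' (U v), V' (U' v),
    U (V' (U v))} := ⟨_, rfl⟩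
  have hv' := h.left.inv_smul_of_smul h.Yv
  have hV' := h.right.inv_smul_of_smul h.Vv
  obtain ⟨WX, WY, WU, WV⟩ := h.core_stable hw hW
  obtain ⟨LX, LY⟩ := h.left.eight_stable h.Yv hL
  obtain ⟨KU, KV⟩ := h.right.eight_stable h.Vv hK
  have hwW : w ∈ W := hW ▸ subset_span (by simp)
  have hvL : v ∈ L := hL ▸ subset_span (by simp)
  have hXvL : X v ∈ L := hL ▸ subset_span (by simp)
  have hvK : v ∈ K := hK ▸ subset_span (by simp)
  have hUvK : U v ∈ K := hK ▸ subset_span (by simp)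
  obtain ⟨LU, LV⟩ := h.X_left_mem_aux (hw ▸ hwW) WX WY hL
  obtain ⟨KX, KY⟩ := h.symm.X_left_mem_aux (by rw [h.core_symm]; exact hw ▸ hwW) WU WV hK
  -- Each of the three modules has eight generators, and `L` and `K` share `v`: this accounts for
  -- the number 23.
  set S := W ⊔ L ⊔ K with hS
  have hWS : W ≤ S := le_sup_left.trans le_sup_left
  have hLS : L ≤ S := le_sup_right.trans le_sup_left
  have hKS : K ≤ S := le_sup_right
  have h1 : W ⊔ span R {U v - (a : R) • v} ≤ S := by
    refine sup_le hWS ?_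
    rw [span_le, Set.singleton_subset_iff]
    exact sub_mem (hKS hUvK) (smul_mem _ _ (hKS hvK))
  have h2 : W ⊔ span R {X v - (a : R) • v} ≤ S := by
    refine sup_le hWS ?_
    rw [span_le, Set.singleton_subset_iff]
    exact sub_mem (hLS hXvL) (smul_mem _ _ (hLS hvL))
  have key : ∀ {f : M →ₗ[R] M}, (∀ m ∈ W, f m ∈ S) → (∀ m ∈ L, f m ∈ S) → (∀ m ∈ K, f m ∈ S) →
      ∀ m ∈ S, f m ∈ S := by
    intro f hf1 hf2 hf3
    suffices S ≤ S.comap f from this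
    conv_lhs => rw [hS]
    exact sup_le (sup_le hf1 hf2) hf3
  have hsub : ∀ {f : M →ₗ[R] M} {m : M}, f m - (a : R) • m ∈ S → m ∈ S → f m ∈ S := by
    intro f m hm hm'
    have := add_mem hm (smul_mem S (a : R) hm')
    rwa [sub_add_cancel] at this
  refine ⟨S, ?_, hLS hvL, key (fun m hm => hWS (WX m hm)) (fun m hm => hLS (LX m hm))
    (fun m hm => hsub (h2 (KX m hm)) (hKS hm)), key (fun m hm => hWS (WY m hm))
    (fun m hm => hLS (LY m hm)) (fun m hm => by rw [KY m hm]; exact smul_mem _ _ (hKS hm)),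
    key (fun m hm => hWS (WU m hm)) (fun m hm => hsub (h1 (LU m hm)) (hLS hm))
    (fun m hm => hKS (KU m hm)), key (fun m hm => hWS (WV m hm))
    (fun m hm => by rw [LV m hm]; exact smul_mem _ _ (hLS hm)) (fun m hm => hKS (KV m hm))⟩
  simp only [Set.insert_subset_iff, Set.singleton_subset_iff, SetLike.mem_coe] at hN
  obtain ⟨n1, n2, n3, n4, n5, n6, n7, n8, n9, n10, n11, n12, n13, n14, n15, n16, n17, n18, n19,
    n20, n21, n24, n25⟩ := hN
  have cw : w ∈ N := by
    rw [hw, core]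
    exact add_mem (sub_mem (sub_mem n19 (smul_mem _ _ n2)) (smul_mem _ _ n8)) (smul_mem _ _ n1)
  -- Passing to `U⁻¹ w` cancels the factor `U` in the core, which leaves only words available in
  -- `N`. Then `X w` follows from `(X - b)(X - c) w = 0`.
  have cX'w : X' w ∈ N := by
    rw [hw, h.X'_core, core]
    simp only [map_sub, map_add, map_smul, h.XU', h.right.X'X]
    exact add_mem (sub_mem (sub_mem n2 (smul_mem _ _ n18)) (smul_mem _ _ n1)) (smul_mem _ _ n9)
  have cXw : X w ∈ N := by
    have : X w = ((b : R) + c) • w - ((b : R) * c) • X' w := by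
      have := congrArg X' h.XX_core
      simpa only [← hw, map_sub, map_smul, h.left.X'X] using this
    rw [this]
    exact sub_mem (smul_mem _ _ cw) (smul_mem _ _ cX'w)
  have cYw : Y w ∈ N := by
    rw [hw, core]
    simp only [map_sub, map_add, map_smul, ← h.YU, h.Yv]
    exact add_mem (sub_mem (sub_mem n14 (smul_mem _ _ n4))
      (smul_mem _ _ (smul_mem _ _ n8))) (smul_mem _ _ (smul_mem _ _ n1))
  have nY' : Y' v ∈ N := mem_of_smul_eq a hv' n1
  have nV' : V' v ∈ N := mem_of_smul_eq a hV' n1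
  have nY'U : Y' (U v) ∈ N := by
    refine mem_of_smul_eq a (n := U v) ?_ n8
    rw [← h.Y'U, ← map_smul, hv']
  have nXV' : X (V' v) ∈ N := by
    refine mem_of_smul_eq a (n := X v) ?_ n2
    rw [← map_smul, hV']
  have nYXV' : Y (X (V' v)) ∈ N := by
    refine mem_of_smul_eq a (n := Y (X v)) ?_ n4
    rw [← map_smul, ← map_smul, hV']
  have nYV' : Y (V' v) ∈ N := by
    refine mem_of_smul_eq a (n := (a : R) • v) ?_ (smul_mem _ _ n1)
    rw [← map_smul, hV', h.Yv]
  have cY'w : Y' w ∈ N := by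
    rw [hw, core]
    simp only [map_sub, map_add, map_smul]
    exact add_mem (sub_mem (sub_mem n15 (smul_mem _ _ n6)) (smul_mem _ _ nY'U)) (smul_mem _ _ nY')
  have cVw : V w ∈ N := by
    rw [hw, core]
    simp only [map_sub, map_add, map_smul, h.XV, h.Vv]
    exact add_mem (sub_mem (sub_mem n16 (smul_mem _ _ (smul_mem _ _ n2))) (smul_mem _ _ n10))
      (smul_mem _ _ (smul_mem _ _ n1))
  have cV'w : V' w ∈ N := by
    rw [hw, core]
    simp only [map_sub, map_add, map_smul, h.XV']
    exact add_mem (sub_mem (sub_mem n17 (smul_mem _ _ nXV')) (smul_mem _ _ n11)) (smul_mem _ _ nV')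
  have cYVw : Y (V w) ∈ N := by
    rw [hw, core]
    simp only [map_sub, map_add, map_smul, h.XV, h.Vv, h.Yv]
    refine add_mem (sub_mem (sub_mem n20 (smul_mem _ _ (smul_mem _ _ n4)))
      (smul_mem _ _ ?_)) (smul_mem _ _ (smul_mem _ _ (smul_mem _ _ n1)))
    rw [← h.YV, ← h.YU, h.Yv, map_smul, map_smul]
    exact smul_mem _ _ n10
  have cYV'w : Y (V' w) ∈ N := by
    rw [hw, core]
    simp only [map_sub, map_add, map_smul, h.XV']
    refine add_mem (sub_mem (sub_mem n21 (smul_mem _ _ nYXV'))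
      (smul_mem _ _ ?_)) (smul_mem _ _ nYV')
    rw [← h.YV', ← h.YU, h.Yv, map_smul, map_smul]
    exact smul_mem _ _ n11
  refine sup_le (sup_le ?_ ?_) ?_
  · rw [hW, span_le]
    rintro _ (rfl | rfl | rfl | rfl | rfl | rfl | rfl | rfl) <;> assumption
  · rw [hL, span_le]
    rintro _ (rfl | rfl | rfl | rfl | rfl | rfl | rfl | rfl) <;> assumption
  · rw [hK, span_le]
    rintro _ (rfl | rfl | rfl | rfl | rfl | rfl | rfl | rfl) <;> assumption

end OpBipair
end Operators
end CubicQuotient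

namespace CubicQuotient

open Submodule

/-! ### The bimodule generated by `z y⁻¹ z` modulo `B u_z B`. -/

section Bimodule

variable {R A : Type*} [CommRing R] [Ring A] [Algebra R A]

/-- The bimodule `B u_z B`, for `B` the algebra generated by `x` and `y`. -/
def lowBimodule (R : Type*) {A : Type*} [CommRing R] [Ring A] [Algebra R A] (x y z : Aˣ) :
    Submodule R A :=
  Subalgebra.toSubmodule (pairAlg R x y) * unitSpan R z * Subalgebra.toSubmodule (pairAlg R x y)

/-- The bimodule `B m B` for `B` the algebra generated by `x` and `y`. -/
def cyclicBimodule (R : Type*) {A : Type*} [CommRing R] [Ring A] [Algebra R A] (x y : Aˣ) (m : A) :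
    Submodule R A :=
  Subalgebra.toSubmodule (pairAlg R x y) * span R {m} * Subalgebra.toSubmodule (pairAlg R x y)

theorem subalgebra_mul_mem {B : Subalgebra R A} {M : Submodule R A} {q m : A} (hq : q ∈ B)
    (hm : m ∈ Subalgebra.toSubmodule B * M * Subalgebra.toSubmodule B) :
    q * m ∈ Subalgebra.toSubmodule B * M * Subalgebra.toSubmodule B := by
  have h1 : q * m ∈ Subalgebra.toSubmodule B *
    (Subalgebra.toSubmodule B * M * Subalgebra.toSubmodule B) := mul_mem_mul hq hm
  rwa [← mul_assoc, ← mul_assoc, (Subalgebra.isIdempotentElem_toSubmodule B).eq] at h1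

theorem mul_subalgebra_mem {B : Subalgebra R A} {M : Submodule R A} {q m : A} (hq : q ∈ B)
    (hm : m ∈ Subalgebra.toSubmodule B * M * Subalgebra.toSubmodule B) :
    m * q ∈ Subalgebra.toSubmodule B * M * Subalgebra.toSubmodule B := by
  have h1 : m * q ∈ Subalgebra.toSubmodule B * M * Subalgebra.toSubmodule B *
    Subalgebra.toSubmodule B := mul_mem_mul hm hq
  rwa [mul_assoc, (Subalgebra.isIdempotentElem_toSubmodule B).eq] at h1

theorem mem_bimodule {B : Subalgebra R A} {M : Submodule R A} {m : A} (hm : m ∈ M) :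
    m ∈ Subalgebra.toSubmodule B * M * Subalgebra.toSubmodule B := by
  have h1 : (1 : A) ∈ Subalgebra.toSubmodule B := one_mem B
  simpa using mul_mem_mul (mul_mem_mul h1 hm) h1

theorem pairAlg_mem_lowBimodule {x y z : Aˣ} {q : A} (hq : q ∈ pairAlg R x y) :
    q ∈ lowBimodule R x y z := by
  simpa [lowBimodule] using subalgebra_mul_mem hq
    (mem_bimodule (B := pairAlg R x y) (one_mem_unitSpan (R := R) z))

/-- The operator on a quotient induced by a left multiplication. -/
def quotLeft (P : Submodule R A) (s : A) (h : ∀ m ∈ P, s * m ∈ P) : A ⧸ P →ₗ[R] A ⧸ P :=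
  P.mapQ P (LinearMap.mulLeft R s) h

/-- The operator on a quotient induced by a right multiplication. -/
def quotRight (P : Submodule R A) (s : A) (h : ∀ m ∈ P, m * s ∈ P) : A ⧸ P →ₗ[R] A ⧸ P :=
  P.mapQ P (LinearMap.mulRight R s) h

@[simp] theorem quotLeft_mk (P : Submodule R A) (s : A) (h : ∀ m ∈ P, s * m ∈ P) (m : A) :
    quotLeft P s h (P.mkQ m) = P.mkQ (s * m) := rfl

@[simp] theorem quotRight_mk (P : Submodule R A) (s : A) (h : ∀ m ∈ P, m * s ∈ P) (m : A) :
    quotRight P s h (P.mkQ m) = P.mkQ (m * s) := rfl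

theorem CubicPair.opPair_quotLeft {a b c : Rˣ} {x y : Aˣ} (h : CubicPair a b c x y)
    (P : Submodule R A) (h1 : ∀ m ∈ P, (x : A) * m ∈ P) (h2 : ∀ m ∈ P, (↑x⁻¹ : A) * m ∈ P)
    (h3 : ∀ m ∈ P, (y : A) * m ∈ P) (h4 : ∀ m ∈ P, (↑y⁻¹ : A) * m ∈ P) :
    OpPair a b c (quotLeft P x h1) (quotLeft P _ h2) (quotLeft P y h3) (quotLeft P _ h4) where
  XX' m := by
    obtain ⟨m, rfl⟩ := P.mkQ_surjective m; simp only [quotLeft_mk, Units.mul_inv_cancel_left]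
  X'X m := by
    obtain ⟨m, rfl⟩ := P.mkQ_surjective m; simp only [quotLeft_mk, Units.inv_mul_cancel_left]
  YY' m := by
    obtain ⟨m, rfl⟩ := P.mkQ_surjective m; simp only [quotLeft_mk, Units.mul_inv_cancel_left]
  Y'Y m := by
    obtain ⟨m, rfl⟩ := P.mkQ_surjective m; simp only [quotLeft_mk, Units.inv_mul_cancel_left]
  braid m := by
    obtain ⟨m, rfl⟩ := P.mkQ_surjective m; simp only [quotLeft_mk, h.tst_mul]
  cubX m := by
    obtain ⟨m, rfl⟩ := P.mkQ_surjective m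
    simp only [quotLeft_mk, h.sq_left_mul, map_add, map_sub, map_smul]
  cubY m := by
    obtain ⟨m, rfl⟩ := P.mkQ_surjective m
    simp only [quotLeft_mk, h.swap.sq_left_mul, map_add, map_sub, map_smul]

theorem CubicPair.opPair_quotRight {a b c : Rˣ} {x y : Aˣ} (h : CubicPair a b c x y)
    (P : Submodule R A) (h1 : ∀ m ∈ P, m * (x : A) ∈ P) (h2 : ∀ m ∈ P, m * (↑x⁻¹ : A) ∈ P)
    (h3 : ∀ m ∈ P, m * (y : A) ∈ P) (h4 : ∀ m ∈ P, m * (↑y⁻¹ : A) ∈ P) :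
    OpPair a b c (quotRight P x h1) (quotRight P _ h2) (quotRight P y h3) (quotRight P _ h4) where
  XX' m := by
    obtain ⟨m, rfl⟩ := P.mkQ_surjective m; simp only [quotRight_mk, Units.inv_mul_cancel_right]
  X'X m := by
    obtain ⟨m, rfl⟩ := P.mkQ_surjective m; simp only [quotRight_mk, Units.mul_inv_cancel_right]
  YY' m := by
    obtain ⟨m, rfl⟩ := P.mkQ_surjective m; simp only [quotRight_mk, Units.inv_mul_cancel_right]
  Y'Y m := by
    obtain ⟨m, rfl⟩ := P.mkQ_surjective m; simp only [quotRight_mk, Units.mul_inv_cancel_right]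
  braid m := by
    obtain ⟨m, rfl⟩ := P.mkQ_surjective m; simp only [quotRight_mk, mul_assoc, h.tst]
  cubX m := by
    obtain ⟨m, rfl⟩ := P.mkQ_surjective m
    simp only [quotRight_mk, mul_assoc, h.sq_left, mul_add, mul_sub, mul_smul_comm, mul_one,
      map_add, map_sub, map_smul]
  cubY m := by
    obtain ⟨m, rfl⟩ := P.mkQ_surjective m
    simp only [quotRight_mk, mul_assoc, h.swap.sq_left, mul_add, mul_sub, mul_smul_comm, mul_one,
      map_add, map_sub, map_smul]

namespace CubicTriple

variable {a b c : Rˣ} {x y z : Aˣ}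

theorem lowBimodule_le_outerModule (h : CubicTriple a b c x y z) :
    lowBimodule R x y z ≤ outerModule R x y z := by
  rw [lowBimodule, mul_assoc, Submodule.mul_le]
  intro q hq n hn
  suffices unitSpan R z * Subalgebra.toSubmodule (pairAlg R x y) ≤
      (outerModule R x y z).comap (LinearMap.mulLeft R q) from this hn
  rw [Submodule.mul_le]
  exact fun u hu q' hq' => h.mul_unitSpan_mul_mem hq hu hq'

theorem triple_le_lowBimodule (h : CubicTriple a b c x y z) :
    triple R y z ≤ lowBimodule R x y z :=
  mul_le_mul' (mul_le_mul' h.left.unitSpan_right_le le_rfl) h.left.unitSpan_right_le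

/-- The three strand relation for `x` and `y`, multiplied by `z` on both sides. -/
theorem three_mul_mem (h : CubicTriple a b c x y z) {v : A} (hv : v = z * ((↑y⁻¹ : A) * z)) :
    (a : R) • ((↑x⁻¹ : A) * (v * x)) - (a : R) • ((x : A) * (v * (↑x⁻¹ : A))) + x * v
      - (a : R) ^ 2 • ((↑x⁻¹ : A) * v) - v * x + (a : R) ^ 2 • (v * (↑x⁻¹ : A)) ∈
      lowBimodule R x y z := by
  have hx := left_mem_pairAlg (R := R) x y
  have hx' := h.left.left_inv_mem_pairAlg
  obtain ⟨n, hn⟩ : ∃ n, n = (y : A) * (z * y) := ⟨_, rfl⟩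
  have hnP : n ∈ lowBimodule R x y z := by
    rw [hn]
    exact h.triple_le_lowBimodule (triple_mem₃ (self_mem_unitSpan y) (self_mem_unitSpan z)
      (self_mem_unitSpan y))
  refine mem_of_unit_smul_mem (a ^ 2) ?_
  have e : ((a ^ 2 : Rˣ) : R) • ((a : R) • ((↑x⁻¹ : A) * (v * x))
      - (a : R) • ((x : A) * (v * (↑x⁻¹ : A))) + x * v
      - (a : R) ^ 2 • ((↑x⁻¹ : A) * v) - v * x + (a : R) ^ 2 • (v * (↑x⁻¹ : A))) =
      (a : R) • ((↑x⁻¹ : A) * (n * x)) - (a : R) • ((x : A) * (n * (↑x⁻¹ : A))) + x * n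
      - (a : R) ^ 2 • ((↑x⁻¹ : A) * n) - n * x + (a : R) ^ 2 • (n * (↑x⁻¹ : A)) := by
    have h1 := congrArg (fun m => (z : A) * (m * z)) h.left.three
    -- The part of the sandwiched relation that comes from `y` involves `z y z = y z y`, hence lies
    -- in `B u_z B`. Only the part in `v = z y⁻¹ z` is new.
    have hn' : n = z * (y * z) := by rw [hn, h.right.tst]
    subst hv hn'
    simp only [mul_sub, sub_mul, mul_add, add_mul, mul_assoc, smul_mul_assoc,
      mul_smul_comm, mul_zero, zero_mul, smul_sub, smul_smul, h.zx_mul, h.zx'_mul, ← h.zx,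
      ← h.zx'] at h1 ⊢
    push_cast
    linear_combination (norm := module) - h1
  rw [e]
  have s1 := fun {m} hm => subalgebra_mul_mem (m := m) (M := unitSpan R z) hx hm
  have s2 := fun {m} hm => subalgebra_mul_mem (m := m) (M := unitSpan R z) hx' hm
  have s3 := fun {m} hm => mul_subalgebra_mem (m := m) (M := unitSpan R z) hx hm
  have s4 := fun {m} hm => mul_subalgebra_mem (m := m) (M := unitSpan R z) hx' hm
  exact add_mem (sub_mem (sub_mem (add_mem (sub_mem (smul_mem _ _ (s2 (s3 hnP)))
    (smul_mem _ _ (s1 (s4 hnP)))) (s1 hnP)) (smul_mem _ _ (s2 hnP))) (s3 hnP))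
    (smul_mem _ _ (s4 hnP))

/-- A submodule containing `B u_z B` and `23` more words contains `B z y⁻¹ z B`. -/
theorem cyclicBimodule_le (h : CubicTriple a b c x y z) {F : Submodule R A}
    (hF : lowBimodule R x y z ≤ F) {v : A} (hv : v = z * ((↑y⁻¹ : A) * z))
    (hvF : ({v, x * v, ↑x⁻¹ * v, y * (x * v), y * (↑x⁻¹ * v), ↑y⁻¹ * (x * v), ↑y⁻¹ * (↑x⁻¹ * v),
      v * x, v * ↑x⁻¹, v * x * y, v * x * ↑y⁻¹, v * ↑x⁻¹ * y, v * ↑x⁻¹ * ↑y⁻¹,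
      y * (x * (v * x)), ↑y⁻¹ * (x * (v * x)), x * (v * x * y), x * (v * x * ↑y⁻¹),
      x * (v * ↑x⁻¹), x * (v * x), y * (x * (v * x * y)), y * (x * (v * x * ↑y⁻¹)),
      v * x * ↑y⁻¹ * x, x * (↑y⁻¹ * (x * v))} : Set A) ⊆ F) :
    cyclicBimodule R x y v ≤ F := by
  obtain ⟨P, hP⟩ : ∃ P, P = lowBimodule R x y z := ⟨_, rfl⟩
  have hx := left_mem_pairAlg (R := R) x y
  have hx' := h.left.left_inv_mem_pairAlg
  have hy := right_mem_pairAlg (R := R) x y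
  have hy' := h.left.right_inv_mem_pairAlg
  have sl : ∀ {q}, q ∈ pairAlg R x y → ∀ m ∈ P, q * m ∈ P := by
    intro q hq m hm
    rw [hP] at hm ⊢
    exact subalgebra_mul_mem hq hm
  have sr : ∀ {q}, q ∈ pairAlg R x y → ∀ m ∈ P, m * q ∈ P := by
    intro q hq m hm
    rw [hP] at hm ⊢
    exact mul_subalgebra_mem hq hm
  have mk_eq : ∀ {m n : A}, m - n ∈ P → P.mkQ m = P.mkQ n := fun hm =>
    (Submodule.Quotient.eq P).2 hm
  -- On the quotient by `B u_z B`, left and right multiplications are the commuting braided pairs of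
  -- the abstract setting; `Yv` and `Vv` hold since `z y⁻¹ z` is the extra generator for the pair
  -- `(y, z)`.
  have bip : OpBipair a b c (quotLeft P _ (sl hx)) (quotLeft P _ (sl hx')) (quotLeft P _ (sl hy))
      (quotLeft P _ (sl hy')) (quotRight P _ (sr hx)) (quotRight P _ (sr hx'))
      (quotRight P _ (sr hy)) (quotRight P _ (sr hy')) (P.mkQ v) :=
    { left := h.left.opPair_quotLeft P _ _ _ _
      right := h.left.opPair_quotRight P _ _ _ _
      XU := by
        intro m; obtain ⟨m, rfl⟩ := P.mkQ_surjective m; simp only [quotLeft_mk, quotRight_mk, mul_assoc]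
      XV := by
        intro m; obtain ⟨m, rfl⟩ := P.mkQ_surjective m; simp only [quotLeft_mk, quotRight_mk, mul_assoc]
      YU := by
        intro m; obtain ⟨m, rfl⟩ := P.mkQ_surjective m; simp only [quotLeft_mk, quotRight_mk, mul_assoc]
      YV := by
        intro m; obtain ⟨m, rfl⟩ := P.mkQ_surjective m; simp only [quotLeft_mk, quotRight_mk, mul_assoc]
      Yv := by
        rw [quotLeft_mk, ← map_smul]
        refine mk_eq ?_
        rw [hP, hv]
        exact h.triple_le_lowBimodule h.right.mul_top_sub_mem
      Vv := by
        rw [quotRight_mk, ← map_smul]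
        refine mk_eq ?_
        rw [hP, hv, mul_assoc, mul_assoc]
        exact h.triple_le_lowBimodule h.right.top_mul_sub_mem
      rel := by
        simp only [quotLeft_mk, quotRight_mk, ← map_smul, ← map_sub, ← map_add]
        rw [← LinearMap.mem_ker, Submodule.ker_mkQ, hP]
        exact h.three_mul_mem hv }
  obtain ⟨S, hSF, hvS, SX, SY, SU, SV⟩ := bip.exists_stable_le (N := F.map P.mkQ) (by
    simp only [Set.insert_subset_iff, Set.singleton_subset_iff, SetLike.mem_coe] at hvF ⊢
    simp only [quotLeft_mk, quotRight_mk]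
    refine ⟨?_, ?_, ?_, ?_, ?_, ?_, ?_, ?_, ?_, ?_, ?_, ?_, ?_, ?_, ?_, ?_, ?_, ?_, ?_, ?_, ?_,
      ?_, ?_⟩ <;> refine mem_map_of_mem ?_ <;> tauto)
  have hSF' : S.comap P.mkQ ≤ F := by
    refine (comap_mono hSF).trans ?_
    rw [comap_map_mkQ, hP]
    exact sup_le hF le_rfl
  refine le_trans ?_ hSF'
  rw [cyclicBimodule, Submodule.mul_le]
  intro m hm q hq
  refine mul_pairAlg_mem (fun m hm => SU _ hm) (fun m hm => SV _ hm) hq ?_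
  suffices Subalgebra.toSubmodule (pairAlg R x y) * span R {v} ≤ S.comap P.mkQ from this hm
  rw [Submodule.mul_le]
  intro q hq m hm
  refine pairAlg_mul_mem (fun m hm => SX _ hm) (fun m hm => SY _ hm) hq ?_
  exact (span_singleton_le_iff_mem v (S.comap P.mkQ)).2 hvS hm

end CubicTriple
end Bimodule
end CubicQuotient

namespace CubicQuotient

open Submodule

/-! ### The whole algebra: two more words and stability under `z`. -/

section Top

variable {R A : Type*} [CommRing R] [Ring A] [Algebra R A]

/-- The bimodule `B u_z B + B z y⁻¹ z B`. -/
def midBimodule (R : Type*) {A : Type*} [CommRing R] [Ring A] [Algebra R A] (x y z : Aˣ) :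
    Submodule R A :=
  lowBimodule R x y z ⊔ cyclicBimodule R x y (z * ((↑y⁻¹ : A) * z))

/-- The bimodule `midBimodule` enlarged by two words of length five. -/
def topBimodule (R : Type*) {A : Type*} [CommRing R] [Ring A] [Algebra R A] (x y z : Aˣ) :
    Submodule R A :=
  midBimodule R x y z ⊔ span R {(z : A) * (y * ((↑x⁻¹ : A) * (y * z))),
    (↑z⁻¹ : A) * ((↑y⁻¹ : A) * (x * ((↑y⁻¹ : A) * (↑z⁻¹ : A))))}

theorem mul_midBimodule_mem {x y z : Aˣ} {q m : A} (hq : q ∈ pairAlg R x y)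
    (hm : m ∈ midBimodule R x y z) : q * m ∈ midBimodule R x y z := by
  obtain ⟨m, hm', n, hn, rfl⟩ := mem_sup.1 hm
  rw [mul_add]
  exact add_mem (mem_sup_left (subalgebra_mul_mem hq hm')) (mem_sup_right (subalgebra_mul_mem hq hn))

theorem midBimodule_mul_mem {x y z : Aˣ} {q m : A} (hq : q ∈ pairAlg R x y)
    (hm : m ∈ midBimodule R x y z) : m * q ∈ midBimodule R x y z := by
  obtain ⟨m, hm', n, hn, rfl⟩ := mem_sup.1 hm
  rw [add_mul]
  exact add_mem (mem_sup_left (mul_subalgebra_mem hq hm')) (mem_sup_right (mul_subalgebra_mem hq hn))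

theorem commute_of_mem_unitSpan {s t : Aˣ} (h : Commute (s : A) (t : A)) {u p : A}
    (hu : u ∈ unitSpan R s) (hp : p ∈ unitSpan R t) : Commute u p := by
  have h1 : ∀ {s t : Aˣ} {u : A}, Commute (s : A) (t : A) → u ∈ unitSpan R s → Commute u t := by
    intro s t u h hu
    have : unitSpan R s ≤ Subalgebra.toSubmodule (Subalgebra.centralizer R {(t : A)}) := by
      refine unitSpan_le (Subalgebra.one_mem _) ?_ ?_ <;>
      simp only [Subalgebra.mem_toSubmodule, Subalgebra.mem_centralizer_iff, Set.mem_singleton_iff,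
        forall_eq]
      · exact h.symm.eq
      · exact h.units_inv_left.symm.eq
    have := this hu
    simp only [Subalgebra.mem_toSubmodule, Subalgebra.mem_centralizer_iff, Set.mem_singleton_iff,
        forall_eq] at this
    exact this.symm
  have h2 := h1 h hu
  have : unitSpan R t ≤ Subalgebra.toSubmodule (Subalgebra.centralizer R {u}) := by
    refine unitSpan_le (Subalgebra.one_mem _) ?_ ?_ <;>
    simp only [Subalgebra.mem_toSubmodule, Subalgebra.mem_centralizer_iff, Set.mem_singleton_iff,
      forall_eq]
    · exact h2.eq
    · exact h2.units_inv_right.eq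
  have := this hp
  simp only [Subalgebra.mem_toSubmodule, Subalgebra.mem_centralizer_iff, Set.mem_singleton_iff,
      forall_eq] at this
  exact this

namespace CubicTriple

variable {a b c : Rˣ} {x y z : Aˣ}

theorem triple_le_midBimodule (h : CubicTriple a b c x y z) :
    triple R z y ≤ midBimodule R x y z := by
  refine h.right.triple_swap_le.trans (sup_le (h.triple_le_lowBimodule.trans le_sup_left) ?_)
  rw [span_singleton_le_iff_mem]
  exact mem_sup_right (mem_bimodule (mem_span_singleton_self _))

/-- `u_z (u_x u_y u_x) u_z` lies in `midBimodule`. -/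
theorem mul_triple_mul_mem (h : CubicTriple a b c x y z) {u t u' : A} (hu : u ∈ unitSpan R z)
    (ht : t ∈ triple R x y) (hu' : u' ∈ unitSpan R z) : u * (t * u') ∈ midBimodule R x y z := by
  suffices triple R x y ≤ (midBimodule R x y z).comap
      (LinearMap.mulLeft R u ∘ₗ LinearMap.mulRight R u') from this ht
  rw [triple, Submodule.mul_le]
  intro m hm r hr
  suffices unitSpan R x * unitSpan R y ≤ (midBimodule R x y z).comap
      (LinearMap.mulLeft R u ∘ₗ LinearMap.mulRight R (r * u')) by
    have := this hm
    simpa [mul_assoc] using this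
  rw [Submodule.mul_le]
  intro p hp q hq
  have h1 := commute_of_mem_unitSpan h.comm hu hp
  have h2 := commute_of_mem_unitSpan h.comm hu' hr
  have e : u * (p * q * (r * u')) = p * (u * (q * u') * r) := by
    rw [← h2.eq]
    simp only [mul_assoc]
    rw [← mul_assoc u p, h1.eq, mul_assoc]
  simp only [mem_comap, LinearMap.comp_apply, LinearMap.mulLeft_apply, LinearMap.mulRight_apply, e]
  exact mul_midBimodule_mem (h.left.unitSpan_left_le hp)
    (midBimodule_mul_mem (h.left.unitSpan_left_le hr) (h.triple_le_midBimodule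
      (triple_mem₃ hu hq hu')))

/-- If `x e` is `a e` modulo a bimodule and `y` commutes with `e`, then also `y e` is `a e`. -/
theorem y_mul_sub_mem (h : CubicTriple a b c x y z) {e : A}
    (hx : (x : A) * e - (a : R) • e ∈ midBimodule R x y z) (hy : (y : A) * e = e * y) :
    (y : A) * e - (a : R) • e ∈ midBimodule R x y z := by
  have hxB := left_mem_pairAlg (R := R) x y
  have hx' := h.left.left_inv_mem_pairAlg
  have hyB := right_mem_pairAlg (R := R) x y
  have hy' := h.left.right_inv_mem_pairAlg
  have h1 : (↑x⁻¹ : A) * ((↑y⁻¹ : A) * (x * (y * (x * e - (a : R) • e)))) ∈ midBimodule R x y z :=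
    mul_midBimodule_mem hx' (mul_midBimodule_mem hy' (mul_midBimodule_mem hxB
      (mul_midBimodule_mem hyB hx)))
  have h2 : (↑x⁻¹ : A) * ((↑y⁻¹ : A) * ((x * e - (a : R) • e) * y)) ∈ midBimodule R x y z :=
    mul_midBimodule_mem hx' (mul_midBimodule_mem hy' (midBimodule_mul_mem hyB hx))
  have h3 : (↑x⁻¹ : A) * (x * e - (a : R) • e) ∈ midBimodule R x y z := mul_midBimodule_mem hx' hx
  -- Modulo `midBimodule`, `x(ye) = (xe)y = a ye`. Hence `xyxe = yxye` reads `a² ye = a y² e`, and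
  -- cancelling `a` and `y` gives `ye = ae`. The formula makes this computation explicit.
  have e1 : (y : A) * e - (a : R) • e =
      (↑x⁻¹ : A) * ((↑y⁻¹ : A) * (x * (y * (x * e - (a : R) • e))))
      + (a : R) • ((↑x⁻¹ : A) * ((↑y⁻¹ : A) * ((x * e - (a : R) • e) * y)))
      - (a : R) • ((↑x⁻¹ : A) * (x * e - (a : R) • e)) := by
    simp only [mul_sub, sub_mul, mul_smul_comm, smul_mul_assoc, mul_assoc, ← h.left.tst_mul,
      Units.inv_mul_cancel_left, ← hy]
    module
  rw [e1]
  exact sub_mem (add_mem h1 (smul_mem _ _ h2)) (smul_mem _ _ h3)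

/-- Transfers the eigenvector property of `y x⁻¹ y` to `y⁻¹ x y⁻¹`, proportional to it modulo `u_x
u_y u_x`. -/
theorem barTop_left (h : CubicPair a b c x y) :
    (x : A) * ((↑y⁻¹ : A) * (x * (↑y⁻¹ : A))) - (a : R) • ((↑y⁻¹ : A) * (x * (↑y⁻¹ : A))) ∈
      triple R x y := by
  refine mem_of_unit_smul_mem (b * c) ?_
  have h1 := h.barTop_sub_top_mem
  have h2 := h.mul_top_sub_mem
  have h3 : (x : A) * (((b : R) * c) • ((↑y⁻¹ : A) * (x * (↑y⁻¹ : A))) - (y : A) * ((↑x⁻¹ : A) * y)) ∈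
      triple R x y := by
    rw [← h.unitSpan_mul_triple]
    exact mul_mem_mul (self_mem_unitSpan x) h1
  have := sub_mem (add_mem h2 h3) (smul_mem _ (a : R) h1)
  refine (congrArg (· ∈ triple R x y) ?_).mp this
  simp only [mul_sub, mul_smul_comm]
  push_cast
  module

theorem barTop_right (h : CubicPair a b c x y) :
    (↑y⁻¹ : A) * (x * ((↑y⁻¹ : A) * x)) - (a : R) • ((↑y⁻¹ : A) * (x * (↑y⁻¹ : A))) ∈
      triple R x y := by
  refine mem_of_unit_smul_mem (b * c) ?_
  have h1 := h.barTop_sub_top_mem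
  have h2 := h.top_mul_sub_mem
  have h3 : (((b : R) * c) • ((↑y⁻¹ : A) * (x * (↑y⁻¹ : A))) - (y : A) * ((↑x⁻¹ : A) * y)) * x ∈
      triple R x y := by
    rw [← h.triple_mul_unitSpan]
    exact mul_mem_mul h1 (self_mem_unitSpan x)
  have := sub_mem (add_mem h2 h3) (smul_mem _ (a : R) h1)
  refine (congrArg (· ∈ triple R x y) ?_).mp this
  simp only [sub_mul, smul_mul_assoc, mul_assoc]
  push_cast
  module

/-- The letter `x` passes through `z` to reach the eigenvector `y x⁻¹ y`, and the error term stays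
in `z u_x u_y u_x z`. For `y`, two braid moves give `y·zyx⁻¹yz = zyz·x⁻¹yz = zyx⁻¹·zyz = zyx⁻¹yz·y`.
-/
theorem e₂₂_stable (h : CubicTriple a b c x y z) {e : A}
    (he : e = (z : A) * (y * ((↑x⁻¹ : A) * (y * z)))) :
    (x : A) * e - (a : R) • e ∈ midBimodule R x y z ∧ e * x - (a : R) • e ∈ midBimodule R x y z ∧
      (y : A) * e = e * y := by
  refine ⟨?_, ?_, ?_⟩
  · have := h.mul_triple_mul_mem (self_mem_unitSpan z) h.left.mul_top_sub_mem (self_mem_unitSpan z)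
    simpa only [he, mul_sub, sub_mul, mul_smul_comm, smul_mul_assoc, mul_assoc, h.zx_mul] using this
  · have := h.mul_triple_mul_mem (self_mem_unitSpan z) h.left.top_mul_sub_mem (self_mem_unitSpan z)
    simpa only [he, mul_sub, sub_mul, mul_smul_comm, smul_mul_assoc, mul_assoc, h.zx] using this
  · simp only [he, mul_assoc, ← h.right.tst_mul, h.right.tst, h.zx'_mul]

theorem e₂₃_stable (h : CubicTriple a b c x y z) {e : A}
    (he : e = (↑z⁻¹ : A) * ((↑y⁻¹ : A) * (x * ((↑y⁻¹ : A) * (↑z⁻¹ : A))))) :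
    (x : A) * e - (a : R) • e ∈ midBimodule R x y z ∧ e * x - (a : R) • e ∈ midBimodule R x y z ∧
      (y : A) * e = e * y := by
  refine ⟨?_, ?_, ?_⟩
  · have := h.mul_triple_mul_mem (inv_mem_unitSpan z) (barTop_left h.left) (inv_mem_unitSpan z)
    simpa only [he, mul_sub, sub_mul, mul_smul_comm, smul_mul_assoc, mul_assoc, h.z'x_mul] using this
  · have := h.mul_triple_mul_mem (inv_mem_unitSpan z) (barTop_right h.left) (inv_mem_unitSpan z)
    simpa only [he, mul_sub, sub_mul, mul_smul_comm, smul_mul_assoc, mul_assoc, h.z'x] using this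
  · simp only [he, mul_assoc]
    rw [h.right.swap.ts't'_mul, h.zx_mul, h.right.ts't']


theorem mul_sub_mem_topBimodule {q e : A} (hq : (q : A) * e - (a : R) • e ∈ midBimodule R x y z)
    (he : e ∈ topBimodule R x y z) : q * e ∈ topBimodule R x y z := by
  have := add_mem (mem_sup_left hq : _ ∈ topBimodule R x y z) (smul_mem _ (a : R) he)
  rwa [sub_add_cancel] at this

theorem sub_mul_mem_topBimodule {q e : A} (hq : e * (q : A) - (a : R) • e ∈ midBimodule R x y z)
    (he : e ∈ topBimodule R x y z) : e * q ∈ topBimodule R x y z := by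
  have := add_mem (mem_sup_left hq : _ ∈ topBimodule R x y z) (smul_mem _ (a : R) he)
  rwa [sub_add_cancel] at this

theorem e₂₂_mem (R : Type*) [CommRing R] [Algebra R A] (x y z : Aˣ) :
    (z : A) * (y * ((↑x⁻¹ : A) * (y * z))) ∈ topBimodule R x y z :=
  mem_sup_right (subset_span (by simp))

theorem e₂₃_mem (R : Type*) [CommRing R] [Algebra R A] (x y z : Aˣ) :
    (↑z⁻¹ : A) * ((↑y⁻¹ : A) * (x * ((↑y⁻¹ : A) * (↑z⁻¹ : A)))) ∈ topBimodule R x y z :=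
  mem_sup_right (subset_span (by simp))

theorem mul_topBimodule_mem (h : CubicTriple a b c x y z) {q m : A} (hq : q ∈ pairAlg R x y)
    (hm : m ∈ topBimodule R x y z) : q * m ∈ topBimodule R x y z := by
  obtain ⟨hx1, -, hy1⟩ := h.e₂₂_stable rfl
  obtain ⟨hx2, -, hy2⟩ := h.e₂₃_stable rfl
  have of_gen : ∀ {q : A}, q ∈ pairAlg R x y →
      q * ((z : A) * (y * ((↑x⁻¹ : A) * (y * z)))) ∈ topBimodule R x y z →
      q * ((↑z⁻¹ : A) * ((↑y⁻¹ : A) * (x * ((↑y⁻¹ : A) * (↑z⁻¹ : A))))) ∈ topBimodule R x y z →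
      ∀ m ∈ topBimodule R x y z, q * m ∈ topBimodule R x y z := by
    intro q hq h1 h2 m hm
    obtain ⟨m, hm', n, hn, rfl⟩ := mem_sup.1 hm
    rw [mul_add]
    refine add_mem (mem_sup_left (mul_midBimodule_mem hq hm')) (mul_mem_of_span ?_ hn)
    rintro _ (rfl | rfl) <;> assumption
  exact pairAlg_mul_mem (of_gen (left_mem_pairAlg x y) (mul_sub_mem_topBimodule hx1 (e₂₂_mem R x y z))
    (mul_sub_mem_topBimodule hx2 (e₂₃_mem R x y z))) (of_gen (right_mem_pairAlg x y)
    (mul_sub_mem_topBimodule (h.y_mul_sub_mem hx1 hy1) (e₂₂_mem R x y z))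
    (mul_sub_mem_topBimodule (h.y_mul_sub_mem hx2 hy2) (e₂₃_mem R x y z))) hq hm

theorem topBimodule_mul_mem (h : CubicTriple a b c x y z) {q m : A} (hq : q ∈ pairAlg R x y)
    (hm : m ∈ topBimodule R x y z) : m * q ∈ topBimodule R x y z := by
  obtain ⟨hx1, hx1', hy1⟩ := h.e₂₂_stable rfl
  obtain ⟨hx2, hx2', hy2⟩ := h.e₂₃_stable rfl
  have of_gen : ∀ {q : A}, q ∈ pairAlg R x y →
      (z : A) * (y * ((↑x⁻¹ : A) * (y * z))) * q ∈ topBimodule R x y z →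
      (↑z⁻¹ : A) * ((↑y⁻¹ : A) * (x * ((↑y⁻¹ : A) * (↑z⁻¹ : A)))) * q ∈ topBimodule R x y z →
      ∀ m ∈ topBimodule R x y z, m * q ∈ topBimodule R x y z := by
    intro q hq h1 h2 m hm
    obtain ⟨m, hm', n, hn, rfl⟩ := mem_sup.1 hm
    rw [add_mul]
    refine add_mem (mem_sup_left (midBimodule_mul_mem hq hm')) (span_mul_mem ?_ hn)
    rintro _ (rfl | rfl) <;> assumption
  refine mul_pairAlg_mem (of_gen (left_mem_pairAlg x y)
    (sub_mul_mem_topBimodule hx1' (e₂₂_mem R x y z))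
    (sub_mul_mem_topBimodule hx2' (e₂₃_mem R x y z))) (of_gen (right_mem_pairAlg x y) ?_ ?_) hq hm
  · rw [← hy1]
    exact mul_sub_mem_topBimodule (h.y_mul_sub_mem hx1 hy1) (e₂₂_mem R x y z)
  · rw [← hy2]
    exact mul_sub_mem_topBimodule (h.y_mul_sub_mem hx2 hy2) (e₂₃_mem R x y z)

theorem cyclic_mem_midBimodule (R : Type*) [CommRing R] [Algebra R A] (x y z : Aˣ) :
    (z : A) * ((↑y⁻¹ : A) * z) ∈ midBimodule R x y z :=
  mem_sup_right (mem_bimodule (mem_span_singleton_self _))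

/-- `u_z B u_z` lies in `topBimodule`. -/
theorem mul_pairAlg_mul_mem (h : CubicTriple a b c x y z) {u q u' : A} (hu : u ∈ unitSpan R z)
    (hq : q ∈ pairAlg R x y) (hu' : u' ∈ unitSpan R z) : u * (q * u') ∈ topBimodule R x y z := by
  have hx := left_mem_pairAlg (R := R) x y
  have hx' := h.left.left_inv_mem_pairAlg
  have hy := right_mem_pairAlg (R := R) x y
  have hy' := h.left.right_inv_mem_pairAlg
  have low : ∀ {m}, m ∈ lowBimodule R x y z → m ∈ topBimodule R x y z := fun hm =>
    mem_sup_left (mem_sup_left hm)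
  have hv := cyclic_mem_midBimodule R x y z
  have htop : (y : A) * ((↑x⁻¹ : A) * y) ∈ pairAlg R x y := mul_mem hy (mul_mem hx' hy)
  obtain ⟨m, hm, n, hn, rfl⟩ := mem_sup.1 (show q ∈ tripleTop R x y from h.left.pairAlg_eq ▸ hq)
  rw [add_mul, mul_add]
  refine add_mem (mem_sup_left (h.mul_triple_mul_mem hu hm hu')) ?_
  suffices ∀ {t : A}, t = y * ((↑x⁻¹ : A) * y) → u * (t * u') ∈ topBimodule R x y z by
    obtain ⟨r, rfl⟩ := mem_span_singleton.1 hn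
    rw [smul_mul_assoc, mul_smul_comm]
    exact smul_mem _ _ (this rfl)
  intro t ht
  suffices unitSpan R z ≤ (topBimodule R x y z).comap
      (LinearMap.mulLeft R u ∘ₗ LinearMap.mulLeft R t) from this hu'
  have ends : ∀ {u' : A}, t * u' ∈ topBimodule R x y z → (z : A) * (t * u') ∈ topBimodule R x y z →
      (↑z⁻¹ : A) * (t * u') ∈ topBimodule R x y z →
      u * (t * u') ∈ topBimodule R x y z := by
    intro u' h1 h2 h3
    suffices unitSpan R z ≤ (topBimodule R x y z).comap
      (LinearMap.mulRight R (t * u')) from this hu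
    exact unitSpan_le (by simpa using h1) h2 h3
  have htB : t ∈ pairAlg R x y := ht ▸ htop
  have hr : ∀ {u'}, u' ∈ unitSpan R z → t * u' ∈ topBimodule R x y z := fun hu' =>
    low (subalgebra_mul_mem htB (mem_bimodule hu'))
  have hl : ∀ {u'}, u' ∈ unitSpan R z → u' * t ∈ topBimodule R x y z := fun hu' =>
    low (mul_subalgebra_mem htB (mem_bimodule hu'))
  refine unitSpan_le (ends ?_ ?_ ?_) (ends ?_ ?_ ?_) (ends ?_ ?_ ?_)
  · exact hr (one_mem_unitSpan z)
  · simpa using hl (self_mem_unitSpan z)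
  · simpa using hl (inv_mem_unitSpan z)
  · exact hr (self_mem_unitSpan z)
  · have := e₂₂_mem R x y z
    rw [ht]
    simpa only [mul_assoc] using this
  -- The words of mixed sign are conjugates of `z y⁻¹ z`: by `yx` here, and by `(xy)⁻¹` for the
  -- other one.
  · have e : (↑z⁻¹ : A) * (t * z) =
        y * (x * (z * ((↑y⁻¹ : A) * z) * ((↑x⁻¹ : A) * (↑y⁻¹ : A)))) := by
      rw [ht]
      simp only [mul_assoc]
      rw [h.zx'_mul, ← h.zx_mul, h.left.swap.ts't'_mul, h.right.swap.tst'_mul, h.right.swap.tst',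
        h.zx'_mul, Units.mul_inv_cancel_left]
    rw [e]
    exact mem_sup_left (mul_midBimodule_mem hy (mul_midBimodule_mem hx
      (midBimodule_mul_mem (mul_mem hx' hy') hv)))
  · exact hr (inv_mem_unitSpan z)
  · have e : (z : A) * (t * (↑z⁻¹ : A)) =
        (↑y⁻¹ : A) * ((↑x⁻¹ : A) * (z * ((↑y⁻¹ : A) * z) * (x * y))) := by
      rw [ht]
      simp only [mul_assoc]
      rw [h.zx_mul, ← h.zx'_mul, h.left.swap.t's't_mul, h.right.swap.t'st_mul, h.right.swap.t'st,
        h.z'x'_mul, Units.inv_mul_cancel_left]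
    rw [e]
    exact mem_sup_left (mul_midBimodule_mem hy' (mul_midBimodule_mem hx'
      (midBimodule_mul_mem (mul_mem hx hy) hv)))
  -- The word `e₂₃` contains `y⁻¹ x y⁻¹` instead of `y x⁻¹ y`; the proportionality of the two
  -- bridges the difference.
  · have h1 := h.mul_triple_mul_mem (inv_mem_unitSpan z) h.left.barTop_sub_top_mem
      (inv_mem_unitSpan z)
    have h2 := sub_mem (smul_mem _ ((b : R) * c) (e₂₃_mem R x y z))
      (mem_sup_left h1 : _ ∈ topBimodule R x y z)
    rw [ht]
    simpa only [sub_mul, mul_sub, smul_mul_assoc, mul_smul_comm, mul_assoc, sub_sub_cancel] using h2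

/-- One has `z y⁻¹ z = y⁻¹ z⁻¹ y z²`. The cubic relation for `z²` leaves three words, each of which
the braid relations bring into `B u_z B u_z B`. -/
theorem cyclic_mul_mul_mem (h : CubicTriple a b c x y z) {p : A} (hp : p ∈ unitSpan R x) :
    (z : A) * ((↑y⁻¹ : A) * (z * (p * ((↑y⁻¹ : A) * z)))) ∈ topBimodule R x y z := by
  have hpB := h.left.unitSpan_left_le hp
  have hy := right_mem_pairAlg (R := R) x y
  have hy' := h.left.right_inv_mem_pairAlg
  have hz := self_mem_unitSpan (R := R) z
  have hz' := inv_mem_unitSpan (R := R) z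
  have hc := commute_of_mem_unitSpan h.comm hz hp
  have hc' := commute_of_mem_unitSpan h.comm hz' hp
  have c1 : ∀ m, (z : A) * (p * m) = p * (z * m) := fun m => by rw [← mul_assoc, hc.eq, mul_assoc]
  have c2 : ∀ m, (↑z⁻¹ : A) * (p * m) = p * (↑z⁻¹ * m) := fun m => by
    rw [← mul_assoc, hc'.eq, mul_assoc]
  have e : ∀ m : A, (z : A) * ((↑y⁻¹ : A) * (z * m)) =
      (↑y⁻¹ : A) * ((↑z⁻¹ : A) * (y * (z * (z * m)))) := fun m => by
    rw [h.right.swap.t's't_mul, Units.inv_mul_cancel_left]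
  rw [e, h.right.swap.sq_left_mul]
  simp only [mul_add, mul_sub, mul_smul_comm]
  refine add_mem (sub_mem (smul_mem _ _ ?_) (smul_mem _ _ ?_)) (smul_mem _ _ ?_)
  · have e1 : (↑y⁻¹ : A) * ((↑z⁻¹ : A) * (y * (z * (p * ((↑y⁻¹ : A) * z))))) =
        z * (((↑y⁻¹ : A) * (p * (↑y⁻¹ : A))) * z) := by
      rw [h.right.swap.t's't_mul, Units.inv_mul_cancel_left]
      simp only [mul_assoc]
    rw [e1]
    exact h.mul_pairAlg_mul_mem hz (mul_mem hy' (mul_mem hpB hy')) hz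
  · refine h.mul_topBimodule_mem hy' ?_
    have := h.mul_pairAlg_mul_mem hz' (mul_mem hy (mul_mem hpB hy')) hz
    simpa only [mul_assoc] using this
  · have e1 : (↑y⁻¹ : A) * ((↑z⁻¹ : A) * (y * ((↑z⁻¹ : A) * (p * ((↑y⁻¹ : A) * z))))) =
        (↑y⁻¹ : A) * ((↑z⁻¹ : A) * ((y * (p * y)) * (↑z⁻¹ : A)) * (↑y⁻¹ : A)) := by
      rw [c2, h.right.t's't]
      simp only [mul_assoc]
    rw [e1]
    exact h.mul_topBimodule_mem hy' (h.topBimodule_mul_mem hy'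
      (h.mul_pairAlg_mul_mem hz' (mul_mem hy (mul_mem hpB hy)) hz'))

/-- Since `p` commutes with `z`, the word begins with `z q z`, which lies in `u_y u_z u_y + R z y⁻¹
z`. The first part leaves words with two letters `z^{±1}`, the second is `cyclic_mul_mul_mem`. -/
theorem z_mul_word_mem (h : CubicTriple a b c x y z) {p q : A} (hp : p ∈ unitSpan R x)
    (hq : q ∈ unitSpan R y) :
    (z : A) * (q * (p * (z * ((↑y⁻¹ : A) * z)))) ∈ topBimodule R x y z := by
  have hpB := h.left.unitSpan_left_le hp
  have hy' := h.left.right_inv_mem_pairAlg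
  have hz := self_mem_unitSpan (R := R) z
  have hc := commute_of_mem_unitSpan h.comm hz hp
  have e : (z : A) * (q * (p * (z * ((↑y⁻¹ : A) * z)))) =
      z * (q * z) * (p * ((↑y⁻¹ : A) * z)) := by
    simp only [mul_assoc]
    rw [← mul_assoc p, ← hc.eq, mul_assoc]
  rw [e]
  have h1 := h.right.triple_swap_le (triple_mem₃ hz hq hz)
  obtain ⟨m, hm, n, hn, e1⟩ := mem_sup.1 h1
  rw [← e1, add_mul]
  refine add_mem ?_ ?_
  · suffices triple R y z ≤ (topBimodule R x y z).comap
        (LinearMap.mulRight R (p * ((↑y⁻¹ : A) * z))) from this hm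
    rw [triple, mul_assoc, Submodule.mul_le]
    intro q1 hq1 n hn
    suffices unitSpan R z * unitSpan R y ≤ (topBimodule R x y z).comap
        (LinearMap.mulLeft R q1 ∘ₗ LinearMap.mulRight R (p * ((↑y⁻¹ : A) * z))) by
      simpa [mul_assoc] using this hn
    rw [Submodule.mul_le]
    intro u hu q2 hq2
    refine h.mul_topBimodule_mem (h.left.unitSpan_right_le hq1) ?_
    have := h.mul_pairAlg_mul_mem hu (mul_mem (h.left.unitSpan_right_le hq2) (mul_mem hpB hy')) hz
    simpa [mul_assoc] using this
  · refine span_mul_mem ?_ hn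
    rintro _ rfl
    simpa only [mul_assoc] using h.cyclic_mul_mul_mem hp

theorem z_mul_low_mem (h : CubicTriple a b c x y z) {m : A} (hm : m ∈ lowBimodule R x y z) :
    (z : A) * m ∈ topBimodule R x y z := by
  suffices lowBimodule R x y z ≤ (topBimodule R x y z).comap (LinearMap.mulLeft R (z : A))
    from this hm
  rw [lowBimodule, Submodule.mul_le]
  intro n hn q' hq'
  have : (z : A) * n ∈ topBimodule R x y z := by
    suffices Subalgebra.toSubmodule (pairAlg R x y) * unitSpan R z ≤
      (topBimodule R x y z).comap (LinearMap.mulLeft R (z : A)) from this hn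
    rw [Submodule.mul_le]
    exact fun q hq u hu => h.mul_pairAlg_mul_mem (self_mem_unitSpan z) hq hu
  rw [mem_comap, LinearMap.mulLeft_apply, ← mul_assoc]
  exact h.topBimodule_mul_mem hq' this

/-- Because `y` acts on `z y⁻¹ z` as `a` modulo `B u_z B`, eight left factors suffice. Seven of them
lie in `u_y u_x`; the last one is `x y⁻¹ x`, whose first letter passes through `z`. -/
theorem z_mul_cyclic_mem (h : CubicTriple a b c x y z) {q : A} (hq : q ∈ pairAlg R x y) :
    (z : A) * (q * (z * ((↑y⁻¹ : A) * z))) ∈ topBimodule R x y z := by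
  rw [pairAlg_comm] at hq
  refine mul_mem_of_cosetWords (F := (topBimodule R x y z).comap (LinearMap.mulLeft R (z : A)))
    h.left.swap (fun q hq => ?_) (fun i => ?_) hq
  · rw [pairAlg_comm] at hq
    exact h.z_mul_low_mem (subalgebra_mul_mem hq (h.triple_le_lowBimodule h.right.mul_top_sub_mem))
  · have h1 := one_mem_unitSpan (R := R) x
    have h1' := one_mem_unitSpan (R := R) y
    have hx := self_mem_unitSpan (R := R) x
    have hx' := inv_mem_unitSpan (R := R) x
    have hy := self_mem_unitSpan (R := R) y
    have hy' := inv_mem_unitSpan (R := R) y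
    rw [mem_comap, LinearMap.mulLeft_apply]
    fin_cases i <;>
      simp only [cosetWords, Matrix.cons_val, Units.val_mul, Units.val_one, mul_assoc,
        Fin.zero_eta, Fin.mk_one, Fin.reduceFinMk]
    · simpa using h.z_mul_word_mem h1 h1'
    · simpa using h.z_mul_word_mem hx h1'
    · simpa using h.z_mul_word_mem hx' h1'
    · exact h.z_mul_word_mem hx hy
    · exact h.z_mul_word_mem hx' hy
    · exact h.z_mul_word_mem hx hy'
    · exact h.z_mul_word_mem hx' hy'
    · rw [h.zx_mul]
      exact h.mul_topBimodule_mem (left_mem_pairAlg x y) (h.z_mul_word_mem hx hy')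

theorem z_mul_mem (h : CubicTriple a b c x y z) {m : A} (hm : m ∈ topBimodule R x y z) :
    (z : A) * m ∈ topBimodule R x y z := by
  obtain ⟨m, hm', n, hn, rfl⟩ := mem_sup.1 hm
  obtain ⟨m, hm1, k, hk, rfl⟩ := mem_sup.1 hm'
  have hx := left_mem_pairAlg (R := R) x y
  have hx' := h.left.left_inv_mem_pairAlg
  have hy := right_mem_pairAlg (R := R) x y
  have hy' := h.left.right_inv_mem_pairAlg
  have hz := self_mem_unitSpan (R := R) z
  rw [mul_add, mul_add]
  refine add_mem (add_mem (h.z_mul_low_mem hm1) ?_) (mul_mem_of_span ?_ hn)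
  · suffices cyclicBimodule R x y (z * ((↑y⁻¹ : A) * z)) ≤
      (topBimodule R x y z).comap (LinearMap.mulLeft R (z : A)) from this hk
    rw [cyclicBimodule, Submodule.mul_le]
    intro n hn q hq
    have : (z : A) * n ∈ topBimodule R x y z := by
      suffices Subalgebra.toSubmodule (pairAlg R x y) * span R {z * ((↑y⁻¹ : A) * z)} ≤
        (topBimodule R x y z).comap (LinearMap.mulLeft R (z : A)) from this hn
      rw [Submodule.mul_le]
      intro q hq m hm
      obtain ⟨r, rfl⟩ := mem_span_singleton.1 hm
      rw [mul_smul_comm]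
      exact smul_mem _ _ (h.z_mul_cyclic_mem hq)
    rw [mem_comap, LinearMap.mulLeft_apply, ← mul_assoc]
    exact h.topBimodule_mul_mem hq this
  · rintro _ (rfl | rfl)
    · have h1 : (z : A) * z ∈ unitSpan R z := by
        rw [← h.right.swap.unitSpan_mul_self]
        exact mul_mem_mul hz hz
      have := h.mul_pairAlg_mul_mem h1 (mul_mem hy (mul_mem hx' hy)) hz
      simpa only [mul_assoc] using this
    · have := h.mul_pairAlg_mul_mem (one_mem_unitSpan z) (mul_mem hy' (mul_mem hx hy'))
        (inv_mem_unitSpan z)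
      simpa [mul_assoc] using this

theorem topBimodule_eq_top (h : CubicTriple a b c x y z)
    (hA : Algebra.adjoin R {(x : A), (y : A), (z : A)} = ⊤) : topBimodule R x y z = ⊤ := by
  rw [eq_top_iff]
  intro m hm₀
  clear hm₀
  have h1 : (1 : A) ∈ topBimodule R x y z :=
    mem_sup_left (mem_sup_left (pairAlg_mem_lowBimodule (one_mem _)))
  suffices ∀ {n}, n ∈ topBimodule R x y z → m * n ∈ topBimodule R x y z by simpa using this h1
  have hm : m ∈ Algebra.adjoin R {(x : A), (y : A), (z : A)} := hA ▸ Algebra.mem_top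
  induction hm using Algebra.adjoin_induction with
  | mem s hs =>
    intro n hn
    rcases hs with rfl | rfl | rfl
    · exact h.mul_topBimodule_mem (left_mem_pairAlg x y) hn
    · exact h.mul_topBimodule_mem (right_mem_pairAlg x y) hn
    · exact h.z_mul_mem hn
  | algebraMap r => exact fun {_} hn => by simpa [Algebra.smul_def] using smul_mem _ r hn
  | add s t _ _ hs ht => exact fun {_} hn => by rw [add_mul]; exact add_mem (hs hn) (ht hn)
  | mul s t _ _ hs ht => exact fun {_} hn => by rw [mul_assoc]; exact hs (ht hn)

end CubicTriple
end Top
end CubicQuotient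

/-! ### From the presentation of `Q 4` to braided triples. -/

namespace CubicQuotient

open Submodule

/-- The defining relation multiplied by `a`, with its terms grouped according to `t - a² t⁻¹`. -/
theorem three_of_rel {R A : Type*} [CommRing R] [Ring A] [Algebra R A] {a : Rˣ} {s t : Aˣ}
    (h : (↑s⁻¹ : A) * t * s = s * t * (↑s⁻¹ : A) - (↑a⁻¹ : R) • ((s : A) * t)
      + (a : R) • ((s : A) * (↑t⁻¹ : A)) + (a : R) • ((↑s⁻¹ : A) * t)
      - ((a ^ 3 : Rˣ) : R) • ((↑s⁻¹ : A) * (↑t⁻¹ : A)) + (↑a⁻¹ : R) • ((t : A) * s)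
      - (a : R) • ((t : A) * (↑s⁻¹ : A)) - (a : R) • ((↑t⁻¹ : A) * s)
      + ((a ^ 3 : Rˣ) : R) • ((↑t⁻¹ : A) * (↑s⁻¹ : A))
      + ((a ^ 2 : Rˣ) : R) • ((↑s⁻¹ : A) * (↑t⁻¹ : A) * s)
      - ((a ^ 2 : Rˣ) : R) • ((s : A) * (↑t⁻¹ : A) * (↑s⁻¹ : A))) :
    (a : R) • ((↑s⁻¹ : A) * ((t : A) - (a : R) ^ 2 • (↑t⁻¹ : A)) * s)
      - (a : R) • ((s : A) * (t - (a : R) ^ 2 • (↑t⁻¹ : A)) * (↑s⁻¹ : A))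
      + (s : A) * (t - (a : R) ^ 2 • (↑t⁻¹ : A))
      - (a : R) ^ 2 • ((↑s⁻¹ : A) * (t - (a : R) ^ 2 • (↑t⁻¹ : A)))
      - ((t : A) - (a : R) ^ 2 • (↑t⁻¹ : A)) * s
      + (a : R) ^ 2 • (((t : A) - (a : R) ^ 2 • (↑t⁻¹ : A)) * (↑s⁻¹ : A)) = 0 := by
  have h3 := congrArg ((a : R) • ·) h
  simp only [smul_add, smul_sub, smul_smul, a.mul_inv, one_smul] at h3
  simp only [mul_sub, sub_mul, mul_smul_comm, smul_mul_assoc, smul_sub, smul_smul]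
  push_cast at h3
  linear_combination (norm := module) h3

theorem gen_braid {n : ℕ} {i j : Fin (n - 1)} (h : (i : ℕ) + 1 = j) :
    (gen i * gen j * gen i : BraidGroup n) = gen j * gen i * gen j := by
  have := PresentedGroup.one_of_mem (rels := braidRels n) (Or.inl ⟨i, j, h, rfl⟩)
  rw [map_mul, map_inv, mul_inv_eq_one] at this
  simp only [map_mul] at this
  exact this

theorem gen_comm {n : ℕ} {i j : Fin (n - 1)} (h : (i : ℕ) + 1 < j) :
    (gen i * gen j : BraidGroup n) = gen j * gen i := by
  have := PresentedGroup.one_of_mem (rels := braidRels n) (Or.inr ⟨i, j, h, rfl⟩)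
  rw [map_mul, map_inv, mul_inv_eq_one] at this
  simp only [map_mul] at this
  exact this

theorem s₁s₂s₁ : s₁ * s₂ * s₁ = s₂ * s₁ * s₂ := gen_braid rfl
theorem s₂s₃s₂ : s₂ * s₃ * s₂ = s₃ * s₂ * s₃ := gen_braid rfl
theorem s₁s₃ : s₁ * s₃ = s₃ * s₁ := gen_comm (by decide)

section Realization

variable {A : Type*} [Ring A] [Algebra R A]

/-- The units of `A` attached to braids by a homomorphism from the group algebra. -/
noncomputable def braidUnits {n : ℕ} (f : BraidAlgebra n →ₐ[R] A) : BraidGroup n →* Aˣ :=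
  ((f : BraidAlgebra n →* A).comp (MonoidAlgebra.of R (BraidGroup n))).toHomUnits

theorem coe_braidUnits {n : ℕ} (f : BraidAlgebra n →ₐ[R] A) (g : BraidGroup n) :
    (braidUnits f g : A) = f (br g) := rfl

theorem cubicPair_braidUnits {f : BraidAlgebra 4 →ₐ[R] A} (hf : ∀ ⦃x y⦄, QRel 4 x y → f x = f y) :
    CubicPair a b c (braidUnits f s₁) (braidUnits f s₂) where
  braid := by rw [← map_mul, ← map_mul, s₁s₂s₁, map_mul, map_mul]
  cubic := by
    have := hf (QRel.cubic (n := 4) ⟨0, by decide⟩ rfl)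
    simp only [map_mul, map_sub, AlgHom.commutes, map_zero] at this
    exact this
  three := three_of_rel <| by
    have h1 := hf (QRel.three (n := 4) ⟨0, by decide⟩ ⟨1, by decide⟩ rfl rfl s₁ s₂ rfl rfl)
    simp only [map_add, map_sub, Units.smul_def, map_smul, ← coe_braidUnits, map_mul, map_inv,
      Units.val_mul] at h1
    exact h1

/-- Conjugation by `s₁s₂s₃` sends `(s₁, s₂)` to `(s₂, s₃)`, which supplies the relations of the
second pair. -/
theorem cubicTriple_braidUnits {f : BraidAlgebra 4 →ₐ[R] A}
    (hf : ∀ ⦃x y⦄, QRel 4 x y → f x = f y) :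
    CubicTriple a b c (braidUnits f s₁) (braidUnits f s₂) (braidUnits f s₃) where
  left := cubicPair_braidUnits hf
  right := by
    have h := (cubicPair_braidUnits hf).conj (braidUnits f (s₁ * s₂ * s₃))
    simp only [← map_mul, ← map_inv] at h
    have e1 : s₁ * s₂ * s₃ * s₁ * (s₁ * s₂ * s₃)⁻¹ = s₂ := by
      rw [mul_inv_eq_iff_eq_mul, mul_assoc _ s₃, ← s₁s₃, ← mul_assoc, s₁s₂s₁]
      simp only [mul_assoc]
    have e2 : s₁ * s₂ * s₃ * s₂ * (s₁ * s₂ * s₃)⁻¹ = s₃ := by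
      rw [mul_inv_eq_iff_eq_mul, mul_assoc s₁, mul_assoc s₁, s₂s₃s₂, ← mul_assoc, ← mul_assoc,
        s₁s₃]
      simp only [mul_assoc]
    rwa [e1, e2] at h
  comm := by
    change (_ : A) * _ = _ * _
    rw [← Units.val_mul, ← Units.val_mul, ← map_mul, ← map_mul, s₁s₃]

/-- By the cubic relation, the subalgebra generated by the generators contains their inverses, hence
the image of every braid. -/
theorem adjoin_braidUnits {f : BraidAlgebra 4 →ₐ[R] A}
    (hf : ∀ ⦃x y⦄, QRel 4 x y → f x = f y) (hsurj : Function.Surjective f) :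
    Algebra.adjoin R {(braidUnits f s₁ : A), (braidUnits f s₂ : A), (braidUnits f s₃ : A)} = ⊤ := by
  set S := Algebra.adjoin R {(braidUnits f s₁ : A), (braidUnits f s₂ : A), (braidUnits f s₃ : A)} with hS
  have hT := cubicTriple_braidUnits hf
  have h12 : pairAlg R (braidUnits f s₁) (braidUnits f s₂) ≤ S :=
    Algebra.adjoin_mono (by rintro _ (rfl | rfl) <;> simp)
  have h23 : pairAlg R (braidUnits f s₂) (braidUnits f s₃) ≤ S :=
    Algebra.adjoin_mono (by rintro _ (rfl | rfl) <;> simp)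
  let H : Subgroup (BraidGroup 4) :=
    { carrier := {g | (braidUnits f g : A) ∈ S ∧ (↑(braidUnits f g)⁻¹ : A) ∈ S}
      mul_mem' := by
        rintro g h ⟨h1, h2⟩ ⟨h3, h4⟩
        simp only [Set.mem_ofPred_eq, map_mul, mul_inv_rev, Units.val_mul]
        exact ⟨mul_mem h1 h3, mul_mem h4 h2⟩
      one_mem' := by
        simp only [Set.mem_ofPred_eq, map_one, inv_one, Units.val_one]
        exact ⟨one_mem _, one_mem _⟩
      inv_mem' := by
        rintro g ⟨h1, h2⟩
        simp only [Set.mem_ofPred_eq, map_inv, inv_inv]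
        exact ⟨h2, h1⟩ }
  have hH : H = ⊤ := by
    rw [eq_top_iff, ← PresentedGroup.closure_range_of (braidRels 4), Subgroup.closure_le]
    rintro _ ⟨i, rfl⟩
    fin_cases i
    · exact ⟨h12 (left_mem_pairAlg _ _), h12 hT.left.left_inv_mem_pairAlg⟩
    · exact ⟨h12 (right_mem_pairAlg _ _), h12 hT.left.right_inv_mem_pairAlg⟩
    · exact ⟨h23 (right_mem_pairAlg _ _), h23 hT.right.right_inv_mem_pairAlg⟩
  rw [eq_top_iff]
  intro m hm₀
  clear hm₀
  obtain ⟨m, rfl⟩ := hsurj m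
  induction m using MonoidAlgebra.induction_on with
  | of g => exact ((hH ▸ Subgroup.mem_top g : g ∈ H)).1
  | add f g hf hg => rw [map_add]; exact add_mem hf hg
  | smul r f hf => rw [map_smul]; exact Subalgebra.smul_mem _ hf r

end Realization

end CubicQuotient

namespace CubicQuotient

open Submodule

/-! ### The explicit families: 239 elements for `B u_z B`, 25 beyond it. -/

section Families

variable {R A : Type*} [CommRing R] [Ring A] [Algebra R A]

/-- The expected spanning family of `B u_z B`, for a family `B₀` spanning `B`. -/
def outerFamily (x y z : Aˣ) (B₀ : Fin 20 → A) : Idx₁ → A :=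
  Sum.elim B₀ <|
  Sum.elim (fun p => B₀ p.1 * (lowWords x y z p.2 : A)) <|
  Sum.elim (fun p => ((cosetWords y x p.1 * ![z⁻¹ * y⁻¹, z⁻¹ * y⁻¹ * x] p.2 : Aˣ) : A)) <|
  Sum.elim (fun i => ((![1, x, x⁻¹, y, y⁻¹] i * (z⁻¹ * y * x⁻¹) : Aˣ) : A)) <|
  Sum.elim (fun p => ((cosetWords x y p.1 * ![z * y⁻¹ * x⁻¹, z * y * x⁻¹ * y] p.2 : Aˣ) : A)) <|
  fun i => ((![z⁻¹ * y⁻¹ * x⁻¹, z⁻¹ * y * x⁻¹ * y] i : Aˣ) : A)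

/-- The `25` words that span modulo `B u_z B`. -/
def topWords (x y z : Aˣ) : Fin 25 → Aˣ :=
  ![z * y⁻¹ * z,
    x * z * y⁻¹ * z,
    x⁻¹ * z * y⁻¹ * z,
    y * x * z * y⁻¹ * z,
    y * x⁻¹ * z * y⁻¹ * z,
    y⁻¹ * x * z * y⁻¹ * z,
    y⁻¹ * x⁻¹ * z * y⁻¹ * z,
    z * y⁻¹ * z * x,
    z * y⁻¹ * z * x⁻¹,
    z * y⁻¹ * z * x * y,
    z * y⁻¹ * z * x * y⁻¹,
    z * y⁻¹ * z * x⁻¹ * y,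
    z * y⁻¹ * z * x⁻¹ * y⁻¹,
    y * x * z * y⁻¹ * z * x,
    y⁻¹ * x * z * y⁻¹ * z * x,
    x * z * y⁻¹ * z * x * y,
    x * z * y⁻¹ * z * x * y⁻¹,
    x * z * y⁻¹ * z * x⁻¹,
    x * z * y⁻¹ * z * x,
    y * x * z * y⁻¹ * z * x * y,
    y * x * z * y⁻¹ * z * x * y⁻¹,
    z * y * x⁻¹ * y * z,
    z⁻¹ * y⁻¹ * x * y⁻¹ * z⁻¹,
    z * y⁻¹ * z * x * y⁻¹ * x,
    x * y⁻¹ * x * z * y⁻¹ * z]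

namespace CubicTriple

variable {a b c : Rˣ} {x y z : Aˣ}

theorem span_outerFamily (h : CubicTriple a b c x y z) {B₀ : Fin 20 → A}
    (hB : span R (Set.range B₀) = Subalgebra.toSubmodule (pairAlg R x y)) :
    span R (Set.range (outerFamily x y z B₀)) = lowBimodule R x y z := by
  have hx := left_mem_pairAlg (R := R) x y
  have hx' := h.left.left_inv_mem_pairAlg
  have hy := right_mem_pairAlg (R := R) x y
  have hy' := h.left.right_inv_mem_pairAlg
  have hz := self_mem_unitSpan (R := R) z
  have hz' := inv_mem_unitSpan (R := R) z
  have hBmem : ∀ i, B₀ i ∈ pairAlg R x y := fun i => by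
    have : B₀ i ∈ span R (Set.range B₀) := subset_span ⟨i, rfl⟩
    rwa [hB] at this
  apply le_antisymm
  · have low : ∀ {q u q' : A}, q ∈ pairAlg R x y → u ∈ unitSpan R z → q' ∈ pairAlg R x y →
        q * (u * q') ∈ lowBimodule R x y z := fun hq hu hq' =>
      subalgebra_mul_mem hq (mul_subalgebra_mem hq' (mem_bimodule hu))
    have h1 : (1 : A) ∈ pairAlg R x y := one_mem _
    have e1 : ∀ i, (cosetWords x y i : A) ∈ pairAlg R x y := by
      intro i
      fin_cases i <;> simp [cosetWords, hx, hx', hy, hy', mul_mem, one_mem]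
    have e2 : ∀ i, (cosetWords y x i : A) ∈ pairAlg R x y := by
      intro i
      fin_cases i <;> simp [cosetWords, hx, hx', hy, hy', mul_mem, one_mem]
    rw [span_le]
    rintro _ ⟨i | ⟨i, j⟩ | ⟨i, j⟩ | i | ⟨i, j⟩ | i, rfl⟩
    · exact pairAlg_mem_lowBimodule (hBmem i)
    · change B₀ i * (lowWords x y z j : A) ∈ lowBimodule R x y z
      have hi := hBmem i
      fin_cases j <;> simp only [lowWords, Matrix.cons_val, Units.val_mul, mul_assoc,
        Fin.zero_eta, Fin.mk_one, Fin.reduceFinMk]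
      · simpa using low hi hz h1
      · simpa using low hi hz' h1
      · exact low hi hz hy
      · exact low hi hz hy'
      · exact low hi hz' hy
      · exact low hi hz (mul_mem hy hx)
      · exact low hi hz' (mul_mem hy hx)
      · exact low hi hz (mul_mem hy hx')
      · exact low hi hz (mul_mem hy' hx)
    · have hi := e2 i
      change ((cosetWords y x i * ![z⁻¹ * y⁻¹, z⁻¹ * y⁻¹ * x] j : Aˣ) : A) ∈ _
      fin_cases j <;> simp only [Matrix.cons_val, Units.val_mul, mul_assoc, Fin.zero_eta,
        Fin.mk_one]
      · exact low hi hz' hy'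
      · exact low hi hz' (mul_mem hy' hx)
    · change ((![1, x, x⁻¹, y, y⁻¹] i * (z⁻¹ * y * x⁻¹) : Aˣ) : A) ∈ _
      rw [Units.val_mul, Units.val_mul, Units.val_mul, mul_assoc (↑z⁻¹ : A)]
      refine low ?_ hz' (mul_mem hy hx')
      fin_cases i <;> simp [hx, hx', hy, hy', one_mem]
    · have hi := e1 i
      change ((cosetWords x y i * ![z * y⁻¹ * x⁻¹, z * y * x⁻¹ * y] j : Aˣ) : A) ∈ _
      fin_cases j <;> simp only [Matrix.cons_val, Units.val_mul, mul_assoc, Fin.zero_eta,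
        Fin.mk_one]
      · exact low hi hz (mul_mem hy' hx')
      · exact low hi hz (mul_mem hy (mul_mem hx' hy))
    · change ((![z⁻¹ * y⁻¹ * x⁻¹, z⁻¹ * y * x⁻¹ * y] i : Aˣ) : A) ∈ _
      fin_cases i <;> simp only [Matrix.cons_val, Units.val_mul, mul_assoc, Fin.zero_eta,
        Fin.mk_one]
      · simpa using low h1 hz' (mul_mem hy' hx')
      · simpa using low h1 hz' (mul_mem hy (mul_mem hx' hy))
  · refine h.lowBimodule_le_outerModule.trans ?_
    set F := span R (Set.range (outerFamily x y z B₀)) with hF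
    have mem : ∀ i, outerFamily x y z B₀ i ∈ F := fun i => subset_span ⟨i, rfl⟩
    have hq : ∀ {w : A}, (∀ i, B₀ i * w ∈ F) → ∀ q ∈ pairAlg R x y, q * w ∈ F := by
      intro w hw q hq
      refine span_mul_mem (S := Set.range B₀) ?_ (hB ▸ hq : q ∈ span R (Set.range B₀))
      rintro _ ⟨i, rfl⟩
      exact hw i
    refine h.outerModule_le ?_ (fun q hq' i => hq (fun j => ?_) q hq') (fun i => ?_) (fun i => ?_)
      (fun i => ?_) (fun i => ?_) ?_ ?_ ?_
    · intro q hq'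
      simpa using hq (w := 1) (fun i => by rw [mul_one]; exact mem (Sum.inl i)) q hq'
    · exact mem (Sum.inr (Sum.inl (j, i)))
    · simpa [outerFamily, mul_assoc] using mem (Sum.inr (Sum.inr (Sum.inl (i, 0))))
    · simpa [outerFamily, mul_assoc] using mem (Sum.inr (Sum.inr (Sum.inl (i, 1))))
    · simpa [outerFamily, mul_assoc] using
        mem (Sum.inr (Sum.inr (Sum.inr (Sum.inr (Sum.inl (i, 0))))))
    · simpa [outerFamily, mul_assoc] using
        mem (Sum.inr (Sum.inr (Sum.inr (Sum.inr (Sum.inl (i, 1))))))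
    · have m4 := fun i => mem (Sum.inr (Sum.inr (Sum.inr (Sum.inl i))))
      rintro _ (rfl | rfl | rfl | rfl | rfl)
      · simpa [outerFamily, mul_assoc] using m4 0
      · simpa [outerFamily, mul_assoc] using m4 1
      · simpa [outerFamily, mul_assoc] using m4 2
      · simpa [outerFamily, mul_assoc] using m4 3
      · simpa [outerFamily, mul_assoc] using m4 4
    · simpa [outerFamily, mul_assoc] using
        mem (Sum.inr (Sum.inr (Sum.inr (Sum.inr (Sum.inr 0)))))
    · simpa [outerFamily, mul_assoc] using
        mem (Sum.inr (Sum.inr (Sum.inr (Sum.inr (Sum.inr 1)))))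

theorem lowBimodule_sup_span_topWords (h : CubicTriple a b c x y z)
    (hA : Algebra.adjoin R {(x : A), (y : A), (z : A)} = ⊤) :
    lowBimodule R x y z ⊔ span R (Set.range fun i => (topWords x y z i : A)) = ⊤ := by
  rw [eq_top_iff, ← h.topBimodule_eq_top hA]
  have mem : ∀ i, (topWords x y z i : A) ∈
      lowBimodule R x y z ⊔ span R (Set.range fun i => (topWords x y z i : A)) :=
    fun i => mem_sup_right (subset_span ⟨i, rfl⟩)
  have low : lowBimodule R x y z ≤
      lowBimodule R x y z ⊔ span R (Set.range fun i => (topWords x y z i : A)) := le_sup_left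
  generalize lowBimodule R x y z ⊔ span R (Set.range fun i => (topWords x y z i : A)) = F
    at mem low ⊢
  refine sup_le (sup_le low (h.cyclicBimodule_le low rfl ?_)) (span_le.2 ?_)
  · rintro _ (rfl | rfl | rfl | rfl | rfl | rfl | rfl | rfl | rfl | rfl | rfl | rfl | rfl | rfl |
      rfl | rfl | rfl | rfl | rfl | rfl | rfl | rfl | rfl)
    · simpa [topWords, mul_assoc] using mem 0
    · simpa [topWords, mul_assoc] using mem 1
    · simpa [topWords, mul_assoc] using mem 2
    · simpa [topWords, mul_assoc] using mem 3
    · simpa [topWords, mul_assoc] using mem 4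
    · simpa [topWords, mul_assoc] using mem 5
    · simpa [topWords, mul_assoc] using mem 6
    · simpa [topWords, mul_assoc] using mem 7
    · simpa [topWords, mul_assoc] using mem 8
    · simpa [topWords, mul_assoc] using mem 9
    · simpa [topWords, mul_assoc] using mem 10
    · simpa [topWords, mul_assoc] using mem 11
    · simpa [topWords, mul_assoc] using mem 12
    · simpa [topWords, mul_assoc] using mem 13
    · simpa [topWords, mul_assoc] using mem 14
    · simpa [topWords, mul_assoc] using mem 15
    · simpa [topWords, mul_assoc] using mem 16
    · simpa [topWords, mul_assoc] using mem 17
    · simpa [topWords, mul_assoc] using mem 18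
    · simpa [topWords, mul_assoc] using mem 19
    · simpa [topWords, mul_assoc] using mem 20
    -- Counted from zero, positions 23 and 24 are `e₂₄` and `e₂₅`, the last two words in the span of
    -- the bimodule of `z y⁻¹ z`. Positions 21 and 22 are the two words outside it.
    · simpa [topWords, mul_assoc] using mem 23
    · simpa [topWords, mul_assoc] using mem 24
  · rintro _ (rfl | rfl)
    · simpa [topWords, mul_assoc] using mem 21
    · simpa [topWords, mul_assoc] using mem 22

end CubicTriple
end Families
end CubicQuotient

/-! ### The spanning statements in `Q 4`. -/

namespace CubicQuotient

open Submodule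

section Adjoin

variable {R A : Type*} [CommRing R] [Ring A] [Algebra R A]

theorem CubicPair.adjoin_left_eq {a b c : Rˣ} {s t : Aˣ} (h : CubicPair a b c s t) :
    Subalgebra.toSubmodule (Algebra.adjoin R {(s : A)}) = unitSpan R s := by
  apply le_antisymm
  · intro m hm
    replace hm : m ∈ Algebra.adjoin R {(s : A)} := hm
    induction hm using Algebra.adjoin_induction with
    | mem s hs => rw [Set.mem_singleton_iff.1 hs]; exact self_mem_unitSpan _
    | algebraMap r =>
      rw [Algebra.algebraMap_eq_smul_one]
      exact smul_mem _ _ (one_mem_unitSpan _)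
    | add s t _ _ hs ht => exact add_mem hs ht
    | mul s t _ _ hs ht => rw [← h.unitSpan_mul_self]; exact mul_mem_mul hs ht
  · have h1 : (s : A) ∈ Algebra.adjoin R {(s : A)} := Algebra.subset_adjoin rfl
    refine unitSpan_le (Subalgebra.one_mem _) h1 ?_
    refine mem_of_unit_smul_mem (a * b * c) ?_
    rw [h.smul_inv]
    exact Subalgebra.add_mem _ (Subalgebra.sub_mem _ (Subalgebra.mul_mem _ h1 h1)
      (Subalgebra.smul_mem _ h1 _)) (Subalgebra.smul_mem _ (Subalgebra.one_mem _) _)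

end Adjoin

/-- The family `𝓑₁` in an algebra receiving the group algebra. -/
noncomputable def family₁Of {A : Type*} [Semiring A] [Algebra R A] (f : BraidAlgebra 4 →ₐ[R] A) (B₀ : Fin 20 → A) : Idx₁ → A :=
  Sum.elim B₀ <|
  Sum.elim (fun p => B₀ p.1 * f (br (wordsF₂ p.2))) <|
  Sum.elim (fun p => f (br (wordsE' p.1 * ![s₃⁻¹ * s₂⁻¹, s₃⁻¹ * s₂⁻¹ * s₁] p.2))) <|
  Sum.elim (fun i => f (br (wordsE₀ i * (s₃⁻¹ * s₂ * s₁⁻¹)))) <|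
  Sum.elim (fun p => f (br (wordsE p.1 * ![s₃ * s₂⁻¹ * s₁⁻¹, s₃ * s₂ * s₁⁻¹ * s₂] p.2))) <|
  fun i => f (br (![s₃⁻¹ * s₂⁻¹ * s₁⁻¹, s₃⁻¹ * s₂ * s₁⁻¹ * s₂] i))

section Generic

variable {A : Type*} [Ring A] [Algebra R A]

theorem outerFamily_braidUnits (f : BraidAlgebra 4 →ₐ[R] A) (B₀ : Fin 20 → A) :
    outerFamily (braidUnits f s₁) (braidUnits f s₂) (braidUnits f s₃) B₀ = family₁Of f B₀ := by
  funext i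
  rcases i with i | ⟨i, j⟩ | ⟨i, j⟩ | i | ⟨i, j⟩ | i
  · rfl
  · change _ * _ = _ * _
    congr 1
    rw [← coe_braidUnits]
    congr 1
    fin_cases j <;> simp [lowWords, wordsF₂]
  · change ((_ : Aˣ) : A) = f (br _)
    rw [← coe_braidUnits, map_mul]
    congr 2
    · fin_cases i <;> simp [cosetWords, wordsE']
    · fin_cases j <;> simp
  · change ((_ : Aˣ) : A) = f (br _)
    rw [← coe_braidUnits, map_mul]
    congr 2
    · fin_cases i <;> simp [wordsE₀]
    · simp
  · change ((_ : Aˣ) : A) = f (br _)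
    rw [← coe_braidUnits, map_mul]
    congr 2
    · fin_cases i <;> simp [cosetWords, wordsE]
    · fin_cases j <;> simp
  · change ((_ : Aˣ) : A) = f (br _)
    rw [← coe_braidUnits]
    congr 1
    fin_cases i <;> simp

theorem topWords_braidUnits (f : BraidAlgebra 4 →ₐ[R] A) (i : Fin 25) :
    (topWords (braidUnits f s₁) (braidUnits f s₂) (braidUnits f s₃) i : A) =
      f (br (wordsTop i)) := by
  rw [← coe_braidUnits]
  congr 1
  fin_cases i <;> simp only [topWords, wordsTop, Matrix.cons_val, Fin.zero_eta, Fin.mk_one,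
    Fin.reduceFinMk, map_mul, map_inv]

theorem pairWords_braidUnits (f : BraidAlgebra 4 →ₐ[R] A) (i : Fin 20) :
    (pairWords (braidUnits f s₁) (braidUnits f s₂) i : A) = f (br (wordsQ₃ i)) := by
  rw [← coe_braidUnits]
  congr 1
  fin_cases i <;> simp [pairWords, wordsQ₃]

end Generic

/- In the next three statements the ring structure is only assumed to be compatible with a given
semiring structure, as for `Q 4`. -/
section Semiring

variable {A : Type*} [inst : Semiring A] [Algebra R A] {f : BraidAlgebra 4 →ₐ[R] A}

theorem span_wordsQ₃_of (ring : Ring A) (hring : ring.toSemiring = inst)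
    (hf : ∀ ⦃x y⦄, QRel 4 x y → f x = f y) :
    span R (Set.range fun i => f (br (wordsQ₃ i))) =
      Subalgebra.toSubmodule (Algebra.adjoin R {f (br s₁), f (br s₂)}) := by
  subst hring
  have := (cubicPair_braidUnits hf).pairAlg_eq_span
  simp only [pairWords_braidUnits] at this
  exact this.symm

theorem span_family₁_of (ring : Ring A) (hring : ring.toSemiring = inst)
    (hf : ∀ ⦃x y⦄, QRel 4 x y → f x = f y) {B₀ : Fin 20 → A}
    (hB : span R (Set.range B₀) =
      Subalgebra.toSubmodule (Algebra.adjoin R {f (br s₁), f (br s₂)})) :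
    span R (Set.range (family₁Of f B₀)) =
      Subalgebra.toSubmodule (Algebra.adjoin R {f (br s₁), f (br s₂)}) *
      Subalgebra.toSubmodule (Algebra.adjoin R {f (br s₃)}) *
      Subalgebra.toSubmodule (Algebra.adjoin R {f (br s₁), f (br s₂)}) := by
  subst hring
  rw [← outerFamily_braidUnits, (cubicTriple_braidUnits hf).span_outerFamily hB, lowBimodule,
    ← (cubicTriple_braidUnits hf).right.swap.adjoin_left_eq]
  rfl

theorem span_wordsTop_of (ring : Ring A) (hring : ring.toSemiring = inst)
    (hf : ∀ ⦃x y⦄, QRel 4 x y → f x = f y) (hsurj : Function.Surjective f) :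
    Subalgebra.toSubmodule (Algebra.adjoin R {f (br s₁), f (br s₂)}) *
      Subalgebra.toSubmodule (Algebra.adjoin R {f (br s₃)}) *
      Subalgebra.toSubmodule (Algebra.adjoin R {f (br s₁), f (br s₂)}) ⊔
      span R (Set.range fun i => f (br (wordsTop i))) = ⊤ := by
  subst hring
  have := (cubicTriple_braidUnits hf).lowBimodule_sup_span_topWords (adjoin_braidUnits hf hsurj)
  rw [lowBimodule, ← (cubicTriple_braidUnits hf).right.swap.adjoin_left_eq] at this
  simp only [topWords_braidUnits] at this
  exact this

end Semiring

theorem mkAlgHom_rel₄ ⦃x y : BraidAlgebra 4⦄ (h : QRel 4 x y) :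
    RingQuot.mkAlgHom R (QRel 4) x = RingQuot.mkAlgHom R (QRel 4) y :=
  RingQuot.mkAlgHom_rel R h

theorem span_wordsQ₃ :
    span R (Set.range fun i => toQ (wordsQ₃ i)) = Subalgebra.toSubmodule Q₃ := by
  have := span_wordsQ₃_of (A := Q 4) inferInstance rfl (f := RingQuot.mkAlgHom R (QRel 4))
    mkAlgHom_rel₄
  exact this

theorem span_family₁ {B₀ : Fin 20 → Q 4}
    (hB : span R (Set.range B₀) = Subalgebra.toSubmodule Q₃) :
    span R (Set.range (family₁ B₀)) = Q₃u₃Q₃ := by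
  have := span_family₁_of (A := Q 4) inferInstance rfl (f := RingQuot.mkAlgHom R (QRel 4))
    mkAlgHom_rel₄ hB
  exact this

theorem Q₃u₃Q₃_sup_span_wordsTop :
    Q₃u₃Q₃ ⊔ span R (Set.range fun i => toQ (wordsTop i)) = ⊤ := by
  have := span_wordsTop_of (A := Q 4) inferInstance rfl (f := RingQuot.mkAlgHom R (QRel 4))
    mkAlgHom_rel₄ (RingQuot.mkAlgHom_surjective R (QRel 4))
  exact this

theorem span_family₂ {B₀ : Fin 20 → Q 4}
    (hB : span R (Set.range B₀) = Subalgebra.toSubmodule Q₃) :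
    span R (Set.range (family₂ B₀)) = ⊤ := by
  rw [family₂, Set.Sum.elim_range, span_union, span_family₁ hB, Q₃u₃Q₃_sup_span_wordsTop]

theorem span_range_mkQ_eq_top {R M ι : Type*} [Ring R] [AddCommGroup M] [Module R M]
    {N : Submodule R M} {e : ι → M} (h : N ⊔ span R (Set.range e) = ⊤) :
    span R (Set.range fun i => N.mkQ (e i)) = ⊤ := by
  have h1 := congrArg (Submodule.map N.mkQ) h
  rw [Submodule.map_sup, Submodule.mkQ_map_self, bot_sup_eq, Submodule.map_span,
    Submodule.map_top, Submodule.range_mkQ, ← Set.range_comp] at h1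
  exact h1

theorem span_mkQ_wordsTop :
    span R (Set.range fun i => Q₃u₃Q₃.mkQ (toQ (wordsTop i))) = ⊤ :=
  span_range_mkQ_eq_top Q₃u₃Q₃_sup_span_wordsTop

end CubicQuotient

/-! ### Generating a product of matrix algebras by isolating matrix units. -/

namespace CubicQuotient

open Matrix

section Indicator

variable {K T : Type*} [Field K] [Fintype T]

/-- A subalgebra of functions that contains the indicator of a set and the restriction of `z` to it
contains the indicators of the level sets of this restriction. -/
theorem indicator_mem {S : Subalgebra K (T → K)} {P : Set T} {z : T → K}
    (h1 : P.indicator 1 ∈ S) (hz : P.indicator z ∈ S) (v : K) :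
    (P ∩ {t | z t = v}).indicator 1 ∈ S := by
  classical
  -- Lagrange interpolation: on `P` the product over the other values `w` of `(z - w)/(v - w)` is
  -- the indicator of `z = v`.
  have hf : P.indicator 1 * ∏ w ∈ (Finset.univ.image z).erase v,
      ((v - w)⁻¹ • (P.indicator z - w • P.indicator 1)) ∈ S := by
    refine S.mul_mem h1 (S.prod_mem fun w _ => S.smul_mem (S.sub_mem hz (S.smul_mem h1 _)) _)
  convert hf using 1
  funext t
  simp only [Pi.mul_apply, Finset.prod_apply, Pi.smul_apply, Pi.sub_apply, smul_eq_mul]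
  by_cases hP : t ∈ P
  · simp only [Set.indicator_of_mem hP, Pi.one_apply, one_mul, mul_one]
    by_cases ht : z t = v
    · rw [Set.indicator_of_mem (show t ∈ P ∩ {t | z t = v} from ⟨hP, ht⟩), Pi.one_apply, Finset.prod_eq_one]
      intro w hw
      rw [ht, inv_mul_cancel₀ (sub_ne_zero.2 (Finset.ne_of_mem_erase hw).symm)]
    · rw [Set.indicator_of_notMem (show t ∉ P ∩ {t | z t = v} from fun h => ht h.2), Finset.prod_eq_zero (i := z t)]
      · exact Finset.mem_erase.2 ⟨ht, Finset.mem_image_of_mem _ (Finset.mem_univ _)⟩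
      · simp
  · rw [Set.indicator_of_notMem hP, Set.indicator_of_notMem (show t ∉ P ∩ {t | z t = v} from fun h => hP h.1), zero_mul]

end Indicator

section Isolation

variable {K ι L : Type*} [Field K] [Fintype ι] [DecidableEq ι] {n : ι → Type*}
  [∀ i, Fintype (n i)] [∀ i, DecidableEq (n i)]

/-- Functions on the indices of all blocks, as block diagonal matrices. -/
def diagHom (K : Type*) [Field K] {ι : Type*} (n : ι → Type*) [∀ i, Fintype (n i)]
    [∀ i, DecidableEq (n i)] :
    ((Σ i, n i) → K) →ₐ[K] ∀ i, Matrix (n i) (n i) K :=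
  AlgHom.pi fun i => (diagonalAlgHom K).comp
    (AlgHom.pi fun k => Pi.evalAlgHom K (fun _ => K) ⟨i, k⟩)

theorem diagHom_apply (f : (Σ i, n i) → K) (i : ι) :
    diagHom K n f i = diagonal fun k => f ⟨i, k⟩ := rfl

/-- The matrix unit `E_{kl}` in the block `i`. -/
def unit (K : Type*) [Field K] {ι : Type*} [DecidableEq ι] {n : ι → Type*}
    [∀ i, DecidableEq (n i)] (i : ι) (k l : n i) : ∀ i, Matrix (n i) (n i) K :=
  Pi.single i (single k l 1)

/-- Families of matrices `X`, `Y` over blocks such that `X` is diagonal, and the diagonal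
entries of `X` and `Y` only depend on a label that determines an index in its block. -/
structure Labelled (xv yv : L → K) (lab : ∀ i, n i → L) (X Y : ∀ i, Matrix (n i) (n i) K) :
    Prop where
  inj : ∀ i, Function.Injective (lab i)
  X_eq : ∀ i, X i = diagonal fun k => xv (lab i k)
  Y_diag : ∀ i k, Y i k k = yv (lab i k)
  Y_off : ∀ i k l, k ≠ l → xv (lab i k) = xv (lab i l) → Y i k l = 0
  sep : ∀ l l', xv l = xv l' → yv l = yv l' → l = l'

namespace Labelled

variable {xv yv : L → K} {lab : ∀ i, n i → L} {X Y Z : ∀ i, Matrix (n i) (n i) K}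
  {𝒜 : Subalgebra K (∀ i, Matrix (n i) (n i) K)}

/-- Interpolation in `X` gives the projection to an eigenspace. Compressed to it, `Y` is diagonal by
`Y_off`, and interpolation in these diagonal entries singles out the label. -/
theorem diagHom_indicator_mem (h : Labelled xv yv lab X Y) (hX : X ∈ 𝒜) (hY : Y ∈ 𝒜) (l : L) :
    ({t : Σ i, n i | lab t.1 t.2 = l} : Set _).indicator 1 ∈ 𝒜.comap (diagHom K n) := by
  classical
  set S := 𝒜.comap (diagHom K n) with hS
  have h1 : (Set.univ : Set (Σ i, n i)).indicator 1 ∈ S := by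
    rw [Set.indicator_univ]
    exact S.one_mem
  have h2 : (Set.univ : Set (Σ i, n i)).indicator (fun t => xv (lab t.1 t.2)) ∈ S := by
    rw [Set.indicator_univ, hS, Subalgebra.mem_comap]
    convert hX using 1
    funext i
    rw [diagHom_apply, h.X_eq]
  have h3 := indicator_mem h1 h2 (xv l)
  rw [Set.univ_inter] at h3
  set P : Set (Σ i, n i) := {t | xv (lab t.1 t.2) = xv l} with hP
  have h4 : P.indicator (fun t => yv (lab t.1 t.2)) ∈ S := by
    have h5 := 𝒜.mul_mem (𝒜.mul_mem h3 hY) h3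
    rw [hS, Subalgebra.mem_comap]
    convert h5 using 1
    funext i
    ext k m
    simp only [diagHom_apply, Pi.mul_apply, RingHom.coe_coe, mul_diagonal, diagonal_mul]
    by_cases hkm : k = m
    · subst hkm
      rw [diagonal_apply_eq]
      by_cases hk : (⟨i, k⟩ : Σ i, n i) ∈ P
      · simp [Set.indicator_of_mem hk, h.Y_diag]
      · simp [Set.indicator_of_notMem hk]
    · rw [diagonal_apply_ne _ hkm]
      by_cases hk : (⟨i, k⟩ : Σ i, n i) ∈ P
      · by_cases hm : (⟨i, m⟩ : Σ i, n i) ∈ P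
        · rw [h.Y_off i k m hkm (Eq.trans hk (Eq.symm hm))]
          simp
        · simp [Set.indicator_of_notMem hm]
      · simp [Set.indicator_of_notMem hk]
  have h5 := indicator_mem h3 h4 (yv l)
  convert h5 using 2
  ext t
  simp only [Set.mem_ofPred_eq, Set.mem_inter_iff, hP]
  exact ⟨fun ht => by simp [ht], fun ht => h.sep _ _ ht.1 ht.2⟩

/-- Isolation of a block: if the diagonal entry of `Z` at a label differs from the entries in the
other blocks, apart from blocks that are already isolated, then a diagonal matrix unit is found. -/
theorem unit_mem (h : Labelled xv yv lab X Y) (hX : X ∈ 𝒜) (hY : Y ∈ 𝒜) (hZ : Z ∈ 𝒜)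
    {D : Set ι} (hD : ∀ i ∈ D, ∀ k, unit K i k k ∈ 𝒜) {i : ι} (hi : i ∉ D) {k : n i} {w : ι → K}
    (hw : ∀ j m, lab j m = lab i k → Z j m m = w j)
    (hne : ∀ j ∉ D, j ≠ i → ∀ m, lab j m = lab i k → w j ≠ w i) :
    unit K i k k ∈ 𝒜 := by
  classical
  set S := 𝒜.comap (diagHom K n) with hS
  have single_eq : ∀ (j : ι) (m : n j),
      diagHom K n (({⟨j, m⟩} : Set (Σ i, n i)).indicator 1) = unit K j m m := by
    intro j m
    funext i'
    rw [diagHom_apply, unit]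
    by_cases hij : i' = j
    · subst hij
      rw [Pi.single_eq_same]
      ext a b
      by_cases hab : a = b
      · subst hab
        by_cases ham : a = m
        · subst ham; simp
        · simp [ham, Matrix.single, Set.indicator, Ne.symm ham]
      · rw [diagonal_apply_ne _ hab]
        simp only [Matrix.single, of_apply]
        rw [if_neg (fun h => hab (h.1.symm.trans h.2))]
    · rw [Pi.single_eq_of_ne hij]
      ext a b
      by_cases hab : a = b
      · subst hab
        simp [hij]
      · simp [diagonal_apply_ne _ hab]
  set P : Set (Σ i, n i) := {t | lab t.1 t.2 = lab i k ∧ t.1 ∉ D} with hP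
  have hPS : P.indicator 1 ∈ S := by
    have h1 := h.diagHom_indicator_mem (𝒜 := 𝒜) hX hY (lab i k)
    -- The blocks of `D` contribute matrix units already known to be in `𝒜`; they are subtracted
    -- from the idempotent of the label.
    have h2 : ∑ t : Σ i, n i, (if lab t.1 t.2 = lab i k ∧ t.1 ∈ D then
        ({t} : Set (Σ i, n i)).indicator (1 : (Σ i, n i) → K) else 0) ∈ S := by
      refine S.sum_mem fun t _ => ?_
      split_ifs with ht
      · change diagHom K n _ ∈ 𝒜
        rw [show t = ⟨t.1, t.2⟩ from rfl, single_eq]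
        exact hD _ ht.2 _
      · exact S.zero_mem
    convert S.sub_mem h1 h2 using 1
    funext t
    rw [Pi.sub_apply, Finset.sum_apply, Finset.sum_eq_single t]
    · by_cases h3 : lab t.1 t.2 = lab i k <;> by_cases h4 : t.1 ∈ D <;>
        simp [hP, Set.indicator, h3, h4]
    · intro s _ hs
      split_ifs
      · rw [Set.indicator_of_notMem (by simpa using hs.symm)]
      · rfl
    · simp
  -- A label occurs at most once in a block, so the compression of `Z` by the idempotent of `P` is
  -- diagonal with the entries `w`.
  have hPZ : P.indicator (fun t => w t.1) ∈ S := by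
    have h5 := 𝒜.mul_mem (𝒜.mul_mem hPS hZ) hPS
    change diagHom K n _ ∈ 𝒜
    convert h5 using 1
    funext j
    ext a b
    simp only [diagHom_apply, Pi.mul_apply, RingHom.coe_coe, mul_diagonal, diagonal_mul]
    by_cases hab : a = b
    · subst hab
      rw [diagonal_apply_eq]
      by_cases hk : (⟨j, a⟩ : Σ i, n i) ∈ P
      · simp [Set.indicator_of_mem hk, hw j a hk.1]
      · simp [Set.indicator_of_notMem hk]
    · rw [diagonal_apply_ne _ hab]
      by_cases hk : (⟨j, a⟩ : Σ i, n i) ∈ P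
      · by_cases hm : (⟨j, b⟩ : Σ i, n i) ∈ P
        · exact absurd (h.inj j (hk.1.trans hm.1.symm)) hab
        · simp [Set.indicator_of_notMem hm]
      · simp [Set.indicator_of_notMem hk]
  have h6 := indicator_mem hPS hPZ (w i)
  rw [← single_eq]
  change _ ∈ S
  convert h6 using 2
  ext t
  simp only [Set.mem_singleton_iff, Set.mem_inter_iff, Set.mem_ofPred_eq, hP]
  constructor
  · rintro rfl
    exact ⟨⟨rfl, hi⟩, rfl⟩
  · obtain ⟨j, m⟩ := t
    rintro ⟨⟨h1, h2⟩, h3⟩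
    by_cases hj : j = i
    · subst hj
      rw [h.inj j (show lab j m = lab j k from h1)]
    · exact absurd h3 (hne j h2 hj m h1)

theorem unit_mul_mul (i : ι) (k l : n i) (M : ∀ i, Matrix (n i) (n i) K) (f : (Σ i, n i) → K) :
    unit K i k l * M * diagHom K n f = ∑ m, (M i l m * f ⟨i, m⟩) • unit K i k m := by
  funext j
  by_cases hj : j = i
  · subst hj
    ext a b
    simp only [Pi.mul_apply, diagHom_apply, mul_diagonal, Finset.sum_apply, Pi.smul_apply, unit,
      Pi.single_eq_same, Matrix.sum_apply, Matrix.smul_apply, smul_eq_mul]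
    rw [Finset.sum_eq_single b]
    · by_cases ha : a = k
      · subst ha; simp
      · simp [Matrix.single, Ne.symm ha, mul_apply]
    · intro m _ hm
      simp [Matrix.single, hm]
    · simp
  · ext a b
    simp [unit, Pi.single_eq_of_ne hj, Finset.sum_apply]

theorem mul_mul_unit (i : ι) (k l : n i) (M : ∀ i, Matrix (n i) (n i) K) (f : (Σ i, n i) → K) :
    diagHom K n f * (M * unit K i k l) = ∑ m, (f ⟨i, m⟩ * M i m k) • unit K i m l := by
  funext j
  by_cases hj : j = i
  · subst hj
    ext a b
    simp only [Pi.mul_apply, diagHom_apply, diagonal_mul, Finset.sum_apply, Pi.smul_apply, unit,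
      Pi.single_eq_same, Matrix.sum_apply, Matrix.smul_apply, smul_eq_mul]
    rw [Finset.sum_eq_single a]
    · by_cases hb : b = l
      · subst hb; simp
      · simp [Matrix.single, Ne.symm hb, mul_apply]
    · intro m _ hm
      simp [Matrix.single, hm]
    · simp
  · ext a b
    simp [unit, Pi.single_eq_of_ne hj, Finset.sum_apply]

theorem unit_mul_unit (i : ι) (k l m : n i) : unit K i k l * unit K i l m = unit K i k m := by
  rw [unit, unit, unit, ← Pi.single_mul, single_mul_single_same, one_mul]

/-- Two indices of a block joined by nonzero entries of an element of `𝒜`. -/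
theorem unit_step (h : Labelled xv yv lab X Y) (hX : X ∈ 𝒜) (hY : Y ∈ 𝒜)
    {M : ∀ i, Matrix (n i) (n i) K} (hM : M ∈ 𝒜) {i : ι} {k₀ k l : n i}
    (h1 : unit K i k₀ k ∈ 𝒜 ∧ unit K i k k₀ ∈ 𝒜) (hkl : M i k l ≠ 0) (hlk : M i l k ≠ 0) :
    unit K i k₀ l ∈ 𝒜 ∧ unit K i l k₀ ∈ 𝒜 := by
  classical
  have h2 := h.diagHom_indicator_mem (𝒜 := 𝒜) hX hY (lab i l)
  constructor
  · have h3 := 𝒜.mul_mem (𝒜.mul_mem h1.1 hM) h2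
    rw [RingHom.coe_coe, unit_mul_mul, Finset.sum_eq_single l] at h3
    · have := 𝒜.smul_mem h3 (M i k l)⁻¹
      simpa [smul_smul, hkl] using this
    · intro m _ hm
      rw [Set.indicator_of_notMem
        (show (⟨i, m⟩ : Σ i, n i) ∉ {t | lab t.1 t.2 = lab i l} from fun hm' => hm (h.inj i hm'))]
      simp
    · simp
  · have h3 := 𝒜.mul_mem h2 (𝒜.mul_mem hM h1.2)
    rw [RingHom.coe_coe, mul_mul_unit, Finset.sum_eq_single l] at h3
    · have := 𝒜.smul_mem h3 (M i l k)⁻¹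
      simpa [smul_smul, hlk] using this
    · intro m _ hm
      rw [Set.indicator_of_notMem
        (show (⟨i, m⟩ : Σ i, n i) ∉ {t | lab t.1 t.2 = lab i l} from fun hm' => hm (h.inj i hm'))]
      simp
    · simp

/-- Indices of a block joined by entries of `Y` or `Z`. -/
def Linked (Y Z : ∀ i, Matrix (n i) (n i) K) (i : ι) (k l : n i) : Prop :=
  (Y i k l ≠ 0 ∧ Y i l k ≠ 0) ∨ (Z i k l ≠ 0 ∧ Z i l k ≠ 0)

theorem unit_mem_of_linked (h : Labelled xv yv lab X Y) (hX : X ∈ 𝒜) (hY : Y ∈ 𝒜) (hZ : Z ∈ 𝒜)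
    {i : ι} {k₀ : n i} (h0 : unit K i k₀ k₀ ∈ 𝒜)
    (hk : ∀ k, Relation.ReflTransGen (Linked Y Z i) k₀ k) (k l : n i) : unit K i k l ∈ 𝒜 := by
  have key : ∀ k, unit K i k₀ k ∈ 𝒜 ∧ unit K i k k₀ ∈ 𝒜 := by
    intro k
    induction hk k with
    | refl => exact ⟨h0, h0⟩
    | tail _ hstep ih =>
      rcases hstep with hs | hs
      · exact h.unit_step hX hY hY ih hs.1 hs.2
      · exact h.unit_step hX hY hZ ih hs.1 hs.2
  rw [← unit_mul_unit i k k₀ l]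
  exact 𝒜.mul_mem (key k).2 (key l).1

theorem eq_top_of_unit_mem (h : ∀ (i : ι) (k l : n i), unit K i k l ∈ 𝒜) : 𝒜 = ⊤ := by
  rw [eq_top_iff]
  intro M _
  have : M = ∑ i, ∑ k, ∑ l, (M i k l) • unit K i k l := by
    have h1 : ∀ i, Pi.single i (M i) = ∑ k, ∑ l, (M i k l) • unit K i k l := by
      intro i
      conv_lhs => rw [matrix_eq_sum_single (M i)]
      funext j
      simp only [Finset.sum_apply, Pi.smul_apply, unit]
      by_cases hj : j = i
      · subst hj
        simp [smul_single]
      · simp [Pi.single_eq_of_ne hj]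
    simp only [← h1, Finset.univ_sum_single]
  rw [this]
  exact 𝒜.sum_mem fun i _ => 𝒜.sum_mem fun k _ => 𝒜.sum_mem fun l _ => 𝒜.smul_mem (h i k l) _

end Labelled
end Isolation
end CubicQuotient

/-! ### Representations adapted to the restriction to three strands. -/

namespace CubicQuotient

open Matrix

/-- Matrices on pairs (component, eigenvalue): `s₁` is diagonal with entries `e`, the generator
`s₂` preserves components and `s₃` preserves eigenvalues. -/
structure BlockData (K : Type*) where
  e : Fin 3 → K
  T : Fin 4 → Fin 3 → Fin 3 → K
  T' : Fin 4 → Fin 3 → Fin 3 → K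
  Z : Fin 3 → Fin 4 → Fin 4 → K
  Z' : Fin 3 → Fin 4 → Fin 4 → K
  V : Finset (Fin 4 × Fin 3)

namespace BlockData

section Blocks

variable {K : Type*} [Field K]

/-- The matrix with blocks `T i` on the components. -/
def rowBlocks (T : Fin 4 → Fin 3 → Fin 3 → K) : Matrix (Fin 4 × Fin 3) (Fin 4 × Fin 3) K :=
  of fun s t => if s.1 = t.1 then T s.1 s.2 t.2 else 0

/-- The matrix with blocks `Z l` on the eigenvalues. -/
def colBlocks (Z : Fin 3 → Fin 4 → Fin 4 → K) : Matrix (Fin 4 × Fin 3) (Fin 4 × Fin 3) K :=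
  of fun s t => if s.2 = t.2 then Z s.2 s.1 t.1 else 0

theorem rowBlocks_apply (T : Fin 4 → Fin 3 → Fin 3 → K) (s t : Fin 4 × Fin 3) :
    rowBlocks T s t = if s.1 = t.1 then T s.1 s.2 t.2 else 0 := rfl

theorem colBlocks_apply (Z : Fin 3 → Fin 4 → Fin 4 → K) (s t : Fin 4 × Fin 3) :
    colBlocks Z s t = if s.2 = t.2 then Z s.2 s.1 t.1 else 0 := rfl

theorem rowBlocks_mul_apply (T : Fin 4 → Fin 3 → Fin 3 → K)
    (M : Matrix (Fin 4 × Fin 3) (Fin 4 × Fin 3) K) (s t : Fin 4 × Fin 3) :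
    (rowBlocks T * M) s t = ∑ m, T s.1 s.2 m * M (s.1, m) t := by
  rw [mul_apply, Fintype.sum_prod_type, Finset.sum_eq_single s.1]
  · simp [rowBlocks_apply]
  · intro i _ hi
    simp [rowBlocks_apply, Ne.symm hi]
  · simp

theorem colBlocks_mul_apply (Z : Fin 3 → Fin 4 → Fin 4 → K)
    (M : Matrix (Fin 4 × Fin 3) (Fin 4 × Fin 3) K) (s t : Fin 4 × Fin 3) :
    (colBlocks Z * M) s t = ∑ j, Z s.2 s.1 j * M (j, s.2) t := by
  rw [mul_apply, Fintype.sum_prod_type_right, Finset.sum_eq_single s.2]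
  · simp [colBlocks_apply]
  · intro i _ hi
    simp [colBlocks_apply, Ne.symm hi]
  · simp

end Blocks

section Restrict

variable {K : Type*} [Field K]

/-- The rows in `V` vanish outside of `V`. -/
def Closed (V : Finset (Fin 4 × Fin 3)) (M : Matrix (Fin 4 × Fin 3) (Fin 4 × Fin 3) K) : Prop :=
  ∀ s ∈ V, ∀ t ∉ V, M s t = 0

/-- The restriction of a matrix to the indices in `V`. -/
def restrict (V : Finset (Fin 4 × Fin 3)) (M : Matrix (Fin 4 × Fin 3) (Fin 4 × Fin 3) K) :
    Matrix V V K :=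
  M.submatrix Subtype.val Subtype.val

theorem restrict_apply (V : Finset (Fin 4 × Fin 3))
    (M : Matrix (Fin 4 × Fin 3) (Fin 4 × Fin 3) K) (s t : V) :
    restrict V M s t = M s t := rfl

theorem restrict_mul {V : Finset (Fin 4 × Fin 3)} {M N : Matrix (Fin 4 × Fin 3) (Fin 4 × Fin 3) K}
    (hM : Closed V M) : restrict V (M * N) = restrict V M * restrict V N := by
  ext s t
  simp only [restrict_apply, mul_apply]
  rw [Finset.sum_coe_sort V fun u => M s u * N u t]
  refine (Finset.sum_subset (Finset.subset_univ V) fun u _ hu => ?_).symm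
  rw [hM s s.2 u hu, zero_mul]

theorem Closed.mul {V : Finset (Fin 4 × Fin 3)} {M N : Matrix (Fin 4 × Fin 3) (Fin 4 × Fin 3) K}
    (hM : Closed V M) (hN : Closed V N) : Closed V (M * N) := by
  intro s hs t ht
  rw [mul_apply]
  refine Finset.sum_eq_zero fun u _ => ?_
  by_cases hu : u ∈ V
  · rw [hN u hu t ht, mul_zero]
  · rw [hM s hs u hu, zero_mul]

end Restrict

variable {K : Type*} [Field K]

/-- The conditions for a representation of the braid group with `s₁` of spectrum in `{a, b, c}`
that satisfies the relation of degree three with parameter `a`. -/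
structure IsRep (D : BlockData K) (a b c : K) : Prop where
  a_ne : a ≠ 0
  e_ne : ∀ l, D.e l ≠ 0
  cubic : ∀ l, (D.e l - a) * (D.e l - b) * (D.e l - c) = 0
  T_closed : ∀ i l m, (i, l) ∈ D.V → (i, m) ∉ D.V → D.T i l m = 0
  Z_closed : ∀ l i j, (i, l) ∈ D.V → (j, l) ∉ D.V → D.Z l i j = 0
  T_mul : ∀ i l m, (i, l) ∈ D.V → (i, m) ∈ D.V →
    ∑ u, D.T i l u * D.T' i u m = if l = m then 1 else 0
  Z_mul : ∀ l i j, (i, l) ∈ D.V → (j, l) ∈ D.V →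
    ∑ u, D.Z l i u * D.Z' l u j = if i = j then 1 else 0
  T_braid : ∀ i l m, (i, l) ∈ D.V → (i, m) ∈ D.V →
    D.e l * D.T i l m * D.e m = ∑ u, D.T i l u * D.e u * D.T i u m
  T_Z_braid : ∀ i j l m, (i, l) ∈ D.V → (j, m) ∈ D.V →
    ∑ u, D.T i l u * D.Z u i j * D.T j u m = ∑ u, D.Z l i u * D.T u l m * D.Z m u j
  three : ∀ i l m, (i, l) ∈ D.V → (i, m) ∈ D.V →
    (D.e l - D.e m) * (D.e l - a) * (D.e m - a) * (D.T i l m - a ^ 2 * D.T' i l m) = 0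

/-- The matrices of `s₁`, `s₂`, `s₃`. -/
def mat (D : BlockData K) : Fin 3 → Matrix D.V D.V K :=
  ![restrict D.V (diagonal fun s => D.e s.2), restrict D.V (rowBlocks D.T),
    restrict D.V (colBlocks D.Z)]

/-- The matrices of the inverses of `s₁`, `s₂`, `s₃`. -/
def matInv (D : BlockData K) : Fin 3 → Matrix D.V D.V K :=
  ![restrict D.V (diagonal fun s => (D.e s.2)⁻¹), restrict D.V (rowBlocks D.T'),
    restrict D.V (colBlocks D.Z')]

theorem closed_diagonal (V : Finset (Fin 4 × Fin 3)) (f : Fin 4 × Fin 3 → K) :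
    Closed V (diagonal f) := fun _ hs _ ht =>
  diagonal_apply_ne _ fun h => ht (h ▸ hs)

namespace IsRep

variable {D : BlockData K} {a b c : K}

theorem closed_T (h : D.IsRep a b c) : Closed D.V (rowBlocks D.T) := by
  rintro ⟨i, l⟩ hs ⟨j, m⟩ ht
  rw [rowBlocks_apply]
  split_ifs with hij
  · obtain rfl : i = j := hij
    exact h.T_closed i l m hs ht
  · rfl

theorem closed_Z (h : D.IsRep a b c) : Closed D.V (colBlocks D.Z) := by
  rintro ⟨i, l⟩ hs ⟨j, m⟩ ht
  rw [colBlocks_apply]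
  split_ifs with hlm
  · obtain rfl : l = m := hlm
    exact h.Z_closed l i j hs ht
  · rfl

theorem mat_mul_matInv (h : D.IsRep a b c) (k : Fin 3) : D.mat k * D.matInv k = 1 := by
  fin_cases k
  · change restrict _ _ * restrict _ _ = 1
    rw [← restrict_mul (closed_diagonal _ _), diagonal_mul_diagonal]
    ext s t
    simp only [restrict_apply, diagonal_apply, one_apply, mul_inv_cancel₀ (h.e_ne _), Subtype.ext_iff]
  · change restrict _ _ * restrict _ _ = 1
    rw [← restrict_mul h.closed_T]
    ext ⟨⟨i, l⟩, hs⟩ ⟨⟨j, m⟩, ht⟩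
    rw [restrict_apply, rowBlocks_mul_apply, one_apply]
    simp only [rowBlocks_apply, Subtype.mk.injEq, Prod.mk.injEq]
    by_cases hij : i = j
    · subst hij
      simp [h.T_mul i l m hs ht]
    · simp [hij]
  · change restrict _ _ * restrict _ _ = 1
    rw [← restrict_mul h.closed_Z]
    ext ⟨⟨i, l⟩, hs⟩ ⟨⟨j, m⟩, ht⟩
    rw [restrict_apply, colBlocks_mul_apply, one_apply]
    simp only [colBlocks_apply, Subtype.mk.injEq, Prod.mk.injEq]
    by_cases hlm : l = m
    · subst hlm
      simp [h.Z_mul l i j hs ht]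
    · simp [hlm]

theorem braid_zero_one (h : D.IsRep a b c) : D.mat 0 * D.mat 1 * D.mat 0 = D.mat 1 * D.mat 0 * D.mat 1 := by
  change restrict _ _ * restrict _ _ * restrict _ _ = restrict _ _ * restrict _ _ * restrict _ _
  rw [← restrict_mul (closed_diagonal _ _), ← restrict_mul ((closed_diagonal _ _).mul h.closed_T),
    ← restrict_mul h.closed_T, ← restrict_mul (h.closed_T.mul (closed_diagonal _ _))]
  ext ⟨⟨i, l⟩, hs⟩ ⟨⟨j, m⟩, ht⟩
  rw [restrict_apply, restrict_apply, mul_diagonal, diagonal_mul, Matrix.mul_assoc,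
    rowBlocks_mul_apply]
  simp only [diagonal_mul, rowBlocks_apply]
  by_cases hij : i = j
  · subst hij
    simpa [mul_assoc] using h.T_braid i l m hs ht
  · simp [hij]

theorem braid_one_two (h : D.IsRep a b c) : D.mat 1 * D.mat 2 * D.mat 1 = D.mat 2 * D.mat 1 * D.mat 2 := by
  change restrict _ _ * restrict _ _ * restrict _ _ = restrict _ _ * restrict _ _ * restrict _ _
  rw [← restrict_mul h.closed_T, ← restrict_mul (h.closed_T.mul h.closed_Z),
    ← restrict_mul h.closed_Z, ← restrict_mul (h.closed_Z.mul h.closed_T)]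
  ext ⟨⟨i, l⟩, hs⟩ ⟨⟨j, m⟩, ht⟩
  rw [restrict_apply, restrict_apply, Matrix.mul_assoc, Matrix.mul_assoc,
    rowBlocks_mul_apply, colBlocks_mul_apply]
  simp only [rowBlocks_mul_apply, colBlocks_mul_apply]
  simp only [rowBlocks_apply, colBlocks_apply]
  simpa [mul_assoc] using h.T_Z_braid i j l m hs ht

theorem comm_zero_two (h : D.IsRep a b c) : D.mat 0 * D.mat 2 = D.mat 2 * D.mat 0 := by
  change restrict _ _ * restrict _ _ = restrict _ _ * restrict _ _
  rw [← restrict_mul (closed_diagonal _ _), ← restrict_mul h.closed_Z]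
  ext s t
  rw [restrict_apply, restrict_apply, diagonal_mul, mul_diagonal, colBlocks_apply]
  split_ifs with hst
  · rw [hst, mul_comm]
  · simp

theorem cubic_mat (h : D.IsRep a b c) : (D.mat 0 - algebraMap K _ a) * (D.mat 0 - algebraMap K _ b) *
    (D.mat 0 - algebraMap K _ c) = 0 := by
  have h1 : D.mat 0 = diagonal fun s : D.V => D.e s.1.2 := by
    exact submatrix_diagonal _ _ Subtype.val_injective
  rw [h1]
  simp only [algebraMap_eq_diagonal, diagonal_sub, diagonal_mul_diagonal]
  ext s t
  simp [diagonal_apply, h.cubic]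

/-- As `s₁` is diagonal, left and right multiplication by it scale the entry `(l, m)` by `e l` and
`e m`, so the relation reduces entrywise to the field `three`. -/
theorem three_mat (h : D.IsRep a b c) : D.matInv 0 * D.mat 1 * D.mat 0 =
    D.mat 0 * D.mat 1 * D.matInv 0 - a⁻¹ • (D.mat 0 * D.mat 1) + a • (D.mat 0 * D.matInv 1)
      + a • (D.matInv 0 * D.mat 1) - a ^ 3 • (D.matInv 0 * D.matInv 1)
      + a⁻¹ • (D.mat 1 * D.mat 0) - a • (D.mat 1 * D.matInv 0) - a • (D.matInv 1 * D.mat 0)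
      + a ^ 3 • (D.matInv 1 * D.matInv 0)
      + a ^ 2 • (D.matInv 0 * D.matInv 1 * D.mat 0)
      - a ^ 2 • (D.mat 0 * D.matInv 1 * D.matInv 0) := by
  have h1 : D.mat 0 = diagonal fun s : D.V => D.e s.1.2 := by
    exact submatrix_diagonal _ _ Subtype.val_injective
  have h2 : D.matInv 0 = diagonal fun s : D.V => (D.e s.1.2)⁻¹ := by
    exact submatrix_diagonal _ _ Subtype.val_injective
  rw [h1, h2]
  ext ⟨⟨i, l⟩, hs⟩ ⟨⟨j, m⟩, ht⟩
  simp only [Matrix.add_apply, Matrix.sub_apply, Matrix.smul_apply, mul_diagonal, diagonal_mul,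
    smul_eq_mul]
  have h3 : D.mat 1 ⟨⟨i, l⟩, hs⟩ ⟨⟨j, m⟩, ht⟩ = if i = j then D.T i l m else 0 := rfl
  have h4 : D.matInv 1 ⟨⟨i, l⟩, hs⟩ ⟨⟨j, m⟩, ht⟩ = if i = j then D.T' i l m else 0 := rfl
  rw [h3, h4]
  by_cases hij : i = j
  · subst hij
    have h5 := h.three i l m hs ht
    have h6 := h.e_ne l
    have h7 := h.e_ne m
    have h8 := h.a_ne
    simp only [if_true]
    field_simp
    linear_combination h5
  · simp [hij]

end IsRep
end BlockData
end CubicQuotient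

/-! ### Explicit matrices for the generators. -/

namespace CubicQuotient

open Matrix

/-- Three eigenvalues in general position, with the polynomials in them that occur as
denominators. -/
structure Frame (K : Type*) [Field K] where
  (x y z p q r A B C H G : K)
  p_eq : p = x - y
  q_eq : q = x - z
  r_eq : r = y - z
  A_eq : A = x ^ 2 + y * z
  B_eq : B = y ^ 2 + x * z
  C_eq : C = z ^ 2 + x * y
  H_eq : H = x ^ 2 - x * y + y ^ 2
  G_eq : G = x ^ 2 - x * z + z ^ 2
  x_ne : x ≠ 0
  y_ne : y ≠ 0
  z_ne : z ≠ 0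
  p_ne : p ≠ 0
  q_ne : q ≠ 0
  r_ne : r ≠ 0
  A_ne : A ≠ 0
  B_ne : B ≠ 0
  C_ne : C ≠ 0
  H_ne : H ≠ 0
  G_ne : G ≠ 0

namespace Frame

variable {K : Type*} [Field K] (F : Frame K)

/-- The eigenvalues. -/
def e : Fin 3 → K
  | 0 => F.x
  | 1 => F.y
  | 2 => F.z

/-- The action of `s₂` on the irreducible representations of dimension `1, 2, 2, 3` of the braid
group on three strands with eigenvalues `{x}`, `{x, y}`, `{x, z}`, `{x, y, z}`. -/
def T : Fin 4 → Fin 3 → Fin 3 → K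
  | 0, 0, 0 => F.x
  | 0, 0, 1 => 0
  | 0, 0, 2 => 0
  | 0, 1, _ => 0
  | 0, 2, _ => 0
  | 1, 0, 0 => -F.y ^ 2 / F.p
  | 1, 0, 1 => -F.x * F.y / F.p
  | 1, 0, 2 => 0
  | 1, 1, 0 => F.H / F.p
  | 1, 1, 1 => F.x ^ 2 / F.p
  | 1, 1, 2 => 0
  | 1, 2, _ => 0
  | 2, 0, 0 => -F.z ^ 2 / F.q
  | 2, 0, 1 => 0
  | 2, 0, 2 => -F.x * F.z / F.q
  | 2, 1, _ => 0
  | 2, 2, 0 => F.G / F.q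
  | 2, 2, 1 => 0
  | 2, 2, 2 => F.x ^ 2 / F.q
  | 3, 0, 0 => F.y * F.z * (F.y + F.z) / (F.p * F.q)
  | 3, 0, 1 => -F.z * F.B / (F.p * F.r)
  | 3, 0, 2 => F.y * F.C / (F.q * F.r)
  | 3, 1, 0 => F.z * F.A / (F.p * F.q)
  | 3, 1, 1 => -F.x * F.z * (F.x + F.z) / (F.p * F.r)
  | 3, 1, 2 => F.x * F.C / (F.q * F.r)
  | 3, 2, 0 => F.y * F.A / (F.p * F.q)
  | 3, 2, 1 => -F.x * F.B / (F.p * F.r)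
  | 3, 2, 2 => F.x * F.y * (F.x + F.y) / (F.q * F.r)

/-- The scalars by which the full twist on three strands acts. -/
def twist : Fin 4 → K
  | 0 => F.x ^ 6
  | 1 => -(F.x ^ 3 * F.y ^ 3)
  | 2 => -(F.x ^ 3 * F.z ^ 3)
  | 3 => (F.x * F.y * F.z) ^ 2

/-- The inverse of `s₂`. -/
def T' : Fin 4 → Fin 3 → Fin 3 → K := fun i l m =>
  -- The full twist on three strands is `s₂ s₁² s₂ s₁²`, so when it acts by `θ` the inverse of `s₂`
  -- is `θ⁻¹ s₁² s₂ s₁²`.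
  F.e l ^ 2 * F.e m ^ 2 * F.T i l m / F.twist i

/-- The inverse of `s₃` when the full twist on four strands acts by `ζ`. -/
def inv (ζ : K) (Z : Fin 3 → Fin 4 → Fin 4 → K) : Fin 3 → Fin 4 → Fin 4 → K :=
  -- With `θ` the full twist on three strands, the one on four strands is `θ s₃ s₂ s₁² s₂ s₃ = θ s₃
  -- θ s₁⁻² s₃`, whence `s₃⁻¹ = ζ⁻¹ θ s₃ θ s₁⁻²`.
  fun l i j => F.twist i * F.twist j * Z l i j / (F.e l ^ 2 * ζ)

/-- The indices of the eigenvalues of each component. -/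
def support (C : Finset (Fin 4)) : Finset (Fin 4 × Fin 3) :=
  Finset.univ.filter fun s => s.1 ∈ C ∧
    s.2 ∈ (![{0}, {0, 1}, {0, 2}, {0, 1, 2}] : Fin 4 → Finset (Fin 3)) s.1

/-- The action of `s₃` on the representation of dimension `3`. -/
def Z3 : Fin 3 → Fin 4 → Fin 4 → K
  | 0, 0, 0 => F.y ^ 3 / F.H
  | 0, 0, 1 => 1
  | 0, 0, 2 => 0
  | 0, 0, 3 => 0
  | 0, 1, 0 => -F.x * F.y * F.p ^ 2 * (F.x ^ 2 + F.y ^ 2) / F.H ^ 2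
  | 0, 1, 1 => F.x ^ 3 / F.H
  | 0, 1, 2 => 0
  | 0, 1, 3 => 0
  | 0, 2, _ => 0
  | 0, 3, _ => 0
  | 1, 0, _ => 0
  | 1, 1, 0 => 0
  | 1, 1, 1 => F.x
  | 1, 1, 2 => 0
  | 1, 1, 3 => 0
  | 1, 2, _ => 0
  | 1, 3, _ => 0
  | 2, _, _ => 0

/-- The action of `s₃` on the representation of dimension `6`. -/
def Z6 : Fin 3 → Fin 4 → Fin 4 → K
  | 0, 0, 0 => F.y ^ 3 * F.z * (F.y + F.z) / (F.A * F.H)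
  | 0, 0, 1 => -F.z * F.B / (F.y * F.r)
  | 0, 0, 2 => 0
  | 0, 0, 3 => 1
  | 0, 1, 0 => -F.y ^ 2 * F.z * F.p * F.r * (F.y + F.z) * (F.y ^ 2 * F.z - F.x ^ 3) / (F.C * F.A
      * F.H ^ 2)
  | 0, 1, 1 => F.x * F.z * (-F.x ^ 3 + F.x ^ 2 * F.y + F.x ^ 2 * F.z + F.x * F.y * F.z + F.x *
      F.z ^ 2 - F.y * F.z ^ 2) / (F.C * F.H)
  | 0, 1, 2 => 0
  | 0, 1, 3 => -F.x ^ 2 * F.r * (F.y + F.z) / (F.C * F.H)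
  | 0, 2, _ => 0
  | 0, 3, 0 => -F.y ^ 3 * F.p * F.q ^ 2 * (F.x + F.z) * (F.y ^ 2 * F.z - F.x ^ 3) / (F.C * F.A ^
      2 * F.H)
  | 0, 3, 1 => F.x ^ 2 * F.q ^ 2 * (F.x + F.z) * F.B / (F.r * F.C * F.A)
  | 0, 3, 2 => 0
  | 0, 3, 3 => F.x ^ 3 * (F.x + F.y) * (F.y + F.z) / (F.C * F.A)
  | 1, 0, _ => 0
  | 1, 1, 0 => 0
  | 1, 1, 1 => F.z ^ 2 * (F.x + F.y) / F.C
  | 1, 1, 2 => 0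
  | 1, 1, 3 => F.r * (F.y + F.z) / F.C
  | 1, 2, _ => 0
  | 1, 3, 0 => 0
  | 1, 3, 1 => -F.x * F.y * F.q * (F.x + F.z) / F.C
  | 1, 3, 2 => 0
  | 1, 3, 3 => F.x * F.y * (F.x + F.y) / F.C
  | 2, 0, _ => 0
  | 2, 1, _ => 0
  | 2, 2, _ => 0
  | 2, 3, 0 => 0
  | 2, 3, 1 => 0
  | 2, 3, 2 => 0
  | 2, 3, 3 => F.x

/-- The action of `s₃` on the representation of dimension `8`. -/
def Z8 : Fin 3 → Fin 4 → Fin 4 → K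
  | 0, 0, 0 => (F.x ^ 2 * F.y + F.x ^ 2 * F.z - F.x * F.y ^ 2 - F.x * F.z ^ 2 + F.y ^ 2 * F.z +
      F.y * F.z ^ 2) * F.y ^ 2 * F.z ^ 2 / (F.A * F.H * F.G)
  | 0, 0, 1 => -F.z ^ 3 * F.B
  | 0, 0, 2 => F.y ^ 3 * F.C
  | 0, 0, 3 => F.y * F.z * F.r
  | 0, 1, 0 => (F.x ^ 4 + F.x ^ 2 * F.y * F.z + F.y ^ 2 * F.z ^ 2) * F.z * F.p * (F.x ^ 2 * F.z -
      F.y ^ 3) / (F.C * F.B * F.A * F.H ^ 2 * F.G)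
  | 0, 1, 1 => F.x ^ 2 * F.z ^ 2 * (F.x + F.z) / (F.C * F.H)
  | 0, 1, 2 => F.x * F.y * F.p * (F.x ^ 2 * F.z - F.y ^ 3) / (F.z * F.B * F.H)
  | 0, 1, 3 => -F.x ^ 2 * F.y * F.r * (F.x + F.z) / (F.C * F.B * F.H)
  | 0, 2, 0 => -(F.x ^ 4 + F.x ^ 2 * F.y * F.z + F.y ^ 2 * F.z ^ 2) * F.y * F.q * (F.x ^ 2 * F.y
      - F.z ^ 3) / (F.C * F.B * F.A * F.H * F.G ^ 2)
  | 0, 2, 1 => F.x * F.z * F.q * (F.x ^ 2 * F.y - F.z ^ 3) / (F.y * F.C * F.G)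
  | 0, 2, 2 => F.x ^ 2 * F.y ^ 2 * (F.x + F.y) / (F.B * F.G)
  | 0, 2, 3 => F.x ^ 2 * F.z * F.r * (F.x + F.y) / (F.C * F.B * F.G)
  | 0, 3, 0 => (F.x ^ 4 + F.x ^ 2 * F.y * F.z + F.y ^ 2 * F.z ^ 2) * F.p * F.q * (F.x ^ 2 * F.y -
      F.z ^ 3) * (F.x ^ 2 * F.z - F.y ^ 3) / (F.r * F.C * F.B * F.A ^ 2 * F.H * F.G)
  | 0, 3, 1 => F.x ^ 2 * F.z * F.q * (F.x + F.z) * (F.x ^ 2 * F.y - F.z ^ 3) / (F.r * F.C * F.A)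
  | 0, 3, 2 => -F.x ^ 2 * F.y * F.p * (F.x + F.y) * (F.x ^ 2 * F.z - F.y ^ 3) / (F.r * F.B * F.A)
  | 0, 3, 3 => F.x ^ 3 * (2 * F.x ^ 2 * F.y * F.z + F.x * F.y ^ 3 + F.x * F.y ^ 2 * F.z + F.x *
      F.y * F.z ^ 2 + F.x * F.z ^ 3 + 2 * F.y ^ 2 * F.z ^ 2) / (F.C * F.B * F.A)
  | 1, 0, _ => 0
  | 1, 1, 0 => 0
  | 1, 1, 1 => F.z ^ 2 * (F.x + F.z) / F.C
  | 1, 1, 2 => 0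
  | 1, 1, 3 => F.r / F.C
  | 1, 2, _ => 0
  | 1, 3, 0 => 0
  | 1, 3, 1 => -F.x * F.z * (F.x ^ 2 * F.y - F.z ^ 3) / F.C
  | 1, 3, 2 => 0
  | 1, 3, 3 => F.x * F.y * (F.x + F.z) / F.C
  | 2, 0, _ => 0
  | 2, 1, _ => 0
  | 2, 2, 0 => 0
  | 2, 2, 1 => 0
  | 2, 2, 2 => F.y ^ 2 * (F.x + F.y) / F.B
  | 2, 2, 3 => -F.r / F.B
  | 2, 3, 0 => 0
  | 2, 3, 1 => 0
  | 2, 3, 2 => -F.x * F.y * (F.x ^ 2 * F.z - F.y ^ 3) / F.B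
  | 2, 3, 3 => F.x * F.z * (F.x + F.y) / F.B

set_option linter.unusedSimpArgs false in
set_option linter.unnecessarySeqFocus false in
theorem T_mul (i : Fin 4) (l m : Fin 3) (hl : (i, l) ∈ support {i}) (hm : (i, m) ∈ support {i}) :
    ∑ u, F.T i l u * F.T' i u m = if l = m then 1 else 0 := by
  have := F.x_ne
  have := F.y_ne
  have := F.z_ne
  have := F.p_ne
  have := F.q_ne
  have := F.r_ne
  fin_cases i <;> fin_cases l <;> fin_cases m <;>
    first
    | exact absurd hl (by decide)
    | exact absurd hm (by decide)
    | (simp only [Fin.sum_univ_three, Fin.zero_eta, Fin.mk_one, Fin.reduceFinMk, Fin.isValue,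
        Fin.reduceEq, reduceIte] <;>
      simp only [T, T', twist, e, mul_zero, zero_mul, add_zero, zero_add] <;>
      field_simp <;>
      (try simp only [F.p_eq, F.q_eq, F.r_eq, F.A_eq, F.B_eq, F.C_eq, F.H_eq, F.G_eq]) <;>
      ring)

set_option linter.unusedSimpArgs false in
set_option linter.unnecessarySeqFocus false in
theorem T_braid (i : Fin 4) (l m : Fin 3) :
    F.e l * F.T i l m * F.e m = ∑ u, F.T i l u * F.e u * F.T i u m := by
  have := F.x_ne
  have := F.y_ne
  have := F.z_ne
  have := F.p_ne
  have := F.q_ne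
  have := F.r_ne
  fin_cases i <;> fin_cases l <;> fin_cases m <;>
    (simp only [Fin.sum_univ_three, Fin.zero_eta, Fin.mk_one, Fin.reduceFinMk, Fin.isValue,
        Fin.reduceEq, reduceIte] <;>
      simp only [T, e, mul_zero, zero_mul, add_zero, zero_add] <;>
      field_simp <;>
      (try simp only [F.p_eq, F.q_eq, F.r_eq, F.A_eq, F.B_eq, F.C_eq, F.H_eq, F.G_eq]) <;>
      ring)

end Frame
end CubicQuotient
-- Inverses and braid relations in dimensions 3, 6 and 8.
namespace CubicQuotient

open Matrix
namespace Frame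

variable {K : Type*} [Field K] (F : Frame K)
set_option linter.unusedSimpArgs false in
set_option linter.unnecessarySeqFocus false in
theorem Z3_mul (l : Fin 3) (i j : Fin 4) (hi : (i, l) ∈ support {0, 1})
    (hj : (j, l) ∈ support {0, 1}) :
    ∑ u, F.Z3 l i u * F.inv (F.x ^ 8 * F.y ^ 4) F.Z3 l u j = if i = j then 1 else 0 := by
  have := F.x_ne
  have := F.y_ne
  have := F.z_ne
  have := F.p_ne
  have := F.H_ne
  fin_cases l <;> fin_cases i <;> fin_cases j <;>
    first
    | exact absurd hi (by decide)
    | exact absurd hj (by decide)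
    | (simp only [Fin.sum_univ_four, Fin.zero_eta, Fin.mk_one, Fin.reduceFinMk, Fin.isValue,
        Fin.reduceEq, reduceIte] <;>
      simp only [Z3, inv, twist, e, mul_zero, zero_mul, add_zero, zero_add] <;>
      field_simp <;>
      (try simp only [F.p_eq, F.q_eq, F.r_eq, F.A_eq, F.B_eq, F.C_eq, F.H_eq, F.G_eq]) <;>
      ring)

set_option linter.unusedSimpArgs false in
set_option linter.unnecessarySeqFocus false in
theorem T_Z3_braid (i j : Fin 4) (l m : Fin 3) (hi : (i, l) ∈ support {0, 1})
    (hj : (j, m) ∈ support {0, 1}) :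
    ∑ u, F.T i l u * F.Z3 u i j * F.T j u m = ∑ u, F.Z3 l i u * F.T u l m * F.Z3 m u j := by
  have := F.x_ne
  have := F.y_ne
  have := F.z_ne
  have := F.p_ne
  have := F.H_ne
  fin_cases i <;> fin_cases l <;> fin_cases j <;> fin_cases m <;>
    first
    | exact absurd hi (by decide)
    | exact absurd hj (by decide)
    | (simp only [Fin.sum_univ_three, Fin.sum_univ_four, Fin.zero_eta, Fin.mk_one, Fin.reduceFinMk, Fin.isValue,
        Fin.reduceEq, reduceIte] <;>
      simp only [T, Z3, mul_zero, zero_mul, add_zero, zero_add] <;>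
      field_simp <;>
      (try simp only [F.p_eq, F.q_eq, F.r_eq, F.A_eq, F.B_eq, F.C_eq, F.H_eq, F.G_eq]) <;>
      ring)

set_option linter.unusedSimpArgs false in
set_option linter.unnecessarySeqFocus false in
theorem Z6_mul (l : Fin 3) (i j : Fin 4) (hi : (i, l) ∈ support {0, 1, 3})
    (hj : (j, l) ∈ support {0, 1, 3}) :
    ∑ u, F.Z6 l i u * F.inv (F.x ^ 6 * F.y ^ 4 * F.z ^ 2) F.Z6 l u j = if i = j then 1 else 0 := by
  have := F.x_ne
  have := F.y_ne
  have := F.z_ne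
  have := F.p_ne
  have := F.q_ne
  have := F.r_ne
  have := F.H_ne
  have := F.A_ne
  have := F.B_ne
  have := F.C_ne
  fin_cases l <;> fin_cases i <;> fin_cases j <;>
    first
    | exact absurd hi (by decide)
    | exact absurd hj (by decide)
    | (simp only [Fin.sum_univ_four, Fin.zero_eta, Fin.mk_one, Fin.reduceFinMk, Fin.isValue,
        Fin.reduceEq, reduceIte] <;>
      simp only [Z6, inv, twist, e, mul_zero, zero_mul, add_zero, zero_add] <;>
      field_simp <;>
      (try simp only [F.p_eq, F.q_eq, F.r_eq, F.A_eq, F.B_eq, F.C_eq, F.H_eq, F.G_eq]) <;>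
      ring)

set_option linter.unusedSimpArgs false in
set_option linter.unnecessarySeqFocus false in
set_option maxHeartbeats 4000000 in
theorem T_Z6_braid (i j : Fin 4) (l m : Fin 3) (hi : (i, l) ∈ support {0, 1, 3})
    (hj : (j, m) ∈ support {0, 1, 3}) :
    ∑ u, F.T i l u * F.Z6 u i j * F.T j u m = ∑ u, F.Z6 l i u * F.T u l m * F.Z6 m u j := by
  have := F.x_ne
  have := F.y_ne
  have := F.z_ne
  have := F.p_ne
  have := F.q_ne
  have := F.r_ne
  have := F.H_ne
  have := F.A_ne
  have := F.B_ne
  have := F.C_ne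
  fin_cases i <;> fin_cases l <;> fin_cases j <;> fin_cases m <;>
    first
    | exact absurd hi (by decide)
    | exact absurd hj (by decide)
    | (simp only [Fin.sum_univ_three, Fin.sum_univ_four, Fin.zero_eta, Fin.mk_one, Fin.reduceFinMk, Fin.isValue,
        Fin.reduceEq, reduceIte] <;>
      simp only [T, Z6, mul_zero, zero_mul, add_zero, zero_add] <;>
      field_simp <;>
      (try simp only [F.p_eq, F.q_eq, F.r_eq, F.A_eq, F.B_eq, F.C_eq, F.H_eq, F.G_eq]) <;>
      ring)
set_option linter.unusedSimpArgs false in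
set_option linter.unnecessarySeqFocus false in
set_option maxHeartbeats 4000000 in
theorem Z8_mul (l : Fin 3) (i j : Fin 4) (hi : (i, l) ∈ support {0, 1, 2, 3})
    (hj : (j, l) ∈ support {0, 1, 2, 3}) :
    ∑ u, F.Z8 l i u * F.inv (F.x ^ 6 * F.y ^ 3 * F.z ^ 3) F.Z8 l u j = if i = j then 1 else 0 := by
  have := F.x_ne
  have := F.y_ne
  have := F.z_ne
  have := F.p_ne
  have := F.q_ne
  have := F.r_ne
  have := F.H_ne
  have := F.G_ne
  have := F.A_ne
  have := F.B_ne
  have := F.C_ne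
  fin_cases l <;> fin_cases i <;> fin_cases j <;>
    first
    | exact absurd hi (by decide)
    | exact absurd hj (by decide)
    | (simp only [Fin.sum_univ_four, Fin.zero_eta, Fin.mk_one, Fin.reduceFinMk, Fin.isValue,
        Fin.reduceEq, reduceIte] <;>
      simp only [Z8, inv, twist, e, mul_zero, zero_mul, add_zero, zero_add] <;>
      field_simp <;>
      (try simp only [F.p_eq, F.q_eq, F.r_eq, F.A_eq, F.B_eq, F.C_eq, F.H_eq, F.G_eq]) <;>
      ring)

set_option linter.unusedSimpArgs false in
set_option linter.unnecessarySeqFocus false in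
set_option maxHeartbeats 4000000 in
theorem T_Z8_braid (i j : Fin 4) (l m : Fin 3) (hi : (i, l) ∈ support {0, 1, 2, 3})
    (hj : (j, m) ∈ support {0, 1, 2, 3}) :
    ∑ u, F.T i l u * F.Z8 u i j * F.T j u m = ∑ u, F.Z8 l i u * F.T u l m * F.Z8 m u j := by
  have := F.x_ne
  have := F.y_ne
  have := F.z_ne
  have := F.p_ne
  have := F.q_ne
  have := F.r_ne
  have := F.H_ne
  have := F.G_ne
  have := F.A_ne
  have := F.B_ne
  have := F.C_ne
  fin_cases i <;> fin_cases l <;> fin_cases j <;> fin_cases m <;>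
    first
    | exact absurd hi (by decide)
    | exact absurd hj (by decide)
    | (simp only [Fin.sum_univ_three, Fin.sum_univ_four, Fin.zero_eta, Fin.mk_one, Fin.reduceFinMk, Fin.isValue,
        Fin.reduceEq, reduceIte] <;>
      simp only [T, Z8, mul_zero, zero_mul, add_zero, zero_add] <;>
      field_simp <;>
      (try simp only [F.p_eq, F.q_eq, F.r_eq, F.A_eq, F.B_eq, F.C_eq, F.H_eq, F.G_eq]) <;>
      ring)
end Frame
end CubicQuotient

/-! ### The universal property of `Q 4` and the defining relations on the matrices. -/

namespace CubicQuotient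

open Matrix

section Lift

variable {A : Type*} [Ring A] [Algebra R A]

/-- The universal property of `Q 4`. -/
theorem exists_algHom_Q₄ (u : Fin 3 → Aˣ) (h12 : u 0 * u 1 * u 0 = u 1 * u 0 * u 1)
    (h23 : u 1 * u 2 * u 1 = u 2 * u 1 * u 2) (h13 : u 0 * u 2 = u 2 * u 0)
    (cubic : ((u 0 : A) - algebraMap R A a) * (u 0 - algebraMap R A b) * (u 0 - algebraMap R A c)
      = 0)
    (three : ((u 0)⁻¹ * u 1 * u 0 : A) = u 0 * u 1 * ↑(u 0)⁻¹
      - (↑a⁻¹ : R) • ((u 0 : A) * u 1) + (a : R) • ((u 0 : A) * ↑(u 1)⁻¹)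
      + (a : R) • ((↑(u 0)⁻¹ : A) * u 1) - (a : R) ^ 3 • ((↑(u 0)⁻¹ : A) * ↑(u 1)⁻¹)
      + (↑a⁻¹ : R) • ((u 1 : A) * u 0) - (a : R) • ((u 1 : A) * ↑(u 0)⁻¹)
      - (a : R) • ((↑(u 1)⁻¹ : A) * u 0) + (a : R) ^ 3 • ((↑(u 1)⁻¹ : A) * ↑(u 0)⁻¹)
      + (a : R) ^ 2 • ((↑(u 0)⁻¹ : A) * ↑(u 1)⁻¹ * u 0)
      - (a : R) ^ 2 • ((u 0 : A) * ↑(u 1)⁻¹ * ↑(u 0)⁻¹)) :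
    ∃ φ : Q 4 →ₐ[R] A, φ (toQ s₁) = u 0 ∧ φ (toQ s₂) = u 1 ∧ φ (toQ s₃) = u 2 := by
  have hrel : ∀ r ∈ braidRels 4, FreeGroup.lift (u : Fin (4 - 1) → Aˣ) r = 1 := by
    rintro r (⟨i, j, hij, rfl⟩ | ⟨i, j, hij, rfl⟩)
    · rw [map_mul, map_inv, mul_inv_eq_one]
      simp only [map_mul, FreeGroup.lift_apply_of]
      obtain ⟨i, hi⟩ := i
      obtain ⟨j, hj⟩ := j
      simp only at hij
      obtain rfl : j = i + 1 := hij.symm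
      obtain rfl | rfl : i = 0 ∨ i = 1 := by omega
      · exact h12
      · exact h23
    · rw [map_mul, map_inv, mul_inv_eq_one]
      simp only [map_mul, FreeGroup.lift_apply_of]
      obtain ⟨i, hi⟩ := i
      obtain ⟨j, hj⟩ := j
      simp only at hij
      obtain ⟨rfl, rfl⟩ : i = 0 ∧ j = 2 := by omega
      exact h13
  set g : BraidGroup 4 →* Aˣ := PresentedGroup.toGroup hrel with hg
  have hgen : ∀ i : Fin (4 - 1), g (gen i) = u i := fun i => PresentedGroup.toGroup.of hrel
  set f : BraidAlgebra 4 →ₐ[R] A := MonoidAlgebra.lift R A (BraidGroup 4) ((Units.coeHom A).comp g)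
    with hf
  have hbr : ∀ w, f (br w) = g w := fun w => by
    rw [hf, br, MonoidAlgebra.lift_of]
    rfl
  have hQ : ∀ ⦃x y : BraidAlgebra 4⦄, QRel 4 x y → f x = f y := by
    intro x y hxy
    cases hxy with
    | cubic i hi =>
      obtain rfl : i = (0 : Fin 3) := Fin.ext hi
      simp only [map_mul, map_sub, hbr, hgen, map_zero, AlgHom.commutes]
      exact cubic
    | three i j hi hj s t hs ht =>
      obtain rfl : i = (0 : Fin 3) := Fin.ext hi
      obtain rfl : j = (1 : Fin 3) := Fin.ext hj
      subst hs ht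
      simp only [map_add, map_sub, Units.smul_def, map_smul, hbr, map_mul, map_inv, hgen,
        Units.val_mul, Units.val_pow_eq_pow_val]
      exact three
  refine ⟨RingQuot.liftAlgHom R ⟨f, hQ⟩, ?_, ?_, ?_⟩
  · rw [toQ, RingQuot.liftAlgHom_mkAlgHom_apply, hbr, s₁, hgen]
    rfl
  · rw [toQ, RingQuot.liftAlgHom_mkAlgHom_apply, hbr, s₂, hgen]
    rfl
  · rw [toQ, RingQuot.liftAlgHom_mkAlgHom_apply, hbr, s₃, hgen]
    rfl

end Lift

namespace Frame

variable {K : Type*} [Field K] (F : Frame K)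

theorem mem_support {C : Finset (Fin 4)} {i : Fin 4} {l : Fin 3} :
    (i, l) ∈ support C ↔ i ∈ C ∧ (i, l) ∈ support {i} := by
  simp [support]

/-- The representation with the components `C` on which `s₃` acts by `Z` with inverse `Z'`. -/
def data (C : Finset (Fin 4)) (Z Z' : Fin 3 → Fin 4 → Fin 4 → K) : BlockData K :=
  ⟨F.e, F.T, F.T', Z, Z', support C⟩

theorem e_ne (l : Fin 3) : F.e l ≠ 0 := by
  fin_cases l
  exacts [F.x_ne, F.y_ne, F.z_ne]

theorem T_closed (i : Fin 4) (l m : Fin 3) (hl : (i, l) ∈ support {i})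
    (hm : (i, m) ∉ support {i}) : F.T i l m = 0 := by
  fin_cases i <;> fin_cases l <;> fin_cases m <;>
    first
    | exact absurd hl (by decide)
    | exact absurd (by decide) hm
    | rfl

theorem three_rel {C : Finset (Fin 4)} {a : K} (ha : F.x = a ∨ F.y = a) (hC : 2 ∈ C → F.x = a)
    (i : Fin 4) (l m : Fin 3) (hl : (i, l) ∈ support C) (hm : (i, m) ∈ support C) :
    (F.e l - F.e m) * (F.e l - a) * (F.e m - a) * (F.T i l m - a ^ 2 * F.T' i l m) = 0 := by
  have hx := F.x_ne
  have hy := F.y_ne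
  have hz := F.z_ne
  rw [mem_support] at hl hm
  fin_cases i <;> fin_cases l <;> fin_cases m <;>
    first
    | exact absurd hl.2 (by decide)
    | exact absurd hm.2 (by decide)
    | (simp only [sub_self, zero_mul]; done)
    | (have hxa := hC hl.1
       simp only [e, T', T, twist, hxa, sub_self, zero_mul, mul_zero])
    | (rcases ha with ha | ha <;>
       simp only [e, T', T, twist, ha, sub_self, zero_mul, mul_zero] <;>
       subst ha <;> field_simp <;> ring)

theorem isRep_data {C : Finset (Fin 4)} {Z Z' : Fin 3 → Fin 4 → Fin 4 → K} {a b c : K}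
    (ha0 : a ≠ 0) (cubic : ∀ l, (F.e l - a) * (F.e l - b) * (F.e l - c) = 0)
    (ha : F.x = a ∨ F.y = a) (hC : 2 ∈ C → F.x = a)
    (Z_closed : ∀ l i j, (i, l) ∈ support C → (j, l) ∉ support C → Z l i j = 0)
    (Z_mul : ∀ l i j, (i, l) ∈ support C → (j, l) ∈ support C →
      ∑ u, Z l i u * Z' l u j = if i = j then 1 else 0)
    (T_Z_braid : ∀ i j l m, (i, l) ∈ support C → (j, m) ∈ support C →
      ∑ u, F.T i l u * Z u i j * F.T j u m = ∑ u, Z l i u * F.T u l m * Z m u j) :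
    (F.data C Z Z').IsRep a b c where
  a_ne := ha0
  e_ne := F.e_ne
  cubic := cubic
  T_closed i l m hl hm := by
    have hl' := mem_support.1 hl
    exact F.T_closed i l m hl'.2 fun h => hm (mem_support.2 ⟨hl'.1, h⟩)
  Z_closed := Z_closed
  T_mul i l m hl hm := F.T_mul i l m (mem_support.1 hl).2 (mem_support.1 hm).2
  Z_mul := Z_mul
  T_braid i l m _ _ := F.T_braid i l m
  T_Z_braid := T_Z_braid
  three := F.three_rel ha hC

/-- The action of `s₃` when it acts as `s₁`. -/
def Z1 : Fin 3 → Fin 4 → Fin 4 → K := fun l i j => if i = j then F.e l else 0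

/-- When `s₃` acts as `s₁`, its braid relation with `s₂` is that of `s₁` with `s₂`. -/
theorem isRep_Z1 {C : Finset (Fin 4)} {a b c : K} (ha0 : a ≠ 0)
    (cubic : ∀ l, (F.e l - a) * (F.e l - b) * (F.e l - c) = 0)
    (ha : F.x = a ∨ F.y = a) (hC : 2 ∈ C → F.x = a) :
    (F.data C F.Z1 fun l i j => if i = j then (F.e l)⁻¹ else 0).IsRep a b c := by
  refine F.isRep_data ha0 cubic ha hC ?_ ?_ ?_
  · intro l i j hi hj
    exact if_neg fun h : i = j => hj (h ▸ hi)
  · intro l i j _ _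
    simp [Z1, F.e_ne]
  · intro i j l m _ _
    by_cases hij : i = j
    · subst hij
      simpa [Z1] using (F.T_braid i l m).symm
    · simp [Z1, hij]

theorem isRep_Z3 {a b c : K} (ha0 : a ≠ 0)
    (cubic : ∀ l, (F.e l - a) * (F.e l - b) * (F.e l - c) = 0) (ha : F.x = a ∨ F.y = a) :
    (F.data {0, 1} F.Z3 (F.inv (F.x ^ 8 * F.y ^ 4) F.Z3)).IsRep a b c := by
  refine F.isRep_data ha0 cubic ha (fun h => absurd h (by decide)) ?_ F.Z3_mul F.T_Z3_braid
  intro l i j hi hj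
  fin_cases l <;> fin_cases i <;> fin_cases j <;>
    first
    | exact absurd hi (by decide)
    | exact absurd (by decide) hj
    | rfl

theorem isRep_Z6 {a b c : K} (ha0 : a ≠ 0)
    (cubic : ∀ l, (F.e l - a) * (F.e l - b) * (F.e l - c) = 0) (ha : F.x = a ∨ F.y = a) :
    (F.data {0, 1, 3} F.Z6 (F.inv (F.x ^ 6 * F.y ^ 4 * F.z ^ 2) F.Z6)).IsRep a b c := by
  refine F.isRep_data ha0 cubic ha (fun h => absurd h (by decide)) ?_ F.Z6_mul F.T_Z6_braid
  intro l i j hi hj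
  fin_cases l <;> fin_cases i <;> fin_cases j <;>
    first
    | exact absurd hi (by decide)
    | exact absurd (by decide) hj
    | rfl

theorem isRep_Z8 {a b c : K} (ha0 : a ≠ 0)
    (cubic : ∀ l, (F.e l - a) * (F.e l - b) * (F.e l - c) = 0) (ha : F.x = a) :
    (F.data {0, 1, 2, 3} F.Z8 (F.inv (F.x ^ 6 * F.y ^ 3 * F.z ^ 3) F.Z8)).IsRep a b c := by
  refine F.isRep_data ha0 cubic (Or.inl ha) (fun _ => ha) ?_ F.Z8_mul F.T_Z8_braid
  intro l i j hi hj
  fin_cases l <;> fin_cases i <;> fin_cases j <;>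
    first
    | exact absurd hi (by decide)
    | exact absurd (by decide) hj
    | rfl

end Frame
end CubicQuotient

/-! ### The fifteen representations over a field with independent parameters. -/

namespace CubicQuotient

open Matrix MvPolynomial

section Generic

variable {K : Type*} [Field K] {v : Fin 3 → K}

/-- Algebraic independence reduces nonvanishing in `K` to that of an integer polynomial, which its
value at the point `(1, 2, 5)` certifies. -/
theorem aeval_ne_zero (hv : AlgebraicIndependent ℤ v) {u : Fin 3 → Fin 3}
    (hu : Function.Injective u) (p : MvPolynomial (Fin 3) ℤ) (hp : eval ![1, 2, 5] p ≠ 0) {t : K}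
    (ht : aeval (v ∘ u) p = t) : t ≠ 0 :=
  ht ▸ (map_ne_zero_iff _ (hv.comp u hu)).2 fun h => hp (by rw [h, map_zero])

/-- The frame of a permutation of algebraically independent eigenvalues. -/
def Frame.generic (hv : AlgebraicIndependent ℤ v) (u : Fin 3 → Fin 3)
    (hu : Function.Injective u) : Frame K where
  x := v (u 0)
  y := v (u 1)
  z := v (u 2)
  p := v (u 0) - v (u 1)
  q := v (u 0) - v (u 2)
  r := v (u 1) - v (u 2)
  A := v (u 0) ^ 2 + v (u 1) * v (u 2)
  B := v (u 1) ^ 2 + v (u 0) * v (u 2)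
  C := v (u 2) ^ 2 + v (u 0) * v (u 1)
  H := v (u 0) ^ 2 - v (u 0) * v (u 1) + v (u 1) ^ 2
  G := v (u 0) ^ 2 - v (u 0) * v (u 2) + v (u 2) ^ 2
  p_eq := rfl
  q_eq := rfl
  r_eq := rfl
  A_eq := rfl
  B_eq := rfl
  C_eq := rfl
  H_eq := rfl
  G_eq := rfl
  x_ne := aeval_ne_zero hv hu (X 0) (by simp) (by simp)
  y_ne := aeval_ne_zero hv hu (X 1) (by simp) (by simp)
  z_ne := aeval_ne_zero hv hu (X 2) (by simp) (by simp)
  p_ne := aeval_ne_zero hv hu (X 0 - X 1) (by simp) (by simp)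
  q_ne := aeval_ne_zero hv hu (X 0 - X 2) (by simp) (by simp)
  r_ne := aeval_ne_zero hv hu (X 1 - X 2) (by simp) (by simp)
  A_ne := aeval_ne_zero hv hu (X 0 ^ 2 + X 1 * X 2) (by simp) (by simp)
  B_ne := aeval_ne_zero hv hu (X 1 ^ 2 + X 0 * X 2) (by simp) (by simp)
  C_ne := aeval_ne_zero hv hu (X 2 ^ 2 + X 0 * X 1) (by simp) (by simp)
  H_ne := aeval_ne_zero hv hu (X 0 ^ 2 - X 0 * X 1 + X 1 ^ 2) (by simp) (by simp)
  G_ne := aeval_ne_zero hv hu (X 0 ^ 2 - X 0 * X 2 + X 2 ^ 2) (by simp) (by simp)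

/-- The orders of the eigenvalues in the irreducible representations. -/
def order : Fin 4 → Fin 3 → Fin 3 := ![![0, 1, 2], ![0, 2, 1], ![1, 0, 2], ![2, 0, 1]]

theorem order_injective (f : Fin 4) : Function.Injective (order f) := by
  revert f
  decide

/-- The order of the eigenvalues of each of the irreducible representations. -/
def repOrder : Fin 15 → Fin 4 := ![0, 0, 1, 2, 3, 0, 0, 0, 2, 1, 1, 3, 0, 2, 3]

/-- The components of each of the irreducible representations. -/
def repComps : Fin 15 → Finset (Fin 4) :=
  ![{3}, {0, 1, 3}, {0, 1, 3}, {0, 1, 3}, {0, 1, 3}, {0, 1, 2, 3}, {1}, {0, 1}, {0, 1}, {1}, {0, 1},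
    {0, 1}, {0}, {0}, {0}]

/-- The frames of the irreducible representations. -/
def repFrame (hv : AlgebraicIndependent ℤ v) (f : Fin 4) : Frame K :=
  Frame.generic hv (order f) (order_injective f)

/-- The action of `s₃` on the irreducible representations. -/
def repZ (F : Frame K) : Fin 15 → Fin 3 → Fin 4 → Fin 4 → K :=
  ![F.Z1, F.Z6, F.Z6, F.Z6, F.Z6, F.Z8, F.Z1, F.Z3, F.Z3, F.Z1, F.Z3, F.Z3, F.Z1, F.Z1, F.Z1]

/-- The action of the inverse of `s₃` on the irreducible representations. -/
def repZ' (F : Frame K) : Fin 15 → Fin 3 → Fin 4 → Fin 4 → K :=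
  let inv1 : Fin 3 → Fin 4 → Fin 4 → K := fun l i j => if i = j then (F.e l)⁻¹ else 0
  let inv3 := F.inv (F.x ^ 8 * F.y ^ 4) F.Z3
  let inv6 := F.inv (F.x ^ 6 * F.y ^ 4 * F.z ^ 2) F.Z6
  let inv8 := F.inv (F.x ^ 6 * F.y ^ 3 * F.z ^ 3) F.Z8
  ![inv1, inv6, inv6, inv6, inv6, inv8, inv1, inv3, inv3, inv1, inv3, inv3, inv1, inv1, inv1]

/-- The fifteen irreducible representations. -/
def rep (hv : AlgebraicIndependent ℤ v) (i : Fin 15) : BlockData K :=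
  (repFrame hv (repOrder i)).data (repComps i) (repZ (repFrame hv (repOrder i)) i)
    (repZ' (repFrame hv (repOrder i)) i)

theorem repFrame_e (hv : AlgebraicIndependent ℤ v) (f : Fin 4) (l : Fin 3) :
    (repFrame hv f).e l = v (order f l) := by
  fin_cases l <;> rfl

theorem isRep_rep (hv : AlgebraicIndependent ℤ v) (i : Fin 15) :
    (rep hv i).IsRep (v 0) (v 1) (v 2) := by
  have ha : v 0 ≠ 0 := hv.ne_zero 0
  have hc : ∀ f l, ((repFrame hv f).e l - v 0) * ((repFrame hv f).e l - v 1) *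
      ((repFrame hv f).e l - v 2) = 0 := by
    intro f l
    rw [repFrame_e]
    generalize order f l = m
    fin_cases m <;> simp
  have hx : ∀ f, (repFrame hv f).x = v 0 ∨ (repFrame hv f).y = v 0 := by
    intro f
    fin_cases f
    exacts [Or.inl rfl, Or.inl rfl, Or.inr rfl, Or.inr rfl]
  fin_cases i
  · exact Frame.isRep_Z1 _ ha (hc _) (hx _) fun h => absurd h (by decide)
  · exact Frame.isRep_Z6 _ ha (hc _) (hx _)
  · exact Frame.isRep_Z6 _ ha (hc _) (hx _)
  · exact Frame.isRep_Z6 _ ha (hc _) (hx _)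
  · exact Frame.isRep_Z6 _ ha (hc _) (hx _)
  · exact Frame.isRep_Z8 _ ha (hc _) rfl
  · exact Frame.isRep_Z1 _ ha (hc _) (hx _) fun h => absurd h (by decide)
  · exact Frame.isRep_Z3 _ ha (hc _) (hx _)
  · exact Frame.isRep_Z3 _ ha (hc _) (hx _)
  · exact Frame.isRep_Z1 _ ha (hc _) (hx _) fun h => absurd h (by decide)
  · exact Frame.isRep_Z3 _ ha (hc _) (hx _)
  · exact Frame.isRep_Z3 _ ha (hc _) (hx _)
  · exact Frame.isRep_Z1 _ ha (hc _) (hx _) fun h => absurd h (by decide)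
  · exact Frame.isRep_Z1 _ ha (hc _) (hx _) fun h => absurd h (by decide)
  · exact Frame.isRep_Z1 _ ha (hc _) (hx _) fun h => absurd h (by decide)

/-- The label of an index of a representation: the component and the eigenvalue, up to the order
of the eigenvalues. -/
def label : Fin 4 → Fin 4 → Fin 3 → Fin 10 :=
  ![![![0, 0, 0], ![3, 4, 0], ![5, 0, 6], ![7, 8, 9]],
    ![![0, 0, 0], ![5, 6, 0], ![0, 0, 0], ![7, 9, 8]],
    ![![1, 0, 0], ![4, 3, 0], ![0, 0, 0], ![8, 7, 9]],
    ![![2, 0, 0], ![6, 5, 0], ![0, 0, 0], ![9, 7, 8]]]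

/-- The eigenvalues of `s₁`. -/
def labelX (v : Fin 3 → K) : Fin 10 → K := ![v 0, v 1, v 2, v 0, v 1, v 0, v 2, v 0, v 1, v 2]

/-- The diagonal entries of `s₂`. -/
def labelY (v : Fin 3 → K) : Fin 10 → K :=
  ![v 0, v 1, v 2, -v 1 ^ 2 / (v 0 - v 1), v 0 ^ 2 / (v 0 - v 1), -v 2 ^ 2 / (v 0 - v 2),
    v 0 ^ 2 / (v 0 - v 2), v 1 * v 2 * (v 1 + v 2) / ((v 0 - v 1) * (v 0 - v 2)),
    -v 0 * v 2 * (v 0 + v 2) / ((v 0 - v 1) * (v 1 - v 2)),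
    v 0 * v 1 * (v 0 + v 1) / ((v 0 - v 2) * (v 1 - v 2))]

/-- This expresses that restriction to three strands is multiplicity free, with each eigenvalue of
`s₁` occurring at most once in a constituent. -/
theorem label_injOn (i : Fin 15) (s t : Fin 4 × Fin 3) (hs : s ∈ Frame.support (repComps i))
    (ht : t ∈ Frame.support (repComps i))
    (h : label (repOrder i) s.1 s.2 = label (repOrder i) t.1 t.2) : s = t := by
  revert i s t
  decide +kernel

theorem labelX_label (i : Fin 15) (s : Fin 4 × Fin 3) (hs : s ∈ Frame.support (repComps i)) :
    labelX v (label (repOrder i) s.1 s.2) = v (order (repOrder i) s.2) := by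
  have h1 : labelX v = v ∘ ![0, 1, 2, 0, 1, 0, 2, 0, 1, 2] := by
    funext l
    fin_cases l <;> rfl
  have h2 : ∀ i, ∀ s ∈ Frame.support (repComps i),
      (![0, 1, 2, 0, 1, 0, 2, 0, 1, 2] : Fin 10 → Fin 3) (label (repOrder i) s.1 s.2) =
      order (repOrder i) s.2 := by decide +kernel
  rw [h1, Function.comp_apply, h2 i s hs]

theorem labelY_label (hv : AlgebraicIndependent ℤ v) (i : Fin 15) (s : Fin 4 × Fin 3)
    (hs : s ∈ Frame.support (repComps i)) :
    labelY v (label (repOrder i) s.1 s.2) = (repFrame hv (repOrder i)).T s.1 s.2 s.2 := by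
  -- Component 2 occurs only with the order 0. For the other orders its entries in `label` are
  -- placeholders and have to be excluded.
  have h1 : ∀ i, ∀ s ∈ Frame.support (repComps i), s ∈ Frame.support
      ((![{0, 1, 2, 3}, {0, 1, 3}, {0, 1, 3}, {0, 1, 3}] : Fin 4 → Finset (Fin 4)) (repOrder i)) := by
    decide +kernel
  replace hs := h1 i s hs
  clear h1
  generalize repOrder i = f at hs ⊢
  have h01 : v 0 - v 1 ≠ 0 := (repFrame hv 0).p_ne
  have h02 : v 0 - v 2 ≠ 0 := (repFrame hv 0).q_ne
  have h12 : v 1 - v 2 ≠ 0 := (repFrame hv 0).r_ne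
  have h10 : v 1 - v 0 ≠ 0 := (repFrame hv 2).p_ne
  have h20 : v 2 - v 0 ≠ 0 := (repFrame hv 3).p_ne
  have h21 : v 2 - v 1 ≠ 0 := (repFrame hv 1).r_ne
  obtain ⟨j, l⟩ := s
  fin_cases f <;> fin_cases j <;> fin_cases l <;>
    first
    | exact absurd hs (by decide +kernel)
    | rfl
    | (simp [labelY, label, Frame.T, repFrame, Frame.generic, order]
       field_simp
       ring)

end Generic

end CubicQuotient

/-! ### Separation of the labels. -/

namespace CubicQuotient

open Matrix MvPolynomial

section Separation

variable {K : Type*} [Field K] {v : Fin 3 → K}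

/-- Distinctness of two rational functions of the parameters is tested on the cross-multiplied
difference at `(1, 2, 5)`, which leaves a finite check on integers. -/
theorem aeval_div_ne (hv : AlgebraicIndependent ℤ v) {n d n' d' : MvPolynomial (Fin 3) ℤ}
    (hd : eval ![1, 2, 5] d ≠ 0) (hd' : eval ![1, 2, 5] d' ≠ 0)
    (h : eval ![1, 2, 5] n * eval ![1, 2, 5] d' ≠ eval ![1, 2, 5] n' * eval ![1, 2, 5] d) :
    aeval v n / aeval v d ≠ aeval v n' / aeval v d' := by
  have h0 := Function.injective_id (α := Fin 3)
  have hd₀ : aeval v d ≠ 0 := aeval_ne_zero hv h0 d hd rfl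
  have hd₁ : aeval v d' ≠ 0 := aeval_ne_zero hv h0 d' hd' rfl
  rw [Ne, div_eq_div_iff hd₀ hd₁, ← sub_eq_zero]
  refine aeval_ne_zero hv h0 (n * d' - n' * d) ?_ (by rw [map_sub, map_mul, map_mul]; rfl)
  rwa [map_sub, map_mul, map_mul, sub_ne_zero]

theorem labels_sep (hv : AlgebraicIndependent ℤ v) (l m : Fin 10) (hx : labelX v l = labelX v m)
    (hy : labelY v l = labelY v m) : l = m := by
  set g : Fin 10 → Fin 3 := ![0, 1, 2, 0, 1, 0, 2, 0, 1, 2] with hg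
  have hX : ∀ l, labelX v l = v (g l) := by
    intro l
    fin_cases l <;> rfl
  set n : Fin 10 → MvPolynomial (Fin 3) ℤ := ![X 0, X 1, X 2, -X 1 ^ 2, X 0 ^ 2, -X 2 ^ 2, X 0 ^ 2,
    X 1 * X 2 * (X 1 + X 2), -X 0 * X 2 * (X 0 + X 2), X 0 * X 1 * (X 0 + X 1)] with hn
  set d : Fin 10 → MvPolynomial (Fin 3) ℤ := ![1, 1, 1, X 0 - X 1, X 0 - X 1, X 0 - X 2, X 0 - X 2,
    (X 0 - X 1) * (X 0 - X 2), (X 0 - X 1) * (X 1 - X 2), (X 0 - X 2) * (X 1 - X 2)] with hd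
  have hY : ∀ l, labelY v l = aeval v (n l) / aeval v (d l) := by
    intro l
    fin_cases l <;> simp [labelY, hn, hd]
  have hn' : ∀ l, eval ![1, 2, 5] (n l) = (![1, 2, 5, -4, 1, -25, 1, 70, -30, 6] : Fin 10 → ℤ) l := by
    intro l
    fin_cases l <;> simp [hn]
  have hd' : ∀ l, eval ![1, 2, 5] (d l) = (![1, 1, 1, -1, -1, -4, -4, 4, 3, 12] : Fin 10 → ℤ) l := by
    intro l
    fin_cases l <;> simp [hd]
  have hd₀ : ∀ l, eval ![1, 2, 5] (d l) ≠ 0 := by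
    intro l
    rw [hd']
    revert l
    decide
  rw [hX, hX] at hx
  replace hx := hv.injective hx
  by_contra hlm
  rw [hY, hY] at hy
  refine aeval_div_ne hv (hd₀ l) (hd₀ m) ?_ hy
  rw [hn', hn', hd', hd']
  clear hX hY hn' hd' hy hd₀
  revert l m
  decide

end Separation

namespace Frame

variable {K : Type*} [Field K] (F : Frame K)

theorem e_injective : Function.Injective F.e := by
  have h1 : F.x ≠ F.y := sub_ne_zero.1 (F.p_eq ▸ F.p_ne)
  have h2 : F.x ≠ F.z := sub_ne_zero.1 (F.q_eq ▸ F.q_ne)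
  have h3 : F.y ≠ F.z := sub_ne_zero.1 (F.r_eq ▸ F.r_ne)
  intro l m h
  fin_cases l <;> fin_cases m <;>
    first
    | rfl
    | exact absurd h h1
    | exact absurd h h2
    | exact absurd h h3
    | exact absurd h.symm h1
    | exact absurd h.symm h2
    | exact absurd h.symm h3

end Frame

section Labelling

variable {K : Type*} [Field K] {v : Fin 3 → K}

theorem rep_mat_zero (hv : AlgebraicIndependent ℤ v) (i : Fin 15) :
    (rep hv i).mat 0 = diagonal fun s => (repFrame hv (repOrder i)).e s.1.2 :=
  submatrix_diagonal _ _ Subtype.val_injective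

theorem rep_mat_one (hv : AlgebraicIndependent ℤ v) (i : Fin 15) (s t : (rep hv i).V) :
    (rep hv i).mat 1 s t =
      if s.1.1 = t.1.1 then (repFrame hv (repOrder i)).T s.1.1 s.1.2 t.1.2 else 0 := rfl

theorem labelled_rep (hv : AlgebraicIndependent ℤ v) :
    Labelled (n := fun i => (rep hv i).V) (labelX v) (labelY v)
      (fun i s => label (repOrder i) s.1.1 s.1.2) (fun i => (rep hv i).mat 0)
      (fun i => (rep hv i).mat 1) where
  inj i s t h := Subtype.ext (label_injOn i s.1 t.1 s.2 t.2 h)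
  X_eq i := by
    rw [rep_mat_zero]
    congr 1
    funext s
    rw [repFrame_e, labelX_label i s.1 s.2]
  Y_diag i s := by
    rw [rep_mat_one, if_pos rfl, labelY_label hv i s.1 s.2]
  Y_off i s t hst h := by
    rw [labelX_label i s.1 s.2, labelX_label i t.1 t.2, ← repFrame_e hv, ← repFrame_e hv] at h
    rw [rep_mat_one, if_neg]
    exact fun h1 => hst (Subtype.ext (Prod.ext h1 (Frame.e_injective _ h)))
  sep := labels_sep hv

end Labelling

end CubicQuotient

/-! ### Connectedness of each representation and choice of the marks. -/

namespace CubicQuotient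

open Matrix MvPolynomial

namespace BlockData

variable {K : Type*} [Field K]

/-- Indices joined by nonzero entries of `s₂` or `s₃`. -/
def Joined (D : BlockData K) (s t : D.V) : Prop :=
  (D.mat 1 s t ≠ 0 ∧ D.mat 1 t s ≠ 0) ∨ (D.mat 2 s t ≠ 0 ∧ D.mat 2 t s ≠ 0)

/-- Indices connected by nonzero entries of `s₂` or `s₃`. -/
def Conn (D : BlockData K) : D.V → D.V → Prop := Relation.ReflTransGen D.Joined

theorem Joined.symm {D : BlockData K} {s t : D.V} (h : D.Joined s t) : D.Joined t s :=
  h.imp And.symm And.symm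

theorem Conn.symm {D : BlockData K} {s t : D.V} (h : D.Conn s t) : D.Conn t s := by
  induction h with
  | refl => exact Relation.ReflTransGen.refl
  | tail _ h' ih => exact Relation.ReflTransGen.head h'.symm ih

theorem Conn.trans {D : BlockData K} {s t u : D.V} (h : D.Conn s t) (h' : D.Conn t u) :
    D.Conn s u :=
  Relation.ReflTransGen.trans h h'

end BlockData

namespace Frame

variable {K : Type*} [Field K] (F : Frame K)

theorem T_ne_zero (i : Fin 4) (l m : Fin 3) (hl : (i, l) ∈ support {i}) (hm : (i, m) ∈ support {i})
    (hlm : l ≠ m) : F.T i l m ≠ 0 := by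
  fin_cases i <;> fin_cases l <;> fin_cases m <;>
    first
    | exact absurd rfl hlm
    | exact absurd hl (by decide)
    | exact absurd hm (by decide)
    | simp [T, F.x_ne, F.y_ne, F.z_ne, F.p_ne, F.q_ne, F.r_ne, F.A_ne, F.B_ne, F.C_ne, F.H_ne, F.G_ne]

variable {C : Finset (Fin 4)} {Z Z' : Fin 3 → Fin 4 → Fin 4 → K}

theorem conn_component {i : Fin 4} {l m : Fin 3} (hl : (i, l) ∈ support C)
    (hm : (i, m) ∈ support C) : (F.data C Z Z').Conn ⟨(i, l), hl⟩ ⟨(i, m), hm⟩ := by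
  by_cases hlm : l = m
  · subst hlm
    exact Relation.ReflTransGen.refl
  · refine Relation.ReflTransGen.single (Or.inl ⟨?_, ?_⟩)
    · have := F.T_ne_zero i l m (mem_support.1 hl).2 (mem_support.1 hm).2 hlm
      change (if i = i then F.T i l m else 0) ≠ 0
      rwa [if_pos rfl]
    · have := F.T_ne_zero i m l (mem_support.1 hm).2 (mem_support.1 hl).2 (Ne.symm hlm)
      change (if i = i then F.T i m l else 0) ≠ 0
      rwa [if_pos rfl]

theorem conn_eigenvalue {i j : Fin 4} {l : Fin 3} (hi : (i, l) ∈ support C)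
    (hj : (j, l) ∈ support C) (h : Z l i j ≠ 0) (h' : Z l j i ≠ 0) :
    (F.data C Z Z').Conn ⟨(i, l), hi⟩ ⟨(j, l), hj⟩ := by
  refine Relation.ReflTransGen.single (Or.inr ⟨?_, ?_⟩)
  · change (if l = l then Z l i j else 0) ≠ 0
    rwa [if_pos rfl]
  · change (if l = l then Z l j i else 0) ≠ 0
    rwa [if_pos rfl]

/-- The indices of one component are all joined by `s₂`, so only links between components, given by
`s₃`, have to be exhibited. -/
theorem conn_of_components {i₀ : Fin 4} {l₀ : Fin 3} (h₀ : (i₀, l₀) ∈ support C)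
    (h : ∀ i ∈ C, ∃ l, ∃ hl : (i, l) ∈ support C,
      (F.data C Z Z').Conn ⟨(i, l), hl⟩ ⟨(i₀, l₀), h₀⟩) (s t : (F.data C Z Z').V) :
    (F.data C Z Z').Conn s t := by
  have key : ∀ s : (F.data C Z Z').V, (F.data C Z Z').Conn s ⟨(i₀, l₀), h₀⟩ := by
    rintro ⟨⟨i, l⟩, hs⟩
    obtain ⟨m, hm, hconn⟩ := h i (mem_support.1 hs).1
    exact (F.conn_component hs hm).trans hconn
  exact (key s).trans (key t).symm

theorem conn_singleton {i₀ : Fin 4} {Z Z' : Fin 3 → Fin 4 → Fin 4 → K}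
    (s t : (F.data {i₀} Z Z').V) : (F.data {i₀} Z Z').Conn s t := by
  obtain ⟨⟨i, l⟩, hs⟩ := s
  obtain ⟨⟨j, m⟩, ht⟩ := t
  obtain rfl : i = i₀ := Finset.mem_singleton.1 (mem_support.1 hs).1
  obtain rfl : j = i := Finset.mem_singleton.1 (mem_support.1 ht).1
  exact F.conn_component hs ht

theorem conn_Z3 (h : F.x ^ 2 + F.y ^ 2 ≠ 0) (s t : (F.data {0, 1} F.Z3 Z').V) :
    (F.data {0, 1} F.Z3 Z').Conn s t := by
  refine F.conn_of_components (i₀ := 0) (l₀ := 0) (by decide) ?_ s t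
  intro i hi
  fin_cases hi
  · exact ⟨0, by decide, Relation.ReflTransGen.refl⟩
  · exact ⟨0, by decide, F.conn_eigenvalue _ _ (by simp [Z3, F.x_ne, F.y_ne, F.p_ne, F.H_ne, h]) (by simp [Z3])⟩

theorem conn_Z6 (h1 : F.y + F.z ≠ 0) (h2 : F.x + F.z ≠ 0) (h3 : F.y ^ 2 * F.z - F.x ^ 3 ≠ 0)
    (s t : (F.data {0, 1, 3} F.Z6 Z').V) : (F.data {0, 1, 3} F.Z6 Z').Conn s t := by
  have hZ : ∀ l i j, (l, i, j) ∈ ({(0, 0, 1), (0, 1, 0), (1, 1, 3), (1, 3, 1)} :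
      Finset (Fin 3 × Fin 4 × Fin 4)) → F.Z6 l i j ≠ 0 := by
    intro l i j h
    fin_cases h <;>
      simp [Z6, F.x_ne, F.y_ne, F.z_ne, F.p_ne, F.q_ne, F.r_ne, F.A_ne, F.B_ne, F.C_ne, F.H_ne,
        h1, h2, h3]
  refine F.conn_of_components (i₀ := 1) (l₀ := 0) (by decide) ?_ s t
  intro i hi
  fin_cases hi
  · exact ⟨0, by decide, F.conn_eigenvalue _ _ (hZ _ _ _ (by decide)) (hZ _ _ _ (by decide))⟩
  · exact ⟨0, by decide, Relation.ReflTransGen.refl⟩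
  · have h4 : ((1 : Fin 4), (1 : Fin 3)) ∈ support {0, 1, 3} := by decide
    exact ⟨1, by decide, (F.conn_eigenvalue _ h4 (hZ _ _ _ (by decide)) (hZ _ _ _ (by decide))).trans
      (F.conn_component _ _)⟩

/-- The component of dimension 3 is linked to the components 0, 1, 2 through `s₃` on the eigenvalues
`x`, `y`, `z` respectively. -/
theorem conn_Z8 (h1 : F.x ^ 2 * F.y - F.z ^ 3 ≠ 0) (h2 : F.x ^ 2 * F.z - F.y ^ 3 ≠ 0)
    (h3 : F.x ^ 4 + F.x ^ 2 * F.y * F.z + F.y ^ 2 * F.z ^ 2 ≠ 0)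
    (s t : (F.data {0, 1, 2, 3} F.Z8 Z').V) : (F.data {0, 1, 2, 3} F.Z8 Z').Conn s t := by
  have hZ : ∀ l i j, (l, i, j) ∈ ({(0, 0, 3), (0, 3, 0), (1, 1, 3), (1, 3, 1), (2, 2, 3),
      (2, 3, 2)} : Finset (Fin 3 × Fin 4 × Fin 4)) → F.Z8 l i j ≠ 0 := by
    intro l i j h
    fin_cases h <;>
      simp [Z8, F.x_ne, F.y_ne, F.z_ne, F.p_ne, F.q_ne, F.r_ne, F.A_ne, F.B_ne, F.C_ne, F.H_ne,
        F.G_ne, h1, h2, h3]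
  refine F.conn_of_components (i₀ := 3) (l₀ := 0) (by decide) ?_ s t
  intro i hi
  fin_cases hi
  · exact ⟨0, by decide, F.conn_eigenvalue _ _ (hZ _ _ _ (by decide)) (hZ _ _ _ (by decide))⟩
  · have h4 : ((3 : Fin 4), (1 : Fin 3)) ∈ support {0, 1, 2, 3} := by decide
    exact ⟨1, by decide, (F.conn_eigenvalue _ h4 (hZ _ _ _ (by decide)) (hZ _ _ _ (by decide))).trans
      (F.conn_component _ _)⟩
  · have h4 : ((3 : Fin 4), (2 : Fin 3)) ∈ support {0, 1, 2, 3} := by decide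
    exact ⟨2, by decide, (F.conn_eigenvalue _ h4 (hZ _ _ _ (by decide)) (hZ _ _ _ (by decide))).trans
      (F.conn_component _ _)⟩
  · exact ⟨0, by decide, Relation.ReflTransGen.refl⟩

end Frame

section Generic

variable {K : Type*} [Field K] {v : Fin 3 → K}

theorem conn_rep (hv : AlgebraicIndependent ℤ v) (i : Fin 15) (s t : (rep hv i).V) :
    (rep hv i).Conn s t := by
  have h1 : ∀ f, (repFrame hv f).x ^ 2 + (repFrame hv f).y ^ 2 ≠ 0 := fun f =>
    aeval_ne_zero hv (order_injective f) (X 0 ^ 2 + X 1 ^ 2) (by simp)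
      (by simp [repFrame, Frame.generic])
  have h2 : ∀ f, (repFrame hv f).y + (repFrame hv f).z ≠ 0 := fun f =>
    aeval_ne_zero hv (order_injective f) (X 1 + X 2) (by simp) (by simp [repFrame, Frame.generic])
  have h3 : ∀ f, (repFrame hv f).x + (repFrame hv f).z ≠ 0 := fun f =>
    aeval_ne_zero hv (order_injective f) (X 0 + X 2) (by simp) (by simp [repFrame, Frame.generic])
  have h4 : ∀ f, (repFrame hv f).y ^ 2 * (repFrame hv f).z - (repFrame hv f).x ^ 3 ≠ 0 := fun f =>
    aeval_ne_zero hv (order_injective f) (X 1 ^ 2 * X 2 - X 0 ^ 3) (by simp)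
      (by simp [repFrame, Frame.generic])
  have h5 : ∀ f, (repFrame hv f).x ^ 2 * (repFrame hv f).y - (repFrame hv f).z ^ 3 ≠ 0 := fun f =>
    aeval_ne_zero hv (order_injective f) (X 0 ^ 2 * X 1 - X 2 ^ 3) (by simp)
      (by simp [repFrame, Frame.generic])
  have h6 : ∀ f, (repFrame hv f).x ^ 2 * (repFrame hv f).z - (repFrame hv f).y ^ 3 ≠ 0 := fun f =>
    aeval_ne_zero hv (order_injective f) (X 0 ^ 2 * X 2 - X 1 ^ 3) (by simp)
      (by simp [repFrame, Frame.generic])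
  have h7 : ∀ f, (repFrame hv f).x ^ 4 + (repFrame hv f).x ^ 2 * (repFrame hv f).y *
      (repFrame hv f).z + (repFrame hv f).y ^ 2 * (repFrame hv f).z ^ 2 ≠ 0 := fun f =>
    aeval_ne_zero hv (order_injective f) (X 0 ^ 4 + X 0 ^ 2 * X 1 * X 2 + X 1 ^ 2 * X 2 ^ 2)
      (by simp) (by simp [repFrame, Frame.generic])
  fin_cases i
  · exact Frame.conn_singleton _ _ _
  · exact Frame.conn_Z6 _ (h2 _) (h3 _) (h4 _) _ _
  · exact Frame.conn_Z6 _ (h2 _) (h3 _) (h4 _) _ _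
  · exact Frame.conn_Z6 _ (h2 _) (h3 _) (h4 _) _ _
  · exact Frame.conn_Z6 _ (h2 _) (h3 _) (h4 _) _ _
  · exact Frame.conn_Z8 _ (h5 _) (h6 _) (h7 _) _ _
  · exact Frame.conn_singleton _ _ _
  · exact Frame.conn_Z3 _ (h1 _) _ _
  · exact Frame.conn_Z3 _ (h1 _) _ _
  · exact Frame.conn_singleton _ _ _
  · exact Frame.conn_Z3 _ (h1 _) _ _
  · exact Frame.conn_Z3 _ (h1 _) _ _
  · exact Frame.conn_singleton _ _ _
  · exact Frame.conn_singleton _ _ _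
  · exact Frame.conn_singleton _ _ _

/-- The indices of the representations at which they are told apart. -/
def mark : Fin 15 → Fin 10 := ![8, 8, 8, 8, 8, 8, 3, 3, 3, 5, 5, 5, 0, 1, 2]

/-- The index with a given label. -/
def markIndex (l : Fin 10) (f : Fin 4) : Fin 4 × Fin 3 :=
  if l = 8 then (![(3, 1), (3, 2), (3, 0), (3, 2)] : Fin 4 → Fin 4 × Fin 3) f
  else if l = 3 then (![(1, 0), (1, 0), (1, 1), (1, 0)] : Fin 4 → Fin 4 × Fin 3) f
  else if l = 5 then (![(2, 0), (1, 0), (1, 0), (1, 1)] : Fin 4 → Fin 4 × Fin 3) f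
  else (0, 0)

theorem eq_markIndex (i j : Fin 15) (s : Fin 4 × Fin 3) (hs : s ∈ Frame.support (repComps j))
    (h : label (repOrder j) s.1 s.2 = mark i) : s = markIndex (mark i) (repOrder j) := by
  revert i j s
  decide +kernel

theorem markIndex_mem (i : Fin 15) :
    markIndex (mark i) (repOrder i) ∈ Frame.support (repComps i) := by
  revert i
  decide +kernel

theorem label_markIndex (i : Fin 15) : label (repOrder i) (markIndex (mark i) (repOrder i)).1
    (markIndex (mark i) (repOrder i)).2 = mark i := by
  revert i
  decide +kernel

end Generic

end CubicQuotient

/-! ### Density of `Q 4` in the matrix algebras, and linear independence. -/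

namespace CubicQuotient

open Matrix MvPolynomial

section Generic

variable {K : Type*} [Field K] {v : Fin 3 → K}

/-- The entry of `s₃` that tells a representation apart. -/
def markValue (hv : AlgebraicIndependent ℤ v) (l : Fin 10) (j : Fin 15) : K :=
  repZ (repFrame hv (repOrder j)) j (markIndex l (repOrder j)).2 (markIndex l (repOrder j)).1
    (markIndex l (repOrder j)).1

/-- Representations with a common mark have distinct diagonal entries of `s₃` there; as for the
labels, the point `(1, 2, 5)` suffices to see it. -/
theorem eq_of_markValue_eq (hv : AlgebraicIndependent ℤ v) (i j : Fin 15) (hij : mark i = mark j)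
    (h : markValue hv (mark i) i = markValue hv (mark j) j) : i = j := by
  set n : Fin 15 → MvPolynomial (Fin 3) ℤ := ![X 1, X 0 * X 1 * (X 0 + X 1), X 0,
    X 1 ^ 3 * (X 1 + X 0) * (X 0 + X 2), X 2, X 0 * X 1 * (X 0 + X 2), X 0, X 0 ^ 3, X 1, X 0,
    X 0 ^ 3, X 2, X 0, X 1, X 2] with hn
  set d : Fin 15 → MvPolynomial (Fin 3) ℤ := ![1, X 2 ^ 2 + X 0 * X 1, 1,
    (X 2 ^ 2 + X 1 * X 0) * (X 1 ^ 2 + X 0 * X 2), 1, X 2 ^ 2 + X 0 * X 1, 1,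
    X 0 ^ 2 - X 0 * X 1 + X 1 ^ 2, 1, 1, X 0 ^ 2 - X 0 * X 2 + X 2 ^ 2, 1, 1, 1, 1] with hd
  have hw : ∀ i, markValue hv (mark i) i = aeval v (n i) / aeval v (d i) := by
    intro i
    fin_cases i
    · change v 1 = _
      simp [hn, hd]
    · change v 0 * v 1 * (v 0 + v 1) / (v 2 ^ 2 + v 0 * v 1) = _
      simp [hn, hd]
    · change v 0 = _
      simp [hn, hd]
    · change v 1 ^ 3 * (v 1 + v 0) * (v 0 + v 2) /
        ((v 2 ^ 2 + v 1 * v 0) * (v 1 ^ 2 + v 0 * v 2)) = _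
      simp [hn, hd]
    · change v 2 = _
      simp [hn, hd]
    · change v 0 * v 1 * (v 0 + v 2) / (v 2 ^ 2 + v 0 * v 1) = _
      simp [hn, hd]
    · change v 0 = _
      simp [hn, hd]
    · change v 0 ^ 3 / (v 0 ^ 2 - v 0 * v 1 + v 1 ^ 2) = _
      simp [hn, hd]
    · change v 1 = _
      simp [hn, hd]
    · change v 0 = _
      simp [hn, hd]
    · change v 0 ^ 3 / (v 0 ^ 2 - v 0 * v 2 + v 2 ^ 2) = _
      simp [hn, hd]
    · change v 2 = _
      simp [hn, hd]
    · change v 0 = _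
      simp [hn, hd]
    · change v 1 = _
      simp [hn, hd]
    · change v 2 = _
      simp [hn, hd]
  have hn' : ∀ i, eval ![1, 2, 5] (n i) =
      (![2, 6, 1, 144, 5, 12, 1, 1, 2, 1, 1, 5, 1, 2, 5] : Fin 15 → ℤ) i := by
    intro l
    fin_cases l <;> simp [hn]
  have hd' : ∀ i, eval ![1, 2, 5] (d i) =
      (![1, 27, 1, 243, 1, 27, 1, 3, 1, 1, 21, 1, 1, 1, 1] : Fin 15 → ℤ) i := by
    intro l
    fin_cases l <;> simp [hd]
  have hd₀ : ∀ i, eval ![1, 2, 5] (d i) ≠ 0 := by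
    intro i
    rw [hd']
    revert i
    decide
  by_contra hne
  rw [hw, hw] at h
  refine aeval_div_ne hv (hd₀ i) (hd₀ j) ?_ h
  rw [hn', hn', hd', hd']
  clear hw hn' hd' h hd₀
  revert i j
  decide

/-- The order in which the representations are told apart. -/
def stage : Fin 15 → ℕ := ![0, 0, 0, 0, 0, 0, 1, 1, 1, 1, 1, 1, 2, 2, 2]

theorem mark_eq_of_label_eq (i j : Fin 15) (s : Fin 4 × Fin 3)
    (hs : s ∈ Frame.support (repComps j)) (h : label (repOrder j) s.1 s.2 = mark i)
    (hij : stage i ≤ stage j) : mark i = mark j := by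
  revert i j s
  decide +kernel

/-- Induction on the stage. The label 8 (eigenvalue `b` in the constituent of dimension 3) occurs
only in the six representations marked by it. The labels 3 and 5 (eigenvalue `a` in the constituents
`{a, b}` and `{a, c}`), and then those of the constituents of dimension 1, occur otherwise only in
representations of earlier stages, whose matrix units are already in `𝒜`. One diagonal unit then
spreads over its block by connectedness. -/
theorem subalgebra_eq_top (hv : AlgebraicIndependent ℤ v)
    {𝒜 : Subalgebra K (∀ i, Matrix (rep hv i).V (rep hv i).V K)}
    (h : ∀ k, (fun i => (rep hv i).mat k) ∈ 𝒜) : 𝒜 = ⊤ := by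
  apply Labelled.eq_top_of_unit_mem
  have key : ∀ m, ∀ i, stage i = m → ∀ k l : (rep hv i).V, unit K i k l ∈ 𝒜 := by
    intro m
    induction m using Nat.strong_induction_on with
    | _ m ih =>
      intro i him
      refine (labelled_rep hv).unit_mem_of_linked (h 0) (h 1) (h 2)
        (k₀ := ⟨markIndex (mark i) (repOrder i), markIndex_mem i⟩) ?_ (fun t => conn_rep hv i _ t)
      refine (labelled_rep hv).unit_mem (h 0) (h 1) (h 2) (D := {j | stage j < m})
        (w := markValue hv (mark i))
        (fun j hj k => ih _ hj j rfl k k) (by simp [him]) ?_ ?_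
      · rintro j ⟨s, hs⟩ hlab
        rw [label_markIndex] at hlab
        obtain rfl := eq_markIndex i j s hs hlab
        change (if _ then _ else _) = _
        rw [if_pos rfl]
        rfl
      · rintro j hj hji ⟨s, hs⟩ hlab hval
        rw [label_markIndex] at hlab
        have h1 := mark_eq_of_label_eq i j s hs hlab (by simpa [him] using hj)
        refine hji (eq_of_markValue_eq hv j i h1.symm ?_)
        rw [← h1, hval]
  exact fun i k l => key _ i rfl k l

theorem finrank_rep (hv : AlgebraicIndependent ℤ v) :
    Module.finrank K (∀ i, Matrix (rep hv i).V (rep hv i).V K) = 264 := by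
  rw [Module.finrank_pi_fintype]
  simp only [Module.finrank_matrix, Module.finrank_self, mul_one, Fintype.card_coe]
  change ∑ i, (Frame.support (repComps i)).card * (Frame.support (repComps i)).card = 264
  decide +kernel

/-- The image of `Q 4` is closed under products, so its `K`-span is the `K`-algebra it generates, to
which `subalgebra_eq_top` applies. -/
theorem exists_linearMap_span_eq_top [Algebra R K] (hv : AlgebraicIndependent ℤ v)
    (ha : v 0 = algebraMap R K a) (hb : v 1 = algebraMap R K b) (hc : v 2 = algebraMap R K c) :
    ∃ φ : Q 4 →ₗ[R] (∀ i, Matrix (rep hv i).V (rep hv i).V K),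
      Submodule.span K (Set.range φ) = ⊤ := by
  have ha' : (v 0)⁻¹ = algebraMap R K (↑a⁻¹ : R) := by
    rw [ha, inv_eq_iff_eq_inv, eq_comm]
    exact inv_eq_of_mul_eq_one_left (by rw [← map_mul, Units.mul_inv, map_one])
  let u : Fin 3 → (∀ i, Matrix (rep hv i).V (rep hv i).V K)ˣ := fun k =>
    ⟨fun i => (rep hv i).mat k, fun i => (rep hv i).matInv k,
      funext fun i => (isRep_rep hv i).mat_mul_matInv k,
      funext fun i => mul_eq_one_comm.1 ((isRep_rep hv i).mat_mul_matInv k)⟩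
  obtain ⟨φ, h1, h2, h3⟩ := exists_algHom_Q₄ u
    (Units.ext (funext fun i => (isRep_rep hv i).braid_zero_one))
    (Units.ext (funext fun i => (isRep_rep hv i).braid_one_two))
    (Units.ext (funext fun i => (isRep_rep hv i).comm_zero_two))
    (funext fun i => by
      have := (isRep_rep hv i).cubic_mat
      rw [ha, hb, hc] at this
      simp only [← IsScalarTower.algebraMap_apply] at this
      exact this)
    (funext fun i => by
      have := (isRep_rep hv i).three_mat
      rw [ha', ha] at this
      simp only [← map_pow, algebraMap_smul] at this
      exact this)
  refine ⟨φ.toLinearMap, ?_⟩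
  set M : Submonoid (∀ i, Matrix (rep hv i).V (rep hv i).V K) := MonoidHom.mrange (φ : Q 4 →* _)
    with hM
  have h4 : Algebra.adjoin K (M : Set (∀ i, Matrix (rep hv i).V (rep hv i).V K)) = ⊤ := by
    refine subalgebra_eq_top hv fun k => Algebra.subset_adjoin ?_
    fin_cases k
    exacts [⟨_, h1⟩, ⟨_, h2⟩, ⟨_, h3⟩]
  have h5 := congrArg Subalgebra.toSubmodule h4
  rw [Algebra.adjoin_eq_span, Submonoid.closure_eq, Algebra.top_toSubmodule] at h5
  exact h5

end Generic

/-- The images of `w` span `N` over `K` and are as many as its dimension, hence independent over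
`K`, so over `S`; a relation between the `w` would map to one between the images. -/
theorem linearIndependent_of_span_range_eq_top {S K M N ι : Type*} [CommRing S] [Field K]
    [Algebra S K] (hS : Function.Injective (algebraMap S K)) [AddCommMonoid M] [Module S M]
    [AddCommGroup N] [Module K N] [Module S N] [IsScalarTower S K N] {φ : M →ₗ[S] N}
    (hφ : Submodule.span K (Set.range φ) = ⊤) [Fintype ι]
    (hι : Fintype.card ι = Module.finrank K N) {w : ι → M}
    (hw : Submodule.span S (Set.range w) = ⊤) : LinearIndependent S w := by
  have h1 : ⊤ ≤ Submodule.span K (Set.range (φ ∘ w)) := by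
    rw [← hφ, Submodule.span_le]
    rintro _ ⟨x, rfl⟩
    have hx : x ∈ Submodule.span S (Set.range w) := hw ▸ Submodule.mem_top
    have h2 := Submodule.mem_map_of_mem (f := φ) hx
    rw [Submodule.map_span, ← Set.range_comp] at h2
    exact Submodule.span_le_restrictScalars S K _ h2
  have h2 := linearIndependent_of_top_le_span_of_card_eq_finrank h1 hι
  have h3 : LinearIndependent S (φ ∘ w) := h2.restrict_scalars fun r s hrs =>
    hS (by simpa [Algebra.smul_def] using hrs)
  exact LinearIndependent.of_comp φ h3

theorem powers_le_nonZeroDivisors :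
    Submonoid.powers (X 0 * X 1 * X 2 : MvPolynomial (Fin 3) ℤ) ≤
      nonZeroDivisors (MvPolynomial (Fin 3) ℤ) :=
  powers_le_nonZeroDivisors_of_noZeroDivisors
    (mul_ne_zero (mul_ne_zero (X_ne_zero 0) (X_ne_zero 1)) (X_ne_zero 2))

instance : IsDomain R := IsLocalization.isDomain_localization powers_le_nonZeroDivisors

theorem algebraicIndependent_of_algebraMap {S K : Type*} [CommRing S] [Field K]
    [Algebra (MvPolynomial (Fin 3) ℤ) S] [Algebra S K]
    (h1 : Function.Injective (algebraMap (MvPolynomial (Fin 3) ℤ) S))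
    (h2 : Function.Injective (algebraMap S K)) :
    AlgebraicIndependent ℤ fun i => algebraMap S K (algebraMap (MvPolynomial (Fin 3) ℤ) S (X i)) := by
  have h : ∀ p, aeval (fun i => algebraMap S K (algebraMap (MvPolynomial (Fin 3) ℤ) S (X i))) p =
      algebraMap S K (algebraMap (MvPolynomial (Fin 3) ℤ) S p) := by
    intro p
    have : (aeval fun i => algebraMap S K (algebraMap (MvPolynomial (Fin 3) ℤ) S (X i)) :
        MvPolynomial (Fin 3) ℤ →ₐ[ℤ] K).toRingHom =
        (algebraMap S K).comp (algebraMap (MvPolynomial (Fin 3) ℤ) S) := by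
      apply MvPolynomial.ringHom_ext
      · intro r
        simp
      · intro i
        simp
    exact congrArg (fun f => f p) this
  intro p q hpq
  rw [h, h] at hpq
  exact h1 (h2 hpq)

/-- A spanning family of `264` elements of `Q 4` is linearly independent. -/
theorem linearIndependent_of_span_eq_top {ι : Type} [Fintype ι] (hι : Fintype.card ι = 264)
    {w : ι → Q 4} (hw : Submodule.span R (Set.range w) = ⊤) : LinearIndependent R w := by
  have hS := IsFractionRing.injective R (FractionRing R)
  have hv := algebraicIndependent_of_algebraMap
    (IsLocalization.injective R powers_le_nonZeroDivisors) hS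
  obtain ⟨φ, hφ⟩ := exists_linearMap_span_eq_top hv rfl rfl rfl
  exact linearIndependent_of_span_range_eq_top hS hφ
    (hι.trans (finrank_rep hv).symm) hw

end CubicQuotient

/-! ### Conclusion. -/

namespace CubicQuotient

theorem free_and_finrank_of_basis {S M ι : Type*} [CommRing S] [Nontrivial S] [AddCommMonoid M]
    [Module S M] [Fintype ι] {w : ι → M} (h1 : LinearIndependent S w)
    (h2 : Submodule.span S (Set.range w) = ⊤) :
    Module.Free S M ∧ Module.finrank S M = Fintype.card ι :=
  let B := Module.Basis.mk h1 h2.ge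
  ⟨Module.Free.of_basis B, Module.finrank_eq_card_basis B⟩

theorem isBasisOf_family₂ {B₀ : Fin 20 → Q 4}
    (hB : Submodule.span R (Set.range B₀) = Subalgebra.toSubmodule Q₃) :
    IsBasisOf (family₂ B₀) ⊤ :=
  ⟨linearIndependent_of_span_eq_top card_Idx₂ (span_family₂ hB), span_family₂ hB⟩

/-- The twenty words form a subfamily of the family `𝓑₂` built on them, whose independence uses only
that they span `Q_3`. -/
theorem isBasisOf_wordsQ₃ :
    IsBasisOf (fun i => toQ (wordsQ₃ i)) (Subalgebra.toSubmodule Q₃) := by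
  refine ⟨?_, span_wordsQ₃⟩
  have h := (isBasisOf_family₂ span_wordsQ₃).1
  exact h.comp (fun i => Sum.inl (Sum.inl i)) fun i j hij => Sum.inl_injective (Sum.inl_injective hij)

end CubicQuotient

theorem mainTheorem1 :
    Module.Free CubicQuotient.R (CubicQuotient.Q 4) ∧
    Module.finrank CubicQuotient.R (CubicQuotient.Q 4) = 264 ∧
    -- an explicit basis of `Q_3` by words, which is one possible choice of `B₀` below
    CubicQuotient.IsBasisOf (fun i => CubicQuotient.toQ (CubicQuotient.wordsQ₃ i))
      (Subalgebra.toSubmodule CubicQuotient.Q₃) ∧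
    -- for every basis `B₀` of `Q_3`
    ∀ B₀ : Fin 20 → CubicQuotient.Q 4,
      CubicQuotient.IsBasisOf B₀ (Subalgebra.toSubmodule CubicQuotient.Q₃) →
      CubicQuotient.IsBasisOf (CubicQuotient.family₂ B₀) ⊤ ∧
      Submodule.span CubicQuotient.R (Set.range (CubicQuotient.family₁ B₀)) =
        CubicQuotient.Q₃u₃Q₃ ∧
      Submodule.span CubicQuotient.R (Set.range fun i =>
        CubicQuotient.Q₃u₃Q₃.mkQ (CubicQuotient.toQ (CubicQuotient.wordsTop i))) = ⊤ := by
  have h := CubicQuotient.isBasisOf_family₂ CubicQuotient.span_wordsQ₃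
  have h' := CubicQuotient.free_and_finrank_of_basis h.1 h.2
  exact ⟨h'.1, h'.2.trans CubicQuotient.card_Idx₂, CubicQuotient.isBasisOf_wordsQ₃,
    fun B₀ hB => ⟨CubicQuotient.isBasisOf_family₂ hB.2, CubicQuotient.span_family₁ hB.2,
      CubicQuotient.span_mkQ_wordsTop⟩⟩
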